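/- An outer-1-planar embedding of a (finite, simple) graph $G$ is given by a drawing of $G$ in the plane in which every edge is crossed at most once, edges with a common endpoint do not cross, and all vertices are incident to the outer (unbounded) face; two drawings define the same embedding if their planarizations (obtained by replacing each crossing by a dummy vertex) have the same rotation system, hence the same facial circuits, and the same outer face. An outer-1-plane graph is a graph with a given outer-1-planar embedding. A bar visibility representation of $G$ assigns to the vertices pairwise disjoint bars (horizontal segments or points) and to every edge a horizontal or vertical segment that joins the bars of its endpoints and meets no bar except at its two ends, such that edges do not overlap (crossings are allowed), and such that the endpoints of all bars and edge segments are points of the integer grid. Its area is the number of grid columns that meet it times the number of grid rows that meet it. It is embedding-preserving if, walking around each bar, we meet the incident edges in the cyclic order of the given embedding, and its planarization has the same faces (in particular the same crossings and the same outer face) as the given embedding. Theorem 5. (a) There is a constant $C$ such that every outer-1-plane graph with $n$ vertices has an embedding-preserving bar visibility representation of area at most $C n^2$. (b) This is worst-case optimal: there is a constant $c>0$ such that for every $N$ there are an $n\ge N$ and an outer-1-plane graph with $n$ vertices all of whose embedding-preserving bar visibility representations have area at least $c n^2$. -/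

import Mathlib

/-- A rotation system, with crossings, of a simple graph in which every edge is crossed at most
once: the combinatorial description of a drawing of `G` on an oriented surface. An edge is given
by its two darts (directions).
* `rot d` is the next dart after `d` in counterclockwise order around the tail of `d`; thus the
  darts at every vertex form one cycle.
* `crossed` is the set of darts of crossed edges, and `cross d` is the one edge that crosses `d`,
  directed such that it crosses `d` from the right of `d` to the left of `d`.
As usual, edges with a common endpoint do not cross. -/
structure OnePlaneMap {V : Type*} (G : SimpleGraph V) where
  rot : Equiv.Perm G.Dart
  rot_isCycleOn : ∀ v : V, rot.IsCycleOn {d | d.fst = v}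
  crossed : Set G.Dart
  cross : Equiv.Perm crossed
  /-- Seen from `cross d`, the edge of `d` passes from right to left in the direction opposite
  to `d`. -/
  cross_cross : ∀ d : crossed, (cross (cross d) : G.Dart) = (d : G.Dart).symm
  cross_disjoint : ∀ d : crossed, ∀ v ∈ (d : G.Dart).edge, v ∉ (cross d : G.Dart).edge

namespace OnePlaneMap

variable {V : Type*} {G : SimpleGraph V} (M : OnePlaneMap G)

/-- The darts of the planarization (each crossing is replaced by a dummy vertex).
`Sum.inl d` is the first piece of `d`: it leaves the tail of `d`, and ends at the crossing of `d`,
or at the head of `d` if `d` is not crossed.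
`Sum.inr d` is the second piece of a crossed dart `d`: it leads from the crossing to the head. -/
abbrev Piece : Type _ := G.Dart ⊕ M.crossed

/-- The counterclockwise rotation around the vertices of the planarization (the vertices of `G`
and the crossings). -/
def vertexPerm : Equiv.Perm M.Piece := Equiv.Perm.sumCongr M.rot M.cross

theorem symm_mem_crossed {d : G.Dart} (h : d ∈ M.crossed) : d.symm ∈ M.crossed := by
  rw [← M.cross_cross ⟨d, h⟩]
  exact (M.cross (M.cross ⟨d, h⟩)).2

open Classical in
/-- Reversal of a dart of the planarization. -/
noncomputable def reverse : M.Piece → M.Piece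
  | Sum.inl d => if h : d.symm ∈ M.crossed then Sum.inr ⟨d.symm, h⟩ else Sum.inl d.symm
  | Sum.inr d => Sum.inl (d : G.Dart).symm

theorem reverse_involutive : Function.Involutive M.reverse := by
  rintro (d | ⟨d, hd⟩)
  · by_cases h : d.symm ∈ M.crossed
    · simp [reverse, h]
    · have h' : d ∉ M.crossed := fun hd => h (M.symm_mem_crossed hd)
      simp [reverse, h, h']
  · simp [reverse, hd]

/-- Reversal of darts, as a permutation; its orbits are the edges of the planarization. -/
noncomputable def edgePerm : Equiv.Perm M.Piece := M.reverse_involutive.toPerm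

/-- The successor of a dart on the boundary walk of the face to its left: at the end of the dart,
continue with the next dart in clockwise order. -/
noncomputable def facePerm : Equiv.Perm M.Piece := M.vertexPerm⁻¹ * M.edgePerm

/-- Two darts of the planarization are linked if one is obtained from the other by rotation or
reversal; the classes of the generated equivalence are the connected components of the
planarization (without the isolated vertices). -/
def Linked (p q : M.Piece) : Prop := q = M.vertexPerm p ∨ q = M.edgePerm p

/-- The set of connected components, isolated vertices excluded, of the planarization. -/
abbrev Component : Type _ := Quot M.Linked

/-- The set of orbits of a permutation. -/
abbrev Orbits {α : Type*} (f : Equiv.Perm α) : Type _ := Quotient (Equiv.Perm.SameCycle.setoid f)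

/-- The surface is a union of spheres, one for each component of the planarization:
Euler's formula `#vertices - #edges + #faces = 2 · #components`. (Isolated vertices would
contribute one vertex, one face and one component.) -/
def IsPlanar : Prop :=
  Nat.card (Orbits M.vertexPerm) + Nat.card (Orbits M.facePerm) =
    Nat.card (Orbits M.edgePerm) + 2 * Nat.card M.Component

end OnePlaneMap

/-- An outer-1-planar embedding of `G`: a planar embedding with at most one crossing per edge,
and with a choice of the outer face, such that all vertices are on the outer face.
The outer face is given by the set `outer` of those darts of the planarization that have it on
their left: for every component of the planarization, this is the boundary walk of one of its
faces. (All components lie in the outer face of each other, because all vertices are on the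
outer face.) -/
structure OuterOnePlane {V : Type*} (G : SimpleGraph V) extends OnePlaneMap G where
  planar : toOnePlaneMap.IsPlanar
  outer : Set toOnePlaneMap.Piece
  facePerm_mem_outer : ∀ p, toOnePlaneMap.facePerm p ∈ outer ↔ p ∈ outer
  outer_sameCycle : ∀ p ∈ outer, ∀ q ∈ outer,
    (Quot.mk _ p : toOnePlaneMap.Component) = Quot.mk _ q → toOnePlaneMap.facePerm.SameCycle p q
  vertex_outer : ∀ d : G.Dart, ∃ e : G.Dart, e.fst = d.fst ∧ Sum.inl e ∈ outer

/-- The point of the plane with the given integer coordinates. -/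
def gridPoint (p : ℤ × ℤ) : ℝ × ℝ := ((p.1 : ℝ), (p.2 : ℝ))

/-- A (bi-directional) bar visibility representation of `G` on the integer grid.
Vertex `v` is drawn as the bar (horizontal segment or point) from `(left v, row v)` to
`(right v, row v)`. The edge of the dart `d` is drawn as the horizontal or vertical segment from
`attach d`, on the bar of the tail of `d`, to `attach d.symm`, on the bar of the head of `d`.
The bars are disjoint, edges meet bars only at their ends, and no two edges overlap. -/
structure BarVisRep {V : Type*} (G : SimpleGraph V) where
  left : V → ℤ
  right : V → ℤ
  row : V → ℤ
  left_le_right : ∀ v, left v ≤ right v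
  attach : G.Dart → ℤ × ℤ
  left_le_attach : ∀ d, left d.fst ≤ (attach d).1
  attach_le_right : ∀ d, (attach d).1 ≤ right d.fst
  attach_row : ∀ d, (attach d).2 = row d.fst
  axis_parallel : ∀ d, (attach d).1 = (attach d.symm).1 ∨ (attach d).2 = (attach d.symm).2
  bars_disjoint : ∀ v w, v ≠ w →
    Disjoint (Set.Icc (left v : ℝ) (right v) ×ˢ {(row v : ℝ)})
      (Set.Icc (left w : ℝ) (right w) ×ˢ {(row w : ℝ)})
  edge_disjoint_bar : ∀ d v,
    Disjoint (openSegment ℝ (gridPoint (attach d)) (gridPoint (attach d.symm)))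
      (Set.Icc (left v : ℝ) (right v) ×ˢ {(row v : ℝ)})
  edges_no_overlap : ∀ d e, d.edge ≠ e.edge →
    (openSegment ℝ (gridPoint (attach d)) (gridPoint (attach d.symm)) ∩
      openSegment ℝ (gridPoint (attach e)) (gridPoint (attach e.symm))).Subsingleton

namespace BarVisRep

variable {V : Type*} {G : SimpleGraph V} (Γ : BarVisRep G)

/-- The bar of a vertex. -/
def bar (v : V) : Set (ℝ × ℝ) := Set.Icc (Γ.left v : ℝ) (Γ.right v) ×ˢ {(Γ.row v : ℝ)}

/-- The end of `d` on the bar of its tail, as a point of the plane. -/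
def tailPt (d : G.Dart) : ℝ × ℝ := gridPoint (Γ.attach d)

/-- The interior of the segment that represents an edge. -/
def edgeSeg (d : G.Dart) : Set (ℝ × ℝ) := openSegment ℝ (Γ.tailPt d) (Γ.tailPt d.symm)

/-- The set of all points of the representation. -/
def drawing : Set (ℝ × ℝ) := (⋃ v, Γ.bar v) ∪ ⋃ d, Γ.edgeSeg d

/-- The number of grid columns that intersect the representation. -/
noncomputable def width : ℕ := {x : ℤ | ∃ p ∈ Γ.drawing, p.1 = (x : ℝ)}.ncard

/-- The number of grid rows that intersect the representation. -/
noncomputable def height : ℕ := {y : ℤ | ∃ p ∈ Γ.drawing, p.2 = (y : ℝ)}.ncard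

noncomputable def area : ℕ := Γ.width * Γ.height

/-- The vector from the tail end to the head end of a dart. -/
def dir (d : G.Dart) : ℤ × ℤ := Γ.attach d.symm - Γ.attach d

/-- The place of a dart on a counterclockwise walk around the bar of its tail:
first the right end, then the top side from right to left, then the left end, and then the bottom
side from left to right. -/
def place (d : G.Dart) : ℤ :=
  let l := Γ.left d.fst
  let r := Γ.right d.fst
  let x := (Γ.attach d).1
  if (Γ.dir d).2 = 0 then
    if 0 < (Γ.dir d).1 then 0 else (r - l) + 2
  else
    if 0 < (Γ.dir d).2 then 1 + (r - x) else (r - l) + 3 + (x - l)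

/-- In the representation, `e` crosses `d` from the right of `d` to the left of `d`. -/
def CrossesFromRight (d e : G.Dart) : Prop :=
  (Γ.edgeSeg d ∩ Γ.edgeSeg e).Nonempty ∧
    0 < (Γ.dir d).1 * (Γ.dir e).2 - (Γ.dir d).2 * (Γ.dir e).1

/-- The unbounded region of the representation. -/
def outerRegion : Set (ℝ × ℝ) :=
  {p | p ∈ Γ.drawingᶜ ∧ ¬ Bornology.IsBounded (connectedComponentIn Γ.drawingᶜ p)}

/-- The vector to the left of the direction of `d`. -/
def leftNormal (d : G.Dart) : ℝ × ℝ := gridPoint (-(Γ.dir d).2, (Γ.dir d).1)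

/-- The dart of `G` that a dart of the planarization is a piece of. -/
def wholeDart (M : OnePlaneMap G) : M.Piece → G.Dart
  | Sum.inl d => d
  | Sum.inr d => d

/-- The points in the interior of the segment that represents a dart of the planarization: on the
first piece of `d`, the crossing has not been reached yet, on the second piece it is behind. -/
def pieceSeg (M : OnePlaneMap G) : M.Piece → Set (ℝ × ℝ)
  | Sum.inl d => {q | q ∈ Γ.edgeSeg d ∧
      ∀ h : d ∈ M.crossed, Disjoint (segment ℝ (Γ.tailPt d) q) (Γ.edgeSeg (M.cross ⟨d, h⟩))}
  | Sum.inr d => {q | q ∈ Γ.edgeSeg d ∧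
      Disjoint (segment ℝ q (Γ.tailPt (d : G.Dart).symm)) (Γ.edgeSeg (M.cross d))}

/-- The unbounded region lies immediately to the left of a dart of the planarization. -/
def OuterOnLeft (M : OnePlaneMap G) (p : M.Piece) : Prop :=
  ∀ q ∈ Γ.pieceSeg M p, ∀ᶠ ε : ℝ in nhdsWithin 0 (Set.Ioi 0),
    q + ε • Γ.leftNormal (wholeDart M p) ∈ Γ.outerRegion

/-- `b` lies strictly between `a` and `c` in the cyclic order of the integers. -/
def CyclicBetween (a b c : ℤ) : Prop := (a < b ∧ b < c) ∨ (b < c ∧ c < a) ∨ (c < a ∧ a < b)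

/-- The representation has the given embedding: around every bar the edges have the prescribed
counterclockwise order, and the edges cross exactly as prescribed (so the planarizations, and with
them the boundary walks of the faces, agree), and the outer face is the unbounded region, which
touches all bars.
(Only one boundary walk of each component of the planarization can be incident to the unbounded
region, so the prescribed outer boundary is the only one.) -/
structure EmbeddingPreserving (E : OuterOnePlane G) : Prop where
  rotation : ∀ d e : G.Dart, e.fst = d.fst →
    ¬ CyclicBetween (Γ.place d) (Γ.place e) (Γ.place (E.rot d))
  crossing : ∀ d e : G.Dart,
    Γ.CrossesFromRight d e ↔ ∃ h : d ∈ E.crossed, (E.cross ⟨d, h⟩ : G.Dart) = e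
  outer_left : ∀ p ∈ E.outer, Γ.OuterOnLeft E.toOnePlaneMap p
  outer_vertex : ∀ v, (Γ.bar v ∩ closure Γ.outerRegion).Nonempty

end BarVisRep

/-! Upper bound. Since all vertices lie on the outer face, its boundary walks can be cut open and
laid one after the other; this lists the vertices along a line, with every edge a chord on one side
of the line. The embedding can be read off from this order: two edges cross exactly if their ends
interleave, and the rotation at a vertex is the order of the other ends of its edges
(`exists_chordOrder`). The reason is a Jordan curve argument, carried out with linear algebra. In
the space of functions on darts, cuts and face differences are orthogonal, and by Euler's formula
they fill all antisymmetric functions (`exists_face_potential`). Hence an edge closed up by an arc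
of the outer face has a winding number, and its jumps along another edge tell how the ends of the
two edges lie.

A recursion on the chord diagram (`exists_isRowFunction`) assigns rows such that every vertex
between the ends of a chord is strictly above the lower end, and of two crossing chords one is
level. Level edges are drawn horizontally. All others are vertical, in columns reserved for their
upper ends, and the bar of a vertex is the hull of its columns. The row condition, together with the
order of the columns of a vertex, keeps the bars out of the way of the edges (`BarPlan`). Vertical
edges never interleave, so there are at most `4n` of them; with one more column per vertex this
gives `5n` columns, and ranks reduce the rows to `n`. The vertical ray above the own column of a
vertex is free, so the unbounded region starts at the correct corner of every bar
(`outerOnLeft_sel`), and it follows the steps of the outer face from there (`outerOnLeft_facePerm`).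

Lower bound. Three chains of `k` nested levels start at a common center; every level has two stems
crossed by two arms. A bar has at most one edge in each horizontal direction, so both first stems of
some chain are vertical (`exists_stemsVertical`). Vertical stems make the crossing arms horizontal,
and these use up both horizontal directions at the next center. So the next stems are vertical
again, and the rotation forces them to continue in the same direction (`StemsVertical.succ`). Each
level therefore needs a new row and a new column, which gives area at least `k * k` on `15 * k + 1`
vertices. -/

/-! ### Functions on the darts of a combinatorial map -/

section PermFunctions

open Module

variable {D : Type*}

/-- The functions that are constant on the classes generated by a relation. -/
def classFunctions (r : D → D → Prop) : Submodule ℝ (D → ℝ) where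
  carrier := {κ | ∀ p q, r p q → κ p = κ q}
  add_mem' := fun ha hb p q h => by simp [ha p q h, hb p q h]
  zero_mem' := fun _ _ _ => rfl
  smul_mem' := fun c κ hκ p q h => by simp [hκ p q h]

theorem mem_classFunctions {r : D → D → Prop} {κ : D → ℝ} :
    κ ∈ classFunctions r ↔ ∀ p q, r p q → κ p = κ q := Iff.rfl

theorem finrank_classFunctions [Finite D] (r : D → D → Prop) :
    finrank ℝ (classFunctions r) = Nat.card (Quot r) := by
  classical
  have hfin : Finite (Quot r) := Finite.of_surjective _ Quot.mk_surjective
  have := Fintype.ofFinite (Quot r)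
  have hr : classFunctions r = (LinearMap.funLeft ℝ ℝ (Quot.mk r)).range := by
    ext κ
    constructor
    · intro h
      exact ⟨Quot.lift κ h, rfl⟩
    · rintro ⟨g, rfl⟩ p q h
      simp [LinearMap.funLeft_apply, Quot.sound h]
  rw [hr, LinearMap.finrank_range_of_inj
    (LinearMap.funLeft_injective_of_surjective ℝ ℝ _ Quot.mk_surjective)]
  simp

theorem mem_classFunctions_sameCycle {π : Equiv.Perm D} {κ : D → ℝ} :
    κ ∈ classFunctions π.SameCycle ↔ ∀ p, κ (π p) = κ p := by
  constructor
  · intro h p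
    exact h _ _ ⟨-1, by simp⟩
  · rintro h p q ⟨i, rfl⟩
    have key : ∀ n : ℕ, ∀ p, κ ((π ^ n) p) = κ p := by
      intro n
      induction n with
      | zero => simp
      | succ n ih => intro p; rw [pow_succ', Equiv.Perm.mul_apply, h, ih]
    obtain ⟨n, rfl | rfl⟩ := i.eq_nat_or_neg
    · simp [key n p]
    · have := key n ((π ^ (-(n : ℤ))) p)
      simpa using this

theorem finrank_classFunctions_sameCycle [Finite D] (π : Equiv.Perm D) :
    finrank ℝ (classFunctions π.SameCycle) = Nat.card (OnePlaneMap.Orbits π) := by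
  rw [finrank_classFunctions]
  rfl

/-- The difference of the values of a function on the two sides of a dart. -/
def sideDiff (e : Equiv.Perm D) : (D → ℝ) →ₗ[ℝ] (D → ℝ) :=
  LinearMap.id - LinearMap.funLeft ℝ ℝ e

theorem sideDiff_apply (e : Equiv.Perm D) (κ : D → ℝ) (p : D) :
    sideDiff e κ p = κ p - κ (e p) := rfl

theorem finrank_map_add_finrank_inf_ker [Finite D] (δ : (D → ℝ) →ₗ[ℝ] (D → ℝ))
    (W : Submodule ℝ (D → ℝ)) :
    finrank ℝ (W.map δ) + finrank ℝ (W ⊓ LinearMap.ker δ : Submodule ℝ (D → ℝ)) =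
      finrank ℝ W := by
  have h := LinearMap.finrank_range_add_finrank_ker (δ.domRestrict W)
  rw [LinearMap.range_domRestrict, LinearMap.ker_domRestrict] at h
  rw [← h, ← Submodule.finrank_map_subtype_eq W (Submodule.comap W.subtype (LinearMap.ker δ)),
    Submodule.map_comap_subtype]

theorem card_eq_two_mul_card_orbits [Finite D] {e : Equiv.Perm D} (he : ∀ p, e (e p) = p)
    (hfix : ∀ p, e p ≠ p) : Nat.card D = 2 * Nat.card (OnePlaneMap.Orbits e) := by
  classical
  have := Fintype.ofFinite D
  have := Fintype.ofFinite (OnePlaneMap.Orbits e)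
  rw [Nat.card_eq_fintype_card, Nat.card_eq_fintype_card, ← Finset.card_univ,
    Finset.card_eq_sum_card_fiberwise (f := (Quotient.mk _ : D → OnePlaneMap.Orbits e))
      (t := Finset.univ) (fun _ _ => by simp)]
  rw [Finset.sum_const_nat (m := 2), Finset.card_univ, mul_comm]
  intro o _
  induction o using Quotient.inductionOn with
  | h p =>
    rw [Finset.card_eq_two]
    refine ⟨p, e p, (hfix p).symm, ?_⟩
    ext q
    simp only [Finset.mem_filter, Finset.mem_univ, true_and, Finset.mem_insert,
      Finset.mem_singleton]
    rw [Quotient.eq]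
    constructor
    · rintro ⟨i, hi⟩
      have hsq : e ^ (2 : ℤ) = 1 := by
        ext x
        rw [show (2 : ℤ) = 1 + 1 from rfl, zpow_add, zpow_one, Equiv.Perm.mul_apply, he]
        rfl
      obtain ⟨j, rfl | rfl⟩ := Int.even_or_odd' i
      · rw [zpow_mul, hsq, one_zpow] at hi
        exact Or.inl hi
      · rw [zpow_add, zpow_mul, hsq, one_zpow] at hi
        right
        rw [← hi]
        simp [he]
    · rintro (rfl | rfl)
      · exact ⟨0, rfl⟩
      · exact ⟨1, by simp [he]⟩

variable {v e f : Equiv.Perm D}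

/-- The relation that generates the connected components of a map. -/
abbrev dartLinked (v e : Equiv.Perm D) (p q : D) : Prop := q = v p ∨ q = e p

theorem classFunctions_inf_ker_vertex :
    classFunctions v.SameCycle ⊓ LinearMap.ker (sideDiff e) =
      classFunctions (dartLinked v e) := by
  ext κ
  rw [Submodule.mem_inf, mem_classFunctions_sameCycle, LinearMap.mem_ker, mem_classFunctions]
  constructor
  · rintro ⟨h1, h2⟩ p q (rfl | rfl)
    · exact (h1 p).symm
    · have := congrFun h2 p
      rw [sideDiff_apply] at this
      simp only [Pi.zero_apply] at this
      linarith
  · intro h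
    refine ⟨fun p => (h _ _ (Or.inl rfl)).symm, ?_⟩
    ext p
    rw [sideDiff_apply, h p _ (Or.inr rfl)]
    simp

/-- For functions with equal values on both sides of every edge, invariance under `f` and under `v`
are equivalent, because `v ∘ f = e`. So a map and its dual have the same components. -/
theorem classFunctions_inf_ker_face (hf : ∀ p, v (f p) = e p) :
    classFunctions f.SameCycle ⊓ LinearMap.ker (sideDiff e) =
      classFunctions (dartLinked v e) := by
  rw [← classFunctions_inf_ker_vertex]
  ext κ
  rw [Submodule.mem_inf, Submodule.mem_inf, mem_classFunctions_sameCycle,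
    mem_classFunctions_sameCycle, LinearMap.mem_ker]
  refine and_congr_left fun h2 => ?_
  have h3 : ∀ p, κ (e p) = κ p := fun p => by
    have := congrFun h2 p
    rw [sideDiff_apply] at this
    simp only [Pi.zero_apply] at this
    linarith
  constructor
  · intro h p
    have h4 : v p = e (f.symm p) := by rw [← hf]; simp
    rw [h4, h3]
    conv_rhs => rw [← f.apply_symm_apply p, h]
  · intro h p
    rw [← h (f p), hf, h3]

theorem sum_comp_mul [Fintype D] (he : ∀ p, e (e p) = p) (κ h : D → ℝ) :
    ∑ p, κ (e p) * h p = ∑ p, κ p * h (e p) := by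
  rw [← Equiv.sum_comp e (fun p => κ p * h (e p))]
  simp [he]

/-- Summation by parts: `h (e p) = h (v (f p)) = h (f p)`, and the sum is reindexed along `f`. If
`κ` is constant on faces, the right side vanishes, so face differences have no divergence. -/
theorem sum_sideDiff_mul [Fintype D] (he : ∀ p, e (e p) = p) (hf : ∀ p, v (f p) = e p)
    (κ h : D → ℝ) (hh : ∀ p, h (v p) = h p) :
    ∑ p, sideDiff e κ p * h p = ∑ p, (κ p - κ (f.symm p)) * h p := by
  simp only [sideDiff_apply, sub_mul, Finset.sum_sub_distrib]
  rw [sum_comp_mul he, ← Equiv.sum_comp f (fun p => κ (f.symm p) * h p)]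
  congr 1
  refine Finset.sum_congr rfl fun p _ => ?_
  rw [← hf, hh, Equiv.symm_apply_apply]

theorem sum_mul_sideDiff [Fintype D] (he : ∀ p, e (e p) = p) (z h : D → ℝ)
    (hz : ∀ p, z (e p) = - z p) :
    ∑ p, z p * sideDiff e h p = 2 * ∑ p, z p * h p := by
  simp only [sideDiff_apply, mul_sub, Finset.sum_sub_distrib]
  rw [← sum_comp_mul he]
  simp only [hz, neg_mul, Finset.sum_neg_distrib]
  ring

theorem sideDiff_antisymm (he : ∀ p, e (e p) = p) (κ : D → ℝ) (p : D) :
    sideDiff e κ (e p) = - sideDiff e κ p := by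
  simp [sideDiff_apply, he]

/-- Cuts and face differences are orthogonal. A common element `z`, being the cut of `h`, has square
norm twice the pairing of `z` with `h`; as `z` is also a face difference, this pairing is zero. -/
theorem disjoint_cuts_faces [Finite D] (he : ∀ p, e (e p) = p) (hf : ∀ p, v (f p) = e p) :
    Disjoint ((classFunctions v.SameCycle).map (sideDiff e))
      ((classFunctions f.SameCycle).map (sideDiff e)) := by
  have := Fintype.ofFinite D
  rw [Submodule.disjoint_def]
  rintro z ⟨h, hh, hz1⟩ ⟨κ, hκ, hz2⟩
  have hh := mem_classFunctions_sameCycle.1 hh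
  have hκ := mem_classFunctions_sameCycle.1 hκ
  have h0 : ∑ p, z p * z p = 0 := by
    conv_lhs => rw [← hz2]
    rw [hz2]
    nth_rewrite 2 [← hz1]
    rw [sum_mul_sideDiff he, ← hz2, sum_sideDiff_mul he hf κ h hh]
    · have : ∀ p, κ p - κ (f.symm p) = 0 := fun p => by
        conv_lhs => rw [← f.apply_symm_apply p, hκ]
        simp
      simp [this]
    · rw [← hz2]
      exact sideDiff_antisymm he κ
  rw [Finset.sum_eq_zero_iff_of_nonneg (fun p _ => mul_self_nonneg _)] at h0
  ext p
  simpa using h0 p (Finset.mem_univ p)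

theorem finrank_range_sideDiff [Finite D] (he : ∀ p, e (e p) = p) (hfix : ∀ p, e p ≠ p) :
    finrank ℝ (LinearMap.range (sideDiff e)) = Nat.card (OnePlaneMap.Orbits e) := by
  have := Fintype.ofFinite D
  have h1 := LinearMap.finrank_range_add_finrank_ker (sideDiff e)
  have h2 : LinearMap.ker (sideDiff e) = classFunctions e.SameCycle := by
    ext κ
    rw [LinearMap.mem_ker, mem_classFunctions_sameCycle]
    constructor
    · intro h p
      have := congrFun h p
      rw [sideDiff_apply] at this
      simp only [Pi.zero_apply] at this
      linarith
    · intro h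
      ext p
      simp [sideDiff_apply, h]
  rw [h2, finrank_classFunctions_sameCycle, finrank_fintype_fun_eq_card,
    ← Nat.card_eq_fintype_card, card_eq_two_mul_card_orbits he hfix] at h1
  omega

theorem finrank_cuts [Finite D] :
    finrank ℝ ((classFunctions v.SameCycle).map (sideDiff e)) + Nat.card (Quot (dartLinked v e)) =
      Nat.card (OnePlaneMap.Orbits v) := by
  rw [← finrank_classFunctions, ← classFunctions_inf_ker_vertex, finrank_map_add_finrank_inf_ker,
    finrank_classFunctions_sameCycle]

theorem finrank_faces [Finite D] (hf : ∀ p, v (f p) = e p) :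
    finrank ℝ ((classFunctions f.SameCycle).map (sideDiff e)) + Nat.card (Quot (dartLinked v e)) =
      Nat.card (OnePlaneMap.Orbits f) := by
  rw [← finrank_classFunctions, ← classFunctions_inf_ker_face hf, finrank_map_add_finrank_inf_ker,
    finrank_classFunctions_sameCycle]

/-- Each of the two independent spaces loses one dimension per component, namely the functions
constant on components. -/
theorem finrank_cuts_sup_faces [Finite D] (he : ∀ p, e (e p) = p) (hf : ∀ p, v (f p) = e p) :
    finrank ℝ ((classFunctions v.SameCycle).map (sideDiff e) ⊔
        (classFunctions f.SameCycle).map (sideDiff e) : Submodule ℝ (D → ℝ)) +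
      2 * Nat.card (Quot (dartLinked v e)) =
        Nat.card (OnePlaneMap.Orbits v) + Nat.card (OnePlaneMap.Orbits f) := by
  have h1 := Submodule.finrank_sup_add_finrank_inf_eq
    ((classFunctions v.SameCycle).map (sideDiff e)) ((classFunctions f.SameCycle).map (sideDiff e))
  rw [(disjoint_cuts_faces he hf).eq_bot, finrank_bot] at h1
  have h2 := finrank_cuts (v := v) (e := e)
  have h3 := finrank_faces hf
  omega

/-- The genus of a combinatorial map is not negative. -/
theorem euler_inequality [Finite D] (he : ∀ p, e (e p) = p) (hfix : ∀ p, e p ≠ p)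
    (hf : ∀ p, v (f p) = e p) :
    Nat.card (OnePlaneMap.Orbits v) + Nat.card (OnePlaneMap.Orbits f) ≤
      Nat.card (OnePlaneMap.Orbits e) + 2 * Nat.card (Quot (dartLinked v e)) := by
  have h1 := finrank_cuts_sup_faces he hf
  -- Both spaces lie in the range of `sideDiff e`, whose dimension is the number of edges.
  have h2 : finrank ℝ ((classFunctions v.SameCycle).map (sideDiff e) ⊔
        (classFunctions f.SameCycle).map (sideDiff e) : Submodule ℝ (D → ℝ)) ≤
      finrank ℝ (LinearMap.range (sideDiff e)) :=
    Submodule.finrank_mono (sup_le LinearMap.map_le_range LinearMap.map_le_range)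
  rw [finrank_range_sideDiff he hfix] at h2
  omega

/-- On a map of genus zero, every flow without sources is the difference of a function on the
faces. -/
theorem exists_face_potential [Fintype D] (he : ∀ p, e (e p) = p) (hfix : ∀ p, e p ≠ p)
    (hf : ∀ p, v (f p) = e p)
    (hplanar : Nat.card (OnePlaneMap.Orbits v) + Nat.card (OnePlaneMap.Orbits f) =
      Nat.card (OnePlaneMap.Orbits e) + 2 * Nat.card (Quot (dartLinked v e)))
    {z : D → ℝ} (hz : ∀ p, z (e p) = - z p)
    (hdiv : ∀ h : D → ℝ, (∀ p, h (v p) = h p) → ∑ p, z p * h p = 0) :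
    ∃ κ : D → ℝ, (∀ p, κ (f p) = κ p) ∧ ∀ p, κ p - κ (e p) = z p := by
  have h1 := finrank_cuts_sup_faces he hf
  -- Genus zero means equality of dimensions, so every antisymmetric function is a cut plus a face
  -- difference.
  have h2 : (classFunctions v.SameCycle).map (sideDiff e) ⊔
      (classFunctions f.SameCycle).map (sideDiff e) = LinearMap.range (sideDiff e) := by
    refine Submodule.eq_of_le_of_finrank_le
      (sup_le LinearMap.map_le_range LinearMap.map_le_range) ?_
    rw [finrank_range_sideDiff he hfix]
    omega
  have h3 : z ∈ LinearMap.range (sideDiff e) := by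
    refine ⟨fun p => z p / 2, ?_⟩
    ext p
    rw [sideDiff_apply, hz]
    ring
  rw [← h2, Submodule.mem_sup] at h3
  obtain ⟨_, ⟨h, hh, rfl⟩, _, ⟨κ, hκ, rfl⟩, hsum⟩ := h3
  have hh := mem_classFunctions_sameCycle.1 hh
  have hκ := mem_classFunctions_sameCycle.1 hκ
  refine ⟨κ, hκ, fun p => ?_⟩
  have h4 : ∑ p, sideDiff e κ p * h p = 0 := by
    rw [sum_sideDiff_mul he hf κ h hh]
    have : ∀ p, κ p - κ (f.symm p) = 0 := fun p => by
      conv_lhs => rw [← f.apply_symm_apply p, hκ]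
      simp
    simp [this]
  -- The cut part of `z` vanishes: its square norm is twice its pairing with `h`, and both `z` (by
  -- `hdiv`) and the face part (by `h4`) pair to zero with `h`.
  have h5 : ∑ p, sideDiff e h p * sideDiff e h p = 0 := by
    rw [sum_mul_sideDiff he _ _ (sideDiff_antisymm he h)]
    have h6 := hdiv h hh
    rw [← hsum] at h6
    simp only [Pi.add_apply, add_mul, Finset.sum_add_distrib, h4, add_zero] at h6
    rw [h6, mul_zero]
  rw [Finset.sum_eq_zero_iff_of_nonneg (fun p _ => mul_self_nonneg _)] at h5
  have h7 := h5 p (Finset.mem_univ p)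
  rw [mul_self_eq_zero] at h7
  rw [← hsum, Pi.add_apply, h7, zero_add, sideDiff_apply]

end PermFunctions

/-! ### Positions along the outer boundary walks -/

section WalkPosition

variable {D ι : Type*}

/-- The indicator function of the part of a set where a function has values in `[a, b)`. -/
noncomputable def arcIndicator (outer : Set D) (pos : D → ℕ) (a b : ℕ) (p : D) : ℝ :=
  open Classical in if p ∈ outer ∧ a ≤ pos p ∧ pos p < b then 1 else 0

-- The outer walk of each component is cut open at a base dart and numbered by steps; the components
-- occupy consecutive blocks. An arc `[pos a, pos b)` inside one block is then entered only at `a`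
-- and left only at `b`.
open Classical in
theorem exists_walk_position [Finite D] [Finite ι] (f : Equiv.Perm D) (outer : Set D)
    (hout : ∀ p, f p ∈ outer ↔ p ∈ outer) (K : D → ι) (hKf : ∀ p, K (f p) = K p)
    (hK : ∀ p ∈ outer, ∀ q ∈ outer, K p = K q → f.SameCycle p q) :
    ∃ pos : D → ℕ, Set.InjOn pos outer ∧
      ∀ a ∈ outer, ∀ b ∈ outer, K a = K b → pos a < pos b → ∀ p,
        arcIndicator outer pos (pos a) (pos b) (f p) =
          arcIndicator outer pos (pos a) (pos b) p
            + (if f p = a then 1 else 0) - (if f p = b then 1 else 0) := by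
  rcases isEmpty_or_nonempty D with hD | ⟨⟨default⟩⟩
  · exact ⟨fun _ => 0, fun p => hD.elim p, fun a => hD.elim a⟩
  obtain ⟨m, ⟨idx⟩⟩ := Finite.exists_equiv_fin ι
  obtain ⟨base, hbase⟩ : ∃ base : ι → D, ∀ p ∈ outer, base (K p) ∈ outer ∧ K (base (K p)) = K p := by
    refine ⟨fun k => if h : ∃ b ∈ outer, K b = k then h.choose else default, fun p hp => ?_⟩
    have h : ∃ b ∈ outer, K b = K p := ⟨p, hp, rfl⟩
    simp only [dif_pos h]
    exact h.choose_spec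
  have hreach : ∀ p ∈ outer, ∃ n : ℕ, (f ^ n) (base (K p)) = p := by
    intro p hp
    exact (hK _ (hbase p hp).1 _ hp (hbase p hp).2).exists_nat_pow_eq
  let steps : D → ℕ := fun p => if h : ∃ n : ℕ, (f ^ n) (base (K p)) = p then Nat.find h else 0
  have hs1 : ∀ p ∈ outer, (f ^ steps p) (base (K p)) = p := by
    intro p hp
    have h := hreach p hp
    simp only [steps, dif_pos h]
    exact Nat.find_spec h
  have hs2 : ∀ p ∈ outer, ∀ n, (f ^ n) (base (K p)) = p → steps p ≤ n := by
    intro p hp n hn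
    have h := hreach p hp
    simp only [steps, dif_pos h]
    exact Nat.find_min' h hn
  have hN : ∀ p ∈ outer, steps p < orderOf f := by
    intro p hp
    have h1 := hs1 p hp
    have h2 : (f ^ (steps p % orderOf f)) (base (K p)) = p := by rwa [pow_mod_orderOf]
    exact lt_of_le_of_lt (hs2 p hp _ h2) (Nat.mod_lt _ (orderOf_pos f))
  have hnext : ∀ p ∈ outer, (f p ≠ base (K p) → steps (f p) = steps p + 1) := by
    intro p hp hne
    have hfp := (hout p).2 hp
    have h1 : steps (f p) ≤ steps p + 1 := by
      apply hs2 _ hfp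
      rw [hKf, pow_succ', Equiv.Perm.mul_apply, hs1 p hp]
    have h2 := hs1 _ hfp
    rw [hKf] at h2
    cases hk : steps (f p) with
    | zero => rw [hk] at h2; exact (hne h2.symm).elim
    | succ k =>
      rw [hk, pow_succ', Equiv.Perm.mul_apply] at h2
      have := hs2 p hp k (f.injective h2)
      omega
  have hlast : ∀ p ∈ outer, f p = base (K p) → ∀ q ∈ outer, K q = K p → steps q ≤ steps p := by
    intro p hp hb q hq hqp
    by_contra! hlt
    have h1 := hs1 q hq
    obtain ⟨j, hj⟩ : ∃ j, steps q = j + (steps p + 1) := ⟨steps q - (steps p + 1), by omega⟩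
    rw [hj, pow_add, Equiv.Perm.mul_apply, pow_succ', Equiv.Perm.mul_apply, hqp, hs1 p hp, hb,
      ← hqp] at h1
    have := hs2 q hq j h1
    omega
  have hs0 : ∀ p ∈ outer, p = base (K p) → steps p = 0 := fun p hp h =>
    Nat.le_zero.1 (hs2 p hp 0 (by simpa using h.symm))
  -- By `hN` a walk has fewer than `orderOf f` steps, so the blocks of different components are
  -- disjoint.
  let pos : D → ℕ := fun p => (idx (K p) : ℕ) * orderOf f + steps p
  have hblock : ∀ p ∈ outer, ∀ q ∈ outer, pos p ≤ pos q → (idx (K p) : ℕ) ≤ idx (K q) := by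
    intro p hp q hq h
    by_contra! hlt
    have h1 := hN q hq
    have h2 : ((idx (K q) : ℕ) + 1) * orderOf f ≤ idx (K p) * orderOf f :=
      Nat.mul_le_mul_right _ hlt
    simp only [pos] at h
    rw [add_mul, one_mul] at h2
    omega
  have hinj : Set.InjOn pos outer := by
    intro p hp q hq h
    have h1 := le_antisymm (hblock p hp q hq h.le) (hblock q hq p hp h.ge)
    have h2 : K p = K q := idx.injective (Fin.ext h1)
    simp only [pos, h2] at h
    rw [← hs1 p hp, ← hs1 q hq, h2, show steps p = steps q by omega]
  refine ⟨pos, hinj, fun a ha b hb hab hlt p => ?_⟩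
  unfold arcIndicator
  by_cases hp : p ∈ outer
  swap
  · have h1 : f p ∉ outer := fun h => hp ((hout p).1 h)
    have h2 : f p ≠ a := fun h => h1 (h ▸ ha)
    have h3 : f p ≠ b := fun h => h1 (h ▸ hb)
    simp [hp, h1, h2, h3]
  have hfp := (hout p).2 hp
  have hA : f p = a ↔ pos (f p) = pos a := ⟨fun h => by rw [h], fun h => hinj hfp ha h⟩
  have hB : f p = b ↔ pos (f p) = pos b := ⟨fun h => by rw [h], fun h => hinj hfp hb h⟩
  have hKfp := hKf p
  -- At the wrap-around the walk goes from the last position of its block to the first. The last one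
  -- is never in `[pos a, pos b)`, and the first one is in it only if it is `a`.
  by_cases hbs : f p = base (K p)
  · have h0 : steps (f p) = 0 := hs0 _ hfp (by rw [hKf]; exact hbs)
    by_cases hKa : K p = K a
    · have h1 := hlast p hp hbs b hb (by rw [hKa, hab])
      have h2 : ¬ (pos p < pos b) := by
        simp only [pos, hKa, hab]; omega
      have h3 : pos (f p) < pos b := by
        refine lt_of_le_of_lt ?_ hlt
        simp only [pos, hKfp, hKa, h0]; omega
      have h4 : pos (f p) ≤ pos a := by
        simp only [pos, hKfp, hKa, h0]; omega
      by_cases h5 : pos (f p) = pos a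
      · simp [hfp, hA, hB, h2, h5, hlt, hlt.ne]
      · have h6 : ¬ pos a ≤ pos (f p) := by omega
        simp [hA, hB, h2, h5, h6, h3.ne]
    · have h1 : ∀ q ∈ outer, K q = K p → ¬ (pos a ≤ pos q ∧ pos q < pos b) := by
        rintro q hq hqp ⟨h1, h2⟩
        have h3 := hblock a ha q hq h1
        have h4 := hblock q hq b hb h2.le
        rw [← hab] at h4
        exact hKa (by rw [← hqp]; exact idx.injective (Fin.ext (le_antisymm h4 h3)))
      have h2 : f p ≠ a := fun h => hKa (by rw [← hKfp, h])
      have h3 : f p ≠ b := fun h => hKa (by rw [← hKfp, h, hab])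
      simp [h1 p hp rfl, h1 (f p) hfp hKfp, h2, h3]
  · have h1 : pos (f p) = pos p + 1 := by
      simp only [pos, hKfp, hnext p hp hbs]; omega
    rw [if_congr hA rfl rfl, if_congr hB rfl rfl, h1]
    simp only [hp, hfp, true_and]
    split_ifs <;> first | omega | norm_num

end WalkPosition

/-! ### The order of the vertices along the outer face -/

namespace OnePlaneMap

variable {V : Type*} {G : SimpleGraph V} (M : OnePlaneMap G)

theorem edgePerm_apply (p : M.Piece) : M.edgePerm p = M.reverse p := rfl

theorem vertexPerm_inl (d : G.Dart) : M.vertexPerm (Sum.inl d) = Sum.inl (M.rot d) := rfl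

theorem vertexPerm_inr (d : M.crossed) : M.vertexPerm (Sum.inr d) = Sum.inr (M.cross d) := rfl

theorem edgePerm_edgePerm (p : M.Piece) : M.edgePerm (M.edgePerm p) = p := M.reverse_involutive p

theorem edgePerm_inr (d : M.crossed) : M.edgePerm (Sum.inr d) = Sum.inl (d : G.Dart).symm := rfl

theorem edgePerm_inl_of_not_mem {d : G.Dart} (h : d ∉ M.crossed) :
    M.edgePerm (Sum.inl d) = Sum.inl d.symm := by
  have h' : d.symm ∉ M.crossed := fun hd => h (by simpa using M.symm_mem_crossed hd)
  simp [edgePerm_apply, reverse, h']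

theorem edgePerm_inl_of_mem {d : G.Dart} (h : d ∈ M.crossed) :
    M.edgePerm (Sum.inl d) = Sum.inr ⟨d.symm, M.symm_mem_crossed h⟩ := by
  simp [edgePerm_apply, reverse, M.symm_mem_crossed h]

theorem edgePerm_ne (p : M.Piece) : M.edgePerm p ≠ p := by
  rcases p with d | d
  · by_cases h : d ∈ M.crossed
    · simp [M.edgePerm_inl_of_mem h]
    · rw [M.edgePerm_inl_of_not_mem h]
      intro h
      exact d.symm_ne (Sum.inl_injective h)
  · simp [edgePerm_inr]

theorem vertexPerm_facePerm (p : M.Piece) : M.vertexPerm (M.facePerm p) = M.edgePerm p := by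
  simp [facePerm]

theorem facePerm_edgePerm_vertexPerm (p : M.Piece) :
    M.facePerm (M.edgePerm (M.vertexPerm p)) = p := by
  simp [facePerm, edgePerm_edgePerm]

theorem rot_fst (d : G.Dart) : (M.rot d).fst = d.fst := by
  have h := (M.rot_isCycleOn d.fst).1.mapsTo (show d ∈ {e : G.Dart | e.fst = d.fst} from rfl)
  exact h

theorem exists_rot_pow [Finite V] {d e : G.Dart} (h : d.fst = e.fst) : ∃ n : ℕ, (M.rot ^ n) d = e := by
  have : Finite G.Dart := Finite.of_injective _ SimpleGraph.Dart.toProd_injective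
  exact ((M.rot_isCycleOn d.fst).2 rfl h.symm).exists_nat_pow_eq

theorem cross_symm (d : M.crossed) :
    (M.cross ⟨(d : G.Dart).symm, M.symm_mem_crossed d.2⟩ : G.Dart) = (M.cross d : G.Dart).symm := by
  have h : (⟨(d : G.Dart).symm, M.symm_mem_crossed d.2⟩ : M.crossed) = M.cross (M.cross d) :=
    Subtype.ext (M.cross_cross d).symm
  rw [h, M.cross_cross]

/-- The flow of value one along the dart `x`. -/
noncomputable def dartFlow (x : G.Dart) (p : M.Piece) : ℝ :=
  open Classical in
  (if BarVisRep.wholeDart M p = x then 1 else 0) - (if BarVisRep.wholeDart M p = x.symm then 1 else 0)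

theorem wholeDart_inl (d : G.Dart) : BarVisRep.wholeDart M (Sum.inl d) = d := rfl

theorem wholeDart_inr (d : M.crossed) : BarVisRep.wholeDart M (Sum.inr d) = d := rfl

theorem wholeDart_edgePerm (p : M.Piece) :
    BarVisRep.wholeDart M (M.edgePerm p) = (BarVisRep.wholeDart M p).symm := by
  rcases p with d | d
  · by_cases h : d ∈ M.crossed
    · rw [M.edgePerm_inl_of_mem h]; rfl
    · rw [M.edgePerm_inl_of_not_mem h]; rfl
  · rfl

theorem dartFlow_edgePerm (x : G.Dart) (p : M.Piece) :
    M.dartFlow x (M.edgePerm p) = - M.dartFlow x p := by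
  have h1 : ∀ d y : G.Dart, d.symm = y ↔ d = y.symm := fun d y =>
    ⟨fun h => by rw [← h, SimpleGraph.Dart.symm_symm], fun h => by rw [h, SimpleGraph.Dart.symm_symm]⟩
  unfold dartFlow
  classical
  have h2 := h1 (BarVisRep.wholeDart M p) x
  have h3 := h1 (BarVisRep.wholeDart M p) x.symm
  rw [SimpleGraph.Dart.symm_symm] at h3
  rw [wholeDart_edgePerm, if_congr h2 rfl rfl, if_congr h3 rfl rfl, neg_sub]

/-- The flow has its source at the tail and its sink at the head of `x`. At the crossing of `x` the
contributions of the two directions cancel, since `h` is constant around it. -/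
theorem sum_dartFlow_mul [Fintype M.Piece] (x : G.Dart) (h : M.Piece → ℝ)
    (hh : ∀ p, h (M.vertexPerm p) = h p) :
    ∑ p, M.dartFlow x p * h p = h (Sum.inl x) - h (Sum.inl x.symm) := by
  classical
  have key : ∀ y : G.Dart, ∑ p, (if BarVisRep.wholeDart M p = y then (1 : ℝ) else 0) * h p =
      h (Sum.inl y) + if hy : y ∈ M.crossed then h (Sum.inr ⟨y, hy⟩) else 0 := by
    intro y
    simp only [ite_mul, one_mul, zero_mul]
    rw [← Finset.sum_filter]
    by_cases hy : y ∈ M.crossed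
    · have : Finset.univ.filter (fun p => BarVisRep.wholeDart M p = y) =
          {Sum.inl y, Sum.inr ⟨y, hy⟩} := by
        ext p
        rw [Finset.mem_filter]
        rcases p with d | d <;> simp [wholeDart_inl, wholeDart_inr, Subtype.ext_iff]
      rw [this, Finset.sum_pair (by simp), dif_pos hy]
    · have : Finset.univ.filter (fun p => BarVisRep.wholeDart M p = y) = {Sum.inl y} := by
        ext p
        rw [Finset.mem_filter]
        rcases p with d | d
        · simp [wholeDart_inl]
        · have : (d : G.Dart) ≠ y := fun h => hy (h ▸ d.2)
          simp [wholeDart_inr, this]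
      rw [this, Finset.sum_singleton, dif_neg hy, add_zero]
  simp only [dartFlow, sub_mul, Finset.sum_sub_distrib, key]
  by_cases hx : x ∈ M.crossed
  · have h1 : h (Sum.inr ⟨x.symm, M.symm_mem_crossed hx⟩) = h (Sum.inr ⟨x, hx⟩) := by
      have h2 : (⟨x.symm, M.symm_mem_crossed hx⟩ : M.crossed) = M.cross (M.cross ⟨x, hx⟩) :=
        Subtype.ext (M.cross_cross ⟨x, hx⟩).symm
      rw [h2, ← vertexPerm_inr, hh, ← vertexPerm_inr, hh]
    rw [dif_pos hx, dif_pos (M.symm_mem_crossed hx), h1]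
    ring
  · have hx' : x.symm ∉ M.crossed := fun hd => hx (by simpa using M.symm_mem_crossed hd)
    rw [dif_neg hx, dif_neg hx']
    ring

/-- The component of a dart of the planarization. -/
def comp (p : M.Piece) : M.Component := Quot.mk _ p

theorem comp_vertexPerm (p : M.Piece) : M.comp (M.vertexPerm p) = M.comp p :=
  (Quot.sound (r := M.Linked) (Or.inl rfl)).symm

theorem comp_edgePerm (p : M.Piece) : M.comp (M.edgePerm p) = M.comp p :=
  (Quot.sound (r := M.Linked) (Or.inr rfl)).symm

theorem comp_facePerm (p : M.Piece) : M.comp (M.facePerm p) = M.comp p := by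
  rw [← comp_vertexPerm, vertexPerm_facePerm, comp_edgePerm]

theorem comp_inl_of_fst_eq [Finite V] {d e : G.Dart} (h : d.fst = e.fst) :
    M.comp (Sum.inl d) = M.comp (Sum.inl e) := by
  obtain ⟨n, rfl⟩ := M.exists_rot_pow h
  clear h
  induction n with
  | zero => rfl
  | succ n ih => rw [ih, pow_succ', Equiv.Perm.mul_apply, ← vertexPerm_inl, comp_vertexPerm]

theorem comp_inr (d : M.crossed) : M.comp (Sum.inr d) = M.comp (Sum.inl (d : G.Dart)) := by
  have h1 : M.comp (Sum.inr (M.cross (M.cross d))) = M.comp (Sum.inr d) := by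
    rw [← vertexPerm_inr, comp_vertexPerm, ← vertexPerm_inr, comp_vertexPerm]
  rw [← h1, ← comp_edgePerm, edgePerm_inr, M.cross_cross, SimpleGraph.Dart.symm_symm]

theorem comp_symm (d : G.Dart) : M.comp (Sum.inl d.symm) = M.comp (Sum.inl d) := by
  by_cases h : d ∈ M.crossed
  · rw [← M.comp_inr ⟨d, h⟩, ← M.comp_edgePerm (Sum.inr _), edgePerm_inr]
  · rw [← M.comp_edgePerm (Sum.inl d), M.edgePerm_inl_of_not_mem h]

end OnePlaneMap

/-- Counterclockwise around the vertex at position `u`, starting from the outer face, the neighbour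
at position `s` comes before the one at position `t`. -/
def KeyLT (u s t : ℕ) : Prop := (s < u ∧ t < s) ∨ (s < u ∧ u < t) ∨ (u < s ∧ u < t ∧ t < s)

/-- The chord from `s` to `t` crosses the chord from `u` to `w` from right to left. -/
def ChordCross (u w s t : ℕ) : Prop :=
  (u < w ∧ (u < t ∧ t < w) ∧ (s < u ∨ w < s)) ∨ (w < u ∧ (w < s ∧ s < u) ∧ (t < w ∨ u < t))

namespace OuterOnePlane

variable {V : Type*} {G : SimpleGraph V} (E : OuterOnePlane G)

open Classical in
/-- An order of the vertices along the outer face which determines the embedding: all vertices can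
be placed in this order on a line, with all edges below the line. The dart `sel d` is the last one
before the outer face on a counterclockwise walk around the tail of `d`. -/
structure ChordOrder (σ : V → ℕ) (sel : G.Dart → G.Dart) : Prop where
  inj : Function.Injective σ
  sel_fst : ∀ d, (sel d).fst = d.fst
  sel_congr : ∀ d e, d.fst = e.fst → sel d = sel e
  sel_outer : ∀ d, Sum.inl (sel d) ∈ E.outer
  cross_iff : ∀ x y : G.Dart, (∃ h : x ∈ E.crossed, (E.cross ⟨x, h⟩ : G.Dart) = y) ↔
    ChordCross (σ x.fst) (σ x.snd) (σ y.fst) (σ y.snd)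
  -- The indicator of "at or after `x`, counterclockwise from the outer face" goes up when the
  -- rotation reaches `x`, and drops when it passes the outer face, that is, after `sel y`.
  rot_key : ∀ x y : G.Dart, x.fst = y.fst →
    (if E.rot y = x ∨ KeyLT (σ x.fst) (σ x.snd) (σ (E.rot y).snd) then (1 : ℝ) else 0) =
      (if y = x ∨ KeyLT (σ x.fst) (σ x.snd) (σ y.snd) then 1 else 0)
        + (if E.rot y = x then 1 else 0) - (if y = sel y then 1 else 0)

theorem exists_sel : ∃ sel : G.Dart → G.Dart, (∀ d, (sel d).fst = d.fst) ∧
    (∀ d e, d.fst = e.fst → sel d = sel e) ∧ ∀ d, Sum.inl (sel d) ∈ E.outer := by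
  have h : ∀ v : V, (∃ d : G.Dart, d.fst = v) → ∃ e : G.Dart, e.fst = v ∧ Sum.inl e ∈ E.outer := by
    rintro v ⟨d, rfl⟩
    exact E.vertex_outer d
  choose s hs1 hs2 using h
  refine ⟨fun d => s d.fst ⟨d, rfl⟩, fun d => hs1 _ _, fun d e hde => ?_, fun d => hs2 _ _⟩
  simp only [hde]

variable {E}

section Potential

variable {sel : G.Dart → G.Dart} {pos : E.toOnePlaneMap.Piece → ℕ}

open Classical in
/-- A function on the faces of the drawing that is cut open along the arc of the outer face
from the tail to the head of `x`. -/
structure IsChordPotential (sel : G.Dart → G.Dart) (pos : E.toOnePlaneMap.Piece → ℕ) (x : G.Dart)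
    (κ : E.toOnePlaneMap.Piece → ℝ) : Prop where
  diff : ∀ p, κ p - κ (E.edgePerm p) = E.dartFlow x p
  face : ∀ p, κ (E.facePerm p) = κ p + (if E.facePerm p = Sum.inl (sel x) then 1 else 0)
    - (if E.facePerm p = Sum.inl (sel x.symm) then 1 else 0)
  outer : ∀ p ∈ E.outer, ∀ q ∈ E.outer, E.comp p = E.comp q →
    κ p - arcIndicator E.outer pos (pos (Sum.inl (sel x))) (pos (Sum.inl (sel x.symm))) p =
    κ q - arcIndicator E.outer pos (pos (Sum.inl (sel x))) (pos (Sum.inl (sel x.symm))) q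

instance [Finite V] : Finite G.Dart := Finite.of_injective _ SimpleGraph.Dart.toProd_injective

-- The flow along `x` and the side difference of the arc indicator both have divergence one at the
-- tail and minus one at the head of `x`. Their difference is therefore given by a face function,
-- and adding the arc indicator back yields `κ`: the winding number of the curve formed by `x` and
-- the arc, seen from inside the outer face on the arc.
open Classical in
theorem exists_chordPotential [Finite V] (hs1 : ∀ d, (sel d).fst = d.fst)
    (hs3 : ∀ d, Sum.inl (sel d) ∈ E.outer)
    (hpos : ∀ a ∈ E.outer, ∀ b ∈ E.outer, E.comp a = E.comp b → pos a < pos b → ∀ p,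
        arcIndicator E.outer pos (pos a) (pos b) (E.facePerm p) =
          arcIndicator E.outer pos (pos a) (pos b) p
            + (if E.facePerm p = a then 1 else 0) - (if E.facePerm p = b then 1 else 0))
    (x : G.Dart) (hx : pos (Sum.inl (sel x)) < pos (Sum.inl (sel x.symm))) :
    ∃ κ, IsChordPotential (E := E) sel pos x κ := by
  have := Fintype.ofFinite E.toOnePlaneMap.Piece
  have hcomp : E.comp (Sum.inl (sel x)) = E.comp (Sum.inl (sel x.symm)) := by
    rw [E.comp_inl_of_fst_eq (hs1 x), E.comp_inl_of_fst_eq (hs1 x.symm), E.comp_symm]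
  set S := arcIndicator E.outer pos (pos (Sum.inl (sel x))) (pos (Sum.inl (sel x.symm))) with hS
  have hstep := hpos _ (hs3 x) _ (hs3 x.symm) hcomp hx
  rw [← hS] at hstep
  have hv : ∀ (h : E.toOnePlaneMap.Piece → ℝ), (∀ p, h (E.vertexPerm p) = h p) →
      ∀ d e : G.Dart, d.fst = e.fst → h (Sum.inl d) = h (Sum.inl e) := by
    intro h hh d e hde
    obtain ⟨n, rfl⟩ := E.exists_rot_pow hde
    clear hde
    induction n with
    | zero => rfl
    | succ n ih =>
      rw [ih, pow_succ', Equiv.Perm.mul_apply, ← E.vertexPerm_inl, hh]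
  obtain ⟨κ', h1, h2⟩ := exists_face_potential (v := E.vertexPerm) (e := E.edgePerm)
    (f := E.facePerm) E.edgePerm_edgePerm E.edgePerm_ne E.vertexPerm_facePerm E.planar
    (z := fun p => E.dartFlow x p - sideDiff E.edgePerm S p)
    (fun p => by
      simp only [E.dartFlow_edgePerm, sideDiff_antisymm E.edgePerm_edgePerm]
      ring)
    (fun h hh => by
      simp only [sub_mul, Finset.sum_sub_distrib]
      have h3 := E.sum_dartFlow_mul x h hh
      rw [h3, sum_sideDiff_mul E.edgePerm_edgePerm E.vertexPerm_facePerm S h hh]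
      have h4 : ∀ p, S p - S (E.facePerm.symm p) =
          (if p = Sum.inl (sel x) then 1 else 0) - (if p = Sum.inl (sel x.symm) then 1 else 0) := by
        intro p
        have := hstep (E.facePerm.symm p)
        rw [Equiv.apply_symm_apply] at this
        rw [this]
        ring
      simp only [h4, sub_mul, ite_mul, one_mul, zero_mul, Finset.sum_sub_distrib,
        Finset.sum_ite_eq', Finset.mem_univ, if_true]
      rw [hv h hh _ _ (hs1 x), hv h hh _ _ (hs1 x.symm)]
      ring)
  refine ⟨fun p => κ' p + S p, ?_, ?_, ?_⟩
  · intro p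
    have := h2 p
    rw [sideDiff_apply] at this
    linarith
  · intro p
    rw [h1, hstep]
    ring
  · intro p hp q hq hpq
    rw [← hS]
    have h3 : κ' ∈ classFunctions E.facePerm.SameCycle := mem_classFunctions_sameCycle.2 h1
    have := h3 p q (E.outer_sameCycle p hp q hq hpq)
    simp [this]

end Potential

end OuterOnePlane

namespace OuterOnePlane

variable {V : Type*} {G : SimpleGraph V} {E : OuterOnePlane G}
  {sel : G.Dart → G.Dart} {pos : E.toOnePlaneMap.Piece → ℕ}

namespace IsChordPotential

variable {x : G.Dart} {κ : E.toOnePlaneMap.Piece → ℝ}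

open Classical in
theorem vertexPerm (hκ : IsChordPotential sel pos x κ) (p : E.toOnePlaneMap.Piece) :
    κ (E.vertexPerm p) = κ p + E.dartFlow x (E.vertexPerm p)
      - (if p = Sum.inl (sel x) then 1 else 0) + (if p = Sum.inl (sel x.symm) then 1 else 0) := by
  have h1 := hκ.diff (E.vertexPerm p)
  have h2 := hκ.face (E.edgePerm (E.vertexPerm p))
  rw [E.facePerm_edgePerm_vertexPerm] at h2
  linarith

theorem dartFlow_eq_zero {M : OnePlaneMap G} {x : G.Dart} {p : M.Piece} (h1 : BarVisRep.wholeDart M p ≠ x)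
    (h2 : BarVisRep.wholeDart M p ≠ x.symm) : M.dartFlow x p = 0 := by
  simp [OnePlaneMap.dartFlow, h1, h2]

/-- Around a vertex that is not an end of `x`, neither the edge of `x` nor an end of the arc is
passed. -/
theorem inl_eq_of_fst_ne [Finite V] (hs1 : ∀ d, (sel d).fst = d.fst)
    (hκ : IsChordPotential sel pos x κ) {y z : G.Dart} (hyz : y.fst = z.fst)
    (h1 : y.fst ≠ x.fst) (h2 : y.fst ≠ x.snd) : κ (Sum.inl y) = κ (Sum.inl z) := by
  obtain ⟨n, rfl⟩ := E.exists_rot_pow hyz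
  clear hyz
  induction n with
  | zero => rfl
  | succ n ih =>
    rw [ih, pow_succ', Equiv.Perm.mul_apply, ← E.vertexPerm_inl, hκ.vertexPerm]
    have hf : ((E.rot ^ n) y).fst = y.fst := by
      clear ih
      induction n with
      | zero => rfl
      | succ n ih => rw [pow_succ', Equiv.Perm.mul_apply, E.rot_fst, ih]
    have h3 : ∀ z : G.Dart, z.fst ≠ y.fst → (E.rot ^ n) y ≠ z := by
      rintro z hz rfl
      exact hz hf
    have h4 : ∀ z : G.Dart, z.fst ≠ y.fst → E.rot ((E.rot ^ n) y) ≠ z := by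
      rintro z hz rfl
      exact hz (by rw [E.rot_fst, hf])
    rw [dartFlow_eq_zero, if_neg, if_neg]
    · ring
    · intro h
      exact h3 _ (by rw [hs1]; exact h2.symm) (Sum.inl_injective h)
    · intro h
      exact h3 _ (by rw [hs1]; exact h1.symm) (Sum.inl_injective h)
    · exact h4 _ h1.symm
    · exact h4 _ h2.symm

theorem inr_cross (hκ : IsChordPotential sel pos x κ) (y : E.crossed) :
    κ (Sum.inr (E.cross y)) = κ (Sum.inr y) + E.dartFlow x (Sum.inr (E.cross y)) := by
  have := hκ.vertexPerm (Sum.inr y)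
  rw [E.vertexPerm_inr] at this
  simpa using this

/-- Since `y` carries no flow, `κ` agrees on its two sides. So its values at the two ends of `y`
differ by the flow of the edge that is passed at the crossing. -/
theorem inl_of_crossed (hκ : IsChordPotential sel pos x κ) (y : E.crossed) (h1 : (y : G.Dart) ≠ x)
    (h2 : (y : G.Dart) ≠ x.symm) :
    κ (Sum.inl (y : G.Dart)) = κ (Sum.inl (y : G.Dart).symm) +
      E.dartFlow x (Sum.inr (E.cross y)) := by
  have hs : (y : G.Dart).symm ≠ x := fun h => h2 (by rw [← h, SimpleGraph.Dart.symm_symm])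
  have hs' : (y : G.Dart).symm ≠ x.symm := fun h => h1 (SimpleGraph.Dart.symm_involutive.injective h)
  have h3 := hκ.inr_cross y
  have h4 := hκ.inr_cross (E.cross y)
  have h5 : E.cross (E.cross y) = ⟨(y : G.Dart).symm, E.symm_mem_crossed y.2⟩ :=
    Subtype.ext (E.cross_cross y)
  have h8 : E.dartFlow x (Sum.inr ⟨(y : G.Dart).symm, E.symm_mem_crossed y.2⟩) = 0 :=
    dartFlow_eq_zero hs hs'
  rw [h5, h8, h3] at h4
  have h6 := hκ.diff (Sum.inl (y : G.Dart))
  rw [E.edgePerm_inl_of_mem y.2, dartFlow_eq_zero (p := Sum.inl _) h1 h2] at h6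
  have h7 := hκ.diff (Sum.inr y)
  rw [E.edgePerm_inr, dartFlow_eq_zero (p := Sum.inr _) h1 h2] at h7
  linarith

theorem inl_eq_inl_symm (hκ : IsChordPotential sel pos x κ) {y : G.Dart} (h1 : y ≠ x)
    (h2 : y ≠ x.symm) (h3 : ∀ h : y ∈ E.crossed, (E.cross ⟨y, h⟩ : G.Dart) ≠ x)
    (h4 : ∀ h : y ∈ E.crossed, (E.cross ⟨y, h⟩ : G.Dart) ≠ x.symm) :
    κ (Sum.inl y) = κ (Sum.inl y.symm) := by
  by_cases hy : y ∈ E.crossed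
  · rw [hκ.inl_of_crossed ⟨y, hy⟩ h1 h2, dartFlow_eq_zero (p := Sum.inr _) (h3 hy) (h4 hy), add_zero]
  · have h6 := hκ.diff (Sum.inl y)
    rw [E.edgePerm_inl_of_not_mem hy, dartFlow_eq_zero (p := Sum.inl _) h1 h2] at h6
    linarith

variable (sel pos) in
/-- The indicator of the arc from the tail to the head of `x`, at the vertex of `y`. -/
noncomputable def onArc (x y : G.Dart) : ℝ :=
  arcIndicator E.outer pos (pos (Sum.inl (sel x))) (pos (Sum.inl (sel x.symm))) (Sum.inl (sel y))

theorem sub_onArc_eq [Finite V] (hs1 : ∀ d, (sel d).fst = d.fst)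
    (hs3 : ∀ d, Sum.inl (sel d) ∈ E.outer)
    (hκ : IsChordPotential sel pos x κ) {y z : G.Dart}
    (h : E.comp (Sum.inl y) = E.comp (Sum.inl z)) :
    κ (Sum.inl (sel y)) - onArc sel pos x y = κ (Sum.inl (sel z)) - onArc sel pos x z := by
  apply hκ.outer _ (hs3 y) _ (hs3 z)
  rw [E.comp_inl_of_fst_eq (hs1 y), E.comp_inl_of_fst_eq (hs1 z), h]

/-- Two edges without a common end that do not cross. -/
theorem onArc_symm_eq [Finite V] (hs1 : ∀ d, (sel d).fst = d.fst)
    (hs3 : ∀ d, Sum.inl (sel d) ∈ E.outer) (hκ : IsChordPotential sel pos x κ) {y : G.Dart}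
    (h1 : y.fst ≠ x.fst) (h2 : y.fst ≠ x.snd) (h3 : y.snd ≠ x.fst) (h4 : y.snd ≠ x.snd)
    : onArc sel pos x y = onArc sel pos x y.symm +
      κ (Sum.inl y) - κ (Sum.inl y.symm) := by
  have h5 := hκ.sub_onArc_eq hs1 hs3 (E.comp_symm y).symm
  have h6 := hκ.inl_eq_of_fst_ne hs1 (hs1 y).symm h1 h2
  have h7 := hκ.inl_eq_of_fst_ne hs1 (hs1 y.symm).symm h3 h4
  linarith

theorem _root_.OuterOnePlane.exists_cross_symm_iff {x y : G.Dart} :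
    (∃ h : x.symm ∈ E.crossed, (E.cross ⟨x.symm, h⟩ : G.Dart) = y.symm) ↔
      ∃ h : x ∈ E.crossed, (E.cross ⟨x, h⟩ : G.Dart) = y := by
  constructor
  · rintro ⟨h, hy⟩
    have h' : x ∈ E.crossed := by simpa using E.symm_mem_crossed h
    refine ⟨h', ?_⟩
    rw [E.cross_symm ⟨x, h'⟩] at hy
    exact SimpleGraph.Dart.symm_involutive.injective hy
  · rintro ⟨h, rfl⟩
    exact ⟨E.symm_mem_crossed h, E.cross_symm ⟨x, h⟩⟩

theorem _root_.OuterOnePlane.cross_eq_symm_of_cross_eq {x y : G.Dart} (h : x ∈ E.crossed)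
    (hy : (E.cross ⟨x, h⟩ : G.Dart) = y) :
    ∃ h' : y ∈ E.crossed, (E.cross ⟨y, h'⟩ : G.Dart) = x.symm := by
  subst hy
  exact ⟨(E.cross ⟨x, h⟩).2, E.cross_cross ⟨x, h⟩⟩

theorem _root_.OuterOnePlane.ends_ne_of_cross_eq {x y : G.Dart} (h : x ∈ E.crossed)
    (hy : (E.cross ⟨x, h⟩ : G.Dart) = y) :
    y.fst ≠ x.fst ∧ y.fst ≠ x.snd ∧ y.snd ≠ x.fst ∧ y.snd ≠ x.snd := by
  have hd := E.cross_disjoint ⟨x, h⟩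
  rw [hy] at hd
  have h1 : x.edge = s(x.fst, x.snd) := rfl
  have h2 : y.edge = s(y.fst, y.snd) := rfl
  simp only [h1, h2, Sym2.mem_iff, not_or] at hd
  have h3 := hd x.fst (Or.inl rfl)
  have h4 := hd x.snd (Or.inr rfl)
  exact ⟨Ne.symm h3.1, Ne.symm h4.1, Ne.symm h3.2, Ne.symm h4.2⟩

/-- The value jumps by one along an edge that crosses `x` from right to left. -/
theorem inl_of_cross_eq (hκ : IsChordPotential sel pos x κ) {y : G.Dart} (h : x ∈ E.crossed)
    (hy : (E.cross ⟨x, h⟩ : G.Dart) = y) : κ (Sum.inl y.symm) = κ (Sum.inl y) + 1 := by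
  obtain ⟨h', hx⟩ := OuterOnePlane.cross_eq_symm_of_cross_eq h hy
  obtain ⟨n1, n2, -, -⟩ := OuterOnePlane.ends_ne_of_cross_eq h hy
  have h1 := hκ.inl_of_crossed ⟨y, h'⟩ (fun h => n1 (congrArg (fun d : G.Dart => d.fst) h))
    (fun h => n2 (congrArg (fun d : G.Dart => d.fst) h))
  have h2 : E.dartFlow x (Sum.inr (E.cross ⟨y, h'⟩)) = -1 := by
    have h3 : BarVisRep.wholeDart E.toOnePlaneMap (Sum.inr (E.cross ⟨y, h'⟩)) = x.symm := hx
    simp [OnePlaneMap.dartFlow, h3, x.symm_ne]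
  rw [h2] at h1
  simp only at h1
  linarith

end IsChordPotential

end OuterOnePlane

namespace OuterOnePlane

variable {V : Type*} {G : SimpleGraph V} {E : OuterOnePlane G}

open Classical in
/-- If a function on the darts at a vertex jumps up before `x` and down after `m` only, and it takes
the values zero and one, except possibly at `x`, then it is one at `x`. -/
theorem eq_one_of_rot_step [Finite V] {x m : G.Dart} {A : G.Dart → ℝ} (hm : x.fst = m.fst)
    (hstep : ∀ y : G.Dart, y.fst = x.fst →
      A (E.rot y) = A y + (if E.rot y = x then 1 else 0) - (if y = m then 1 else 0))
    (hAm : A m = 1) (h01 : ∀ y : G.Dart, y.fst = x.fst → y ≠ x → A y = 0 ∨ A y = 1) : A x = 1 := by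
  by_cases hxm : x = m
  · rw [hxm, hAm]
  have hrot : ∀ y : G.Dart, y.fst = x.fst → E.rot y ≠ y := by
    intro y hy h
    have h1 : ∀ z : G.Dart, z.fst = x.fst → z = y := by
      intro z hz
      obtain ⟨n, rfl⟩ := E.exists_rot_pow (hy.trans hz.symm)
      exact Equiv.Perm.pow_apply_eq_self_of_apply_eq_self h n
    exact hxm ((h1 x rfl).trans (h1 m hm.symm).symm)
  have h2 := hstep x rfl
  rw [if_neg (hrot x rfl), if_neg hxm] at h2
  have h3 := h01 (E.rot x) (E.rot_fst x) (hrot x rfl)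
  have hp : (E.rot.symm x).fst = x.fst := by
    rw [← E.rot_fst (E.rot.symm x), Equiv.apply_symm_apply]
  have h4 := hstep (E.rot.symm x) hp
  rw [Equiv.apply_symm_apply, if_pos rfl] at h4
  by_cases h5 : E.rot.symm x = m
  · rw [h5, if_pos rfl, hAm] at h4
    linarith
  · rw [if_neg h5] at h4
    have h6 := h01 _ hp (fun h => hrot x rfl (by conv_lhs => rw [← h]; simp))
    rcases h3 with h3 | h3 <;> rcases h6 with h6 | h6 <;> linarith

-- The order is that of the corners `sel` along the outer walks. Crossings and rotations are
-- recovered by comparing, for each dart `x`, the jumps of its potential with the arc indicator: on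
-- the outer face of one component the two differ by a constant.
open Classical in
theorem exists_chordOrder [Finite V] (E : OuterOnePlane G) : ∃ σ sel, E.ChordOrder σ sel := by
  obtain ⟨sel, hs1, hs2, hs3⟩ := E.exists_sel
  have : Finite E.toOnePlaneMap.Component :=
    Finite.of_surjective (Quot.mk _) Quot.mk_surjective
  obtain ⟨pos, hinj, hpos⟩ := exists_walk_position E.facePerm E.outer E.facePerm_mem_outer E.comp
    E.comp_facePerm E.outer_sameCycle
  have hpot := fun x hx => E.exists_chordPotential (pos := pos) hs1 hs3
    (fun a ha b hb hab hlt p => by convert hpos a ha b hb hab hlt p) x hx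
  obtain ⟨m, ⟨idx⟩⟩ := Finite.exists_equiv_fin V
  -- Positions are doubled so that isolated vertices, which have no position on a walk, can take the
  -- odd numbers.
  let σ : V → ℕ := fun v => if h : ∃ d : G.Dart, d.fst = v then 2 * pos (Sum.inl (sel h.choose))
    else 2 * idx v + 1
  have hσ : ∀ d : G.Dart, σ d.fst = 2 * pos (Sum.inl (sel d)) := by
    intro d
    have h : ∃ e : G.Dart, e.fst = d.fst := ⟨d, rfl⟩
    simp only [σ, dif_pos h]
    rw [hs2 _ _ h.choose_spec]
  have hσinj : Function.Injective σ := by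
    intro v w hvw
    by_cases hv : ∃ d : G.Dart, d.fst = v <;> by_cases hw : ∃ d : G.Dart, d.fst = w
    · obtain ⟨d, rfl⟩ := hv
      obtain ⟨e, rfl⟩ := hw
      rw [hσ, hσ] at hvw
      have h1 := hinj (hs3 d) (hs3 e) (by omega)
      rw [← hs1 d, ← hs1 e, Sum.inl_injective h1]
    · simp only [σ, dif_pos hv, dif_neg hw] at hvw
      omega
    · simp only [σ, dif_neg hv, dif_pos hw] at hvw
      omega
    · simp only [σ, dif_neg hv, dif_neg hw] at hvw
      exact idx.injective (Fin.ext (by omega))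
  have hσs : ∀ d : G.Dart, σ d.snd = 2 * pos (Sum.inl (sel d.symm)) := fun d => hσ d.symm
  have hlt : ∀ x : G.Dart, σ x.fst < σ x.snd →
      pos (Sum.inl (sel x)) < pos (Sum.inl (sel x.symm)) := by
    intro x h
    rw [hσ, hσs] at h
    omega
  have harc : ∀ x y : G.Dart, IsChordPotential.onArc sel pos x y =
      if σ x.fst ≤ σ y.fst ∧ σ y.fst < σ x.snd then 1 else 0 := by
    intro x y
    unfold IsChordPotential.onArc arcIndicator
    simp only [hs3 y, true_and, hσ, hσs]
    congr 1
    exact propext ⟨fun h => ⟨by omega, by omega⟩, fun h => ⟨by omega, by omega⟩⟩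
  have hne : ∀ x : G.Dart, σ x.fst ≠ σ x.snd := fun x h => x.adj.ne (hσinj h)
  have hσne : ∀ {v w : V}, v ≠ w → σ v ≠ σ w := fun h h' => h (hσinj h')
  -- Crossings are interleaved pairs of edges.
  have hcross1 : ∀ x y : G.Dart, σ x.fst < σ x.snd →
      ((∃ h : x ∈ E.crossed, (E.cross ⟨x, h⟩ : G.Dart) = y) ↔
        ChordCross (σ x.fst) (σ x.snd) (σ y.fst) (σ y.snd)) := by
    intro x y hx
    obtain ⟨κ, hκ⟩ := hpot x (hlt x hx)
    constructor
    · rintro ⟨h, hy⟩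
      obtain ⟨n1, n2, n3, n4⟩ := ends_ne_of_cross_eq h hy
      -- The potential rises by one along `y`, hence so does the arc indicator: the head of `y` is
      -- on the arc and its tail is not.
      have h1 := hκ.onArc_symm_eq hs1 hs3 n1 n2 n3 n4
      rw [hκ.inl_of_cross_eq h hy, harc, harc] at h1
      have m1 := hσne n1
      have m2 := hσne n2
      have m3 := hσne n3
      have m4 := hσne n4
      have h2 : y.symm.fst = y.snd := rfl
      rw [h2] at h1
      left
      split_ifs at h1 with h3 h4 h4
      · linarith
      · linarith
      · omega
      · linarith
    · intro hc
      rcases hc with ⟨-, hc1, hc2⟩ | ⟨hc, -⟩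
      swap
      · omega
      have n1 : y.fst ≠ x.fst := fun h => by rw [h] at hc2; omega
      have n2 : y.fst ≠ x.snd := fun h => by rw [h] at hc2; omega
      have n3 : y.snd ≠ x.fst := fun h => by rw [h] at hc1; omega
      have n4 : y.snd ≠ x.snd := fun h => by rw [h] at hc1; omega
      have h1 := hκ.onArc_symm_eq hs1 hs3 n1 n2 n3 n4
      have h2 : y.symm.fst = y.snd := rfl
      rw [harc, harc, h2, if_neg (by omega), if_pos (by omega)] at h1
      -- The interleaving demands that the potential rises by one along `y`. It would be constant if
      -- the edges did not cross, and it would fall if `y` crossed in the other direction.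
      by_contra hcon
      have h3 : ∀ h : y ∈ E.crossed, (E.cross ⟨y, h⟩ : G.Dart) ≠ x.symm := by
        intro h h4
        obtain ⟨h5, h6⟩ := cross_eq_symm_of_cross_eq h h4
        exact hcon (exists_cross_symm_iff.1 ⟨h5, h6⟩)
      by_cases h4 : ∃ h : y ∈ E.crossed, (E.cross ⟨y, h⟩ : G.Dart) = x
      · obtain ⟨h5, h6⟩ := h4
        obtain ⟨h7, h8⟩ := cross_eq_symm_of_cross_eq h5 h6
        have := hκ.inl_of_cross_eq h7 h8
        rw [SimpleGraph.Dart.symm_symm] at this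
        linarith
      · have := hκ.inl_eq_inl_symm (y := y) (fun h => n1 (by rw [h])) (fun h => n2 (by rw [h]; rfl))
          (fun h h' => h4 ⟨h, h'⟩) h3
        linarith
  have hcross : ∀ x y : G.Dart, ((∃ h : x ∈ E.crossed, (E.cross ⟨x, h⟩ : G.Dart) = y) ↔
      ChordCross (σ x.fst) (σ x.snd) (σ y.fst) (σ y.snd)) := by
    intro x y
    rcases lt_or_gt_of_ne (hne x) with hx | hx
    · exact hcross1 x y hx
    · rw [← exists_cross_symm_iff, hcross1 x.symm y.symm hx]
      have h1 : x.symm.fst = x.snd := rfl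
      have h2 : x.symm.snd = x.fst := rfl
      have h3 : y.symm.fst = y.snd := rfl
      have h4 : y.symm.snd = y.fst := rfl
      rw [h1, h2, h3, h4]
      have := hσne y.adj.ne
      unfold ChordCross
      omega
  refine ⟨σ, sel, hσinj, hs1, hs2, hs3, hcross, ?_⟩
  -- `A` is the potential around the tail of `x`, normalised to one at `sel x`; if `x` runs
  -- backwards in the order, the potential of `x.symm` is used with opposite sign. No other dart at
  -- this vertex crosses `x`, so the value at `y ≠ x` is that at the other end of `y`, where the arc
  -- indicator gives it.
  have hrot : ∀ x : G.Dart, ∃ A : G.Dart → ℝ, (∀ y : G.Dart, y.fst = x.fst →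
      A (E.rot y) = A y + (if E.rot y = x then 1 else 0) - (if y = sel x then 1 else 0)) ∧
      A (sel x) = 1 ∧ ∀ y : G.Dart, y.fst = x.fst → y ≠ x →
        A y = if KeyLT (σ x.fst) (σ x.snd) (σ y.snd) then 1 else 0 := by
    intro x
    have hsymm : ∀ y z : G.Dart, y.fst = x.fst → z.fst = x.fst → y ≠ z.symm := by
      rintro y z hy hz rfl
      have h1 : z.snd = x.fst := hy
      exact z.adj.ne (by rw [hz, h1])
    have hsel : ∀ y : G.Dart, y.fst = x.fst → y ≠ sel x.symm := by
      intro y hy h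
      have h1 := hs1 x.symm
      rw [← h, hy] at h1
      exact x.adj.ne h1
    have hsnd : ∀ y : G.Dart, y.fst = x.fst → y ≠ x → y.snd ≠ x.snd := by
      intro y h1 h2 h3
      exact h2 (SimpleGraph.Dart.ext _ _ (Prod.ext h1 h3))
    have hnc : ∀ y z : G.Dart, y.fst = x.fst → z.edge = x.edge → ∀ h : y ∈ E.crossed,
        (E.cross ⟨y, h⟩ : G.Dart) ≠ z := by
      intro y z hy hz h h'
      have h1 := E.cross_disjoint ⟨y, h⟩ x.fst
      rw [h', hz] at h1
      exact h1 (by rw [← hy]; exact Sym2.mem_mk_left _ _) (Sym2.mem_mk_left _ _)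
    rcases lt_or_gt_of_ne (hne x) with hx | hx
    · obtain ⟨κ, hκ⟩ := hpot x (hlt x hx)
      refine ⟨fun y => κ (Sum.inl y) - (κ (Sum.inl (sel x)) - 1), ?_, by ring, ?_⟩
      · intro y hy
        have h1 := hκ.vertexPerm (Sum.inl y)
        rw [E.vertexPerm_inl] at h1
        simp only [Sum.inl.injEq, if_neg (hsel y hy), OnePlaneMap.dartFlow,
          OnePlaneMap.wholeDart_inl, hsymm (E.rot y) x ((E.rot_fst y).trans hy) rfl, if_false] at h1
        dsimp only
        rw [h1]
        by_cases c1 : E.rot y = x <;> by_cases c2 : y = sel x <;>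
          simp only [c1, c2, if_true, if_false] <;> ring
      · intro y hy hyx
        have h1 := hκ.inl_eq_inl_symm hyx (hsymm y x hy rfl) (hnc y x hy rfl)
          (hnc y x.symm hy x.edge_symm)
        have h2 : y.symm.fst = y.snd := rfl
        have h3 := hκ.inl_eq_of_fst_ne hs1 (hs1 y.symm).symm
          (by rw [h2, ← hy]; exact y.adj.ne.symm) (hsnd y hy hyx)
        have h4 := hκ.sub_onArc_eq hs1 hs3 (y := y.symm) (z := x)
          ((E.comp_symm y).trans (E.comp_inl_of_fst_eq hy))
        rw [harc x y.symm, harc x x,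
          if_pos (c := _ ≤ σ x.fst ∧ σ x.fst < _) ⟨le_rfl, hx⟩, ← h3, ← h1, h2] at h4
        have m1 := hσne (hsnd y hy hyx)
        have m2 := hne y
        rw [hy] at m2
        have h5 : KeyLT (σ x.fst) (σ x.snd) (σ y.snd) ↔
            σ x.fst ≤ σ y.snd ∧ σ y.snd < σ x.snd := by
          unfold KeyLT
          omega
        rw [if_congr h5 rfl rfl]
        linarith
    · obtain ⟨κ, hκ⟩ := hpot x.symm (hlt x.symm hx)
      have hx1 : x.symm.fst = x.snd := rfl
      have hx2 : x.symm.snd = x.fst := rfl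
      refine ⟨fun y => 1 - (κ (Sum.inl y) - κ (Sum.inl (sel x))), ?_, by ring, ?_⟩
      · intro y hy
        have h1 := hκ.vertexPerm (Sum.inl y)
        rw [E.vertexPerm_inl] at h1
        simp only [Sum.inl.injEq, if_neg (hsel y hy), OnePlaneMap.dartFlow,
          SimpleGraph.Dart.symm_symm,
          OnePlaneMap.wholeDart_inl, hsymm (E.rot y) x ((E.rot_fst y).trans hy) rfl, if_false] at h1
        dsimp only
        rw [h1]
        by_cases c1 : E.rot y = x <;> by_cases c2 : y = sel x <;>
          simp only [c1, c2, if_true, if_false] <;> ring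
      · intro y hy hyx
        have h1 := hκ.inl_eq_inl_symm (hsymm y x hy rfl)
          (by rwa [SimpleGraph.Dart.symm_symm]) (hnc y x.symm hy x.edge_symm)
          (hnc y x.symm.symm hy (by rw [SimpleGraph.Dart.symm_symm]))
        have h2 : y.symm.fst = y.snd := rfl
        have h3 := hκ.inl_eq_of_fst_ne hs1 (hs1 y.symm).symm
          (hsnd y hy hyx) (by rw [h2, hx2, ← hy]; exact y.adj.ne.symm)
        have h4 := hκ.sub_onArc_eq hs1 hs3 (y := y.symm) (z := x)
          ((E.comp_symm y).trans (E.comp_inl_of_fst_eq hy))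
        rw [harc x.symm y.symm, harc x.symm x, hx1, hx2,
          if_neg (c := _ ∧ σ x.fst < σ x.fst) (fun h => lt_irrefl _ h.2), ← h3, ← h1, h2] at h4
        have m1 := hσne (hsnd y hy hyx)
        have m2 := hne y
        rw [hy] at m2
        have h5 : KeyLT (σ x.fst) (σ x.snd) (σ y.snd) ↔
            ¬ (σ x.snd ≤ σ y.snd ∧ σ y.snd < σ x.fst) := by
          unfold KeyLT
          omega
        rw [if_congr h5 rfl rfl, ite_not]
        split_ifs at h4 ⊢ <;> linarith
  intro x y hxy
  obtain ⟨A, h1, h2, h3⟩ := hrot x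
  -- The arc does not determine the value at `x` itself; it is forced by the jumps around the
  -- vertex.
  have h4 : A x = 1 := eq_one_of_rot_step (hs1 x).symm h1 h2 (fun y hy hyx => by
    rw [h3 y hy hyx]
    split_ifs <;> simp)
  have h5 : ∀ y : G.Dart, y.fst = x.fst →
      A y = if y = x ∨ KeyLT (σ x.fst) (σ x.snd) (σ y.snd) then 1 else 0 := by
    intro y hy
    by_cases hyx : y = x
    · rw [if_pos (Or.inl hyx), hyx, h4]
    · rw [h3 y hy hyx]
      simp [hyx]
  rw [← h5 y hxy.symm, ← h5 (E.rot y) ((E.rot_fst y).trans hxy.symm), h1 y hxy.symm, hs2 x y hxy]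

end OuterOnePlane

/-! ### Rows for the vertices of a chord diagram -/

/-- Every chord crosses at most one other chord. -/
def CrossedOnce (C : ℤ → ℤ → Prop) : Prop :=
  ∀ p q r s r' s', C p q → C r s → C r' s' →
    ((p < r ∧ r < q ∧ q < s) ∨ (r < p ∧ p < s ∧ s < q)) →
    ((p < r' ∧ r' < q ∧ q < s') ∨ (r' < p ∧ p < s' ∧ s' < q)) → r = r' ∧ s = s'

/-- Rows for the points of `[p, j]`: all points below a chord are above its lower end, and one chord
of each crossing pair is level; this holds also for the chords that are crossed by a chord from the
left of `p`. -/
structure IsRowFunction (C : ℤ → ℤ → Prop) (p j : ℤ) (f : ℤ → ℕ) : Prop where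
  first : f p = 0
  chord : ∀ u w k, C u w → p ≤ u → w ≤ j → u < k → k < w → min (f u) (f w) < f k
  level : ∀ a b c d, p ≤ a → a < b → b < c → c < d → d ≤ j → C a c → C b d → f a = f c ∨ f b = f d
  marked : ∀ x t b d, x < p → p ≤ b → b < t → t < d → d ≤ j → C x t → C b d → f b = f d
  pos : (∀ x t d, x < p → p < t → t < d → d ≤ j → C x t → ¬ C p d) → ∀ k, p < k → k ≤ j → 0 < f k

theorem CrossedOnce.mirror {C : ℤ → ℤ → Prop} (h : CrossedOnce C) :
    CrossedOnce (fun a b => C (-b) (-a)) := by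
  intro p q r s r' s' h1 h2 h3 h4 h5
  have := h _ _ _ _ _ _ h1 h2 h3 (by omega) (by omega)
  omega

/-- With `p` alone in the bottom row, the chords from `p` satisfy the row condition. A chord that
crosses one of them is level, because for the interval from `p + 1` it is crossed from the left. The
only obstacle would be a chord from `p` that must itself be level, which `hp` excludes. -/
theorem isRowFunction_of_not_marked {C : ℤ → ℤ → Prop} {p j : ℤ} {f : ℤ → ℕ}
    (hf : IsRowFunction C (p + 1) j f)
    (hp : ∀ x t d, x < p → p < t → t < d → d ≤ j → C x t → ¬ C p d) :
    IsRowFunction C p j (fun x => if x ≤ p then 0 else f x + 1) where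
  first := by simp
  chord u w k h hu hw h1 h2 := by
    rcases eq_or_lt_of_le hu with rfl | hu
    · simp [not_le.2 h1]
    · have := hf.chord u w k h (by omega) hw h1 h2
      simp only [not_le.2 hu, not_le.2 (show p < w by omega), not_le.2 (show p < k by omega), if_false]
      omega
  level a b c d ha h1 h2 h3 h4 hac hbd := by
    simp only [not_le.2 (show p < b by omega), not_le.2 (show p < c by omega),
      not_le.2 (show p < d by omega), if_false]
    rcases eq_or_lt_of_le ha with rfl | ha
    · right
      rw [hf.marked p c b d (by omega) (by omega) h2 h3 h4 hac hbd]
    · have := hf.level a b c d (by omega) h1 h2 h3 h4 hac hbd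
      simp only [not_le.2 ha, if_false]
      omega
  marked x t b d hx hb h1 h2 h3 hxt hbd := by
    rcases eq_or_lt_of_le hb with rfl | hb
    · exact (hp x t d hx h1 h2 h3 hxt hbd).elim
    · simp only [not_le.2 hb, not_le.2 (show p < d by omega), if_false]
      rw [hf.marked x t b d (by omega) (by omega) h1 h2 h3 hxt hbd]
  pos _ k hk _ := by simp [not_le.2 hk]

/-- The chord `p d` has to be level because `x t` crosses it, so `p` and `d` both get row zero. The
parts `[p, t]`, `[t, d]` and `[d, j]` are solved separately, the middle one from its right end. To
agree at `t`, the first two solutions are multiplied by each other's value at `t`; positive factors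
preserve all equalities and strict inequalities between rows. -/
theorem isRowFunction_of_marked {C : ℤ → ℤ → Prop} (hC : CrossedOnce C) {p t d j x : ℤ}
    {f g h : ℤ → ℕ} (hf : IsRowFunction C p t f)
    (hg : IsRowFunction (fun a b => C (-b) (-a)) (-d) (-t) (fun y => g (-y)))
    (hh : IsRowFunction C d j h) (hx : x < p) (hpt : p < t) (htd : t < d) (hdj : d ≤ j)
    (hxt : C x t) (hpd : C p d) :
    IsRowFunction C p j (fun y => if y ≤ t then f y * g t else if y < d then g y * f t else h y) := by
  set F : ℤ → ℕ := fun y => if y ≤ t then f y * g t else if y < d then g y * f t else h y with hF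
  have hgd : g d = 0 := by simpa using hg.first
  -- A chord from the left of `p` that ends before `d` crosses `p d`, hence is `x t`. So no chord
  -- from `p` inside `[p, t]` is crossed from the left, and `pos` applies.
  have hft : 0 < f t := hf.pos (fun x' t' d' h1 h2 h3 h4 h5 _ => by
    have := hC p d x t x' t' hpd hxt h5 (by omega) (by omega)
    omega) t hpt le_rfl
  have hg0 : ∀ k, t ≤ k → k < d → 0 < g k := fun k h1 h2 => by
    have := hg.pos (fun x' t' d' h1 h2 h3 h4 h5 _ => by
      have := hC p d x t (-t') (-x') hpd hxt h5 (by omega) (by omega)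
      omega) (-k) (by omega) (by omega)
    simpa using this
  have hf0 : ∀ k, p < k → k ≤ t → 0 < f k := hf.pos (fun x' t' d' h1 h2 h3 h4 h5 _ => by
    have := hC p d x t x' t' hpd hxt h5 (by omega) (by omega)
    omega)
  have hgt := hg0 t le_rfl htd
  have e1 : ∀ y, y ≤ t → F y = f y * g t := fun y hy => by simp only [hF, if_pos hy]
  have e2 : ∀ y, t ≤ y → y ≤ d → F y = g y * f t := fun y h1 h2 => by
    rcases eq_or_lt_of_le h1 with rfl | h1
    · rw [e1 _ le_rfl, mul_comm]
    rcases eq_or_lt_of_le h2 with rfl | h2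
    · simp only [hF, if_neg (not_le.2 h1), if_neg (lt_irrefl _), hh.first, hgd, zero_mul]
    · simp only [hF, if_neg (not_le.2 h1), if_pos h2]
  have e3 : ∀ y, d ≤ y → F y = h y := fun y h1 => by
    simp only [hF, if_neg (not_le.2 (htd.trans_le h1)), if_neg (not_lt.2 h1)]
  have hFp : F p = 0 := by rw [e1 p hpt.le, hf.first, zero_mul]
  have hFd : F d = 0 := by rw [e3 d le_rfl, hh.first]
  -- A chord that leaves its part crosses `x t` or `p d`. These two already cross each other, so
  -- only `p d` itself can extend over two parts.
  have hsplit : ∀ u w, C u w → p ≤ u → u < w → w ≤ t ∨ (t ≤ u ∧ w ≤ d) ∨ d ≤ u ∨ (u = p ∧ w = d) := by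
    intro u w huw h1 h2
    by_contra hcon
    by_cases h3 : w ≤ d
    · have := hC x t u w p d hxt huw hpd (by omega) (by omega)
      omega
    · rcases eq_or_lt_of_le h1 with rfl | h1
      · have := hC x t p w p d hxt huw hpd (by omega) (by omega)
        omega
      · have := hC p d u w x t hpd huw hxt (by omega) (by omega)
        omega
  refine ⟨hFp, ?_, ?_, ?_, ?_⟩
  · intro u w k huw h1 h2 h3 h4
    rcases hsplit u w huw h1 (h3.trans h4) with h5 | ⟨h5, h6⟩ | h5 | ⟨rfl, rfl⟩
    · rw [e1 u (by omega), e1 w h5, e1 k (by omega), ← min_mul_of_nonneg _ _ (Nat.zero_le _)]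
      exact Nat.mul_lt_mul_of_pos_right (hf.chord u w k huw h1 h5 h3 h4) hgt
    · rw [e2 u (by omega) (by omega), e2 w (by omega) h6, e2 k (by omega) (by omega),
        ← min_mul_of_nonneg _ _ (Nat.zero_le _)]
      have := hg.chord (-w) (-u) (-k) (by simpa using huw) (by omega) (by omega) (by omega) (by omega)
      simp only [neg_neg] at this
      rw [min_comm] at this
      exact Nat.mul_lt_mul_of_pos_right this hft
    · rw [e3 u h5, e3 w (by omega), e3 k (by omega)]
      exact hh.chord u w k huw h5 h2 h3 h4
    · rw [hFp, hFd]
      rcases le_or_gt k t with h6 | h6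
      · rw [e1 k h6]
        exact Nat.mul_pos (hf0 k h3 h6) hgt
      · rw [e2 k h6.le h4.le]
        exact Nat.mul_pos (hg0 k h6.le h4) hft
  · intro a b c e ha h1 h2 h3 he hac hbe
    rcases hsplit a c hac ha (h1.trans h2) with h5 | ⟨h5, h6⟩ | h5 | ⟨rfl, rfl⟩
    · rcases hsplit b e hbe (by omega) (h2.trans h3) with h7 | ⟨h7, h8⟩ | h7 | ⟨rfl, rfl⟩
      · rw [e1 a (by omega), e1 b (by omega), e1 c (by omega), e1 e (by omega)]
        rcases hf.level a b c e ha h1 h2 h3 h7 hac hbe with h | h <;> simp [h]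
      all_goals omega
    · rcases hsplit b e hbe (by omega) (h2.trans h3) with h7 | ⟨h7, h8⟩ | h7 | ⟨rfl, rfl⟩
      · omega
      · rw [e2 a (by omega) (by omega), e2 b (by omega) (by omega), e2 c (by omega) (by omega),
          e2 e (by omega) (by omega)]
        have := hg.level (-e) (-c) (-b) (-a) (by omega) (by omega) (by omega) (by omega) (by omega)
          (by simpa using hbe) (by simpa using hac)
        simp only [neg_neg] at this
        rcases this with h | h <;> simp [h]
      all_goals omega
    · rw [e3 a (by omega), e3 b (by omega), e3 c (by omega), e3 e (by omega)]
      exact hh.level a b c e h5 h1 h2 h3 he hac hbe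
    · have := hC a c b e x t hpd hbe hxt (by omega) (by omega)
      omega
  · intro x' t' b e hx' hb h1 h2 he hxt' hbe
    rcases hsplit b e hbe hb (h1.trans h2) with h7 | ⟨h7, h8⟩ | h7 | ⟨rfl, rfl⟩
    · have := hC p d x t x' t' hpd hxt hxt' (by omega) (by omega)
      omega
    · have := hC p d x t x' t' hpd hxt hxt' (by omega) (by omega)
      omega
    · rw [e3 b h7, e3 e (by omega)]
      exact hh.marked x' t' b e (by omega) h7 h1 h2 he hxt' hbe
    · rw [hFp, hFd]
  · intro hcon
    exact (hcon x t d hx hpt htd hdj hxt hpd).elim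

/-- Induction on the length of the interval. All chord diagrams are treated at once, because the
middle part is solved in the reflected diagram. -/
theorem exists_isRowFunction (n : ℕ) : ∀ (C : ℤ → ℤ → Prop), CrossedOnce C → ∀ p j : ℤ, p ≤ j →
    j - p < n → ∃ f, IsRowFunction C p j f := by
  induction n with
  | zero => intro C _ p j h1 h2; simp at h2; omega
  | succ n ih =>
    intro C hC p j hpj hn
    by_cases hm : ∀ x t d, x < p → p < t → t < d → d ≤ j → C x t → ¬ C p d
    · rcases eq_or_lt_of_le hpj with rfl | hlt
      · exact ⟨fun _ => 0, rfl, fun _ _ _ _ _ _ _ _ => by omega, fun _ _ _ _ _ _ _ _ _ => by omega,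
          fun _ _ _ _ _ _ _ _ _ => by omega, fun _ _ _ _ => by omega⟩
      · obtain ⟨f, hf⟩ := ih C hC (p + 1) j (by omega) (by push_cast at hn; omega)
        exact ⟨_, isRowFunction_of_not_marked hf hm⟩
    · push Not at hm
      obtain ⟨x, t, d, hx, hpt, htd, hdj, hxt, hpd⟩ := hm
      push_cast at hn
      obtain ⟨f, hf⟩ := ih C hC p t hpt.le (by omega)
      obtain ⟨g, hg⟩ := ih _ hC.mirror (-d) (-t) (by omega) (by omega)
      obtain ⟨h, hh⟩ := ih C hC d j hdj (by omega)
      exact ⟨_, isRowFunction_of_marked hC (g := fun y => g (-y)) hf (by simpa using hg) hh hx hpt htd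
        hdj hxt hpd⟩

/-! ### Bars and columns -/

/-- The coordinates of a bar visibility representation. The edge between `u` and a vertex `w` in a
higher row is drawn in the column `col w u`; the columns of a vertex `w` lie between `X w` and the
columns of the next vertices in the order `σ`. -/
structure BarPlan {V : Type*} (G : SimpleGraph V) where
  σ : V → ℕ
  ρ : V → ℕ
  X : V → ℤ
  col : V → V → ℤ
  left : V → ℤ
  right : V → ℤ
  σ_inj : Function.Injective σ
  row_chord : ∀ u w k, G.Adj u w → σ u < σ k → σ k < σ w → min (ρ u) (ρ w) < ρ k
  row_level : ∀ a b c d, G.Adj a c → G.Adj b d → σ a < σ b → σ b < σ c → σ c < σ d →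
    ρ a = ρ c ∨ ρ b = ρ d
  X_lt_X : ∀ v w, σ v < σ w → X v < X w
  X_lt_col : ∀ w u, G.Adj w u → ρ u < ρ w → X w < col w u
  col_lt_X : ∀ w u v, G.Adj w u → ρ u < ρ w → σ w < σ v → col w u < X v
  -- Bars of lower neighbours of `w` come from the left or from the right, up to their column. A
  -- farther neighbour on the same side is lower, so its edge has to pass beyond the end of the bar
  -- of the nearer one. On the left the nearer neighbour thus has the smaller column, on the right
  -- the larger one.
  col_left : ∀ w u u', G.Adj w u → ρ u < ρ w → G.Adj w u' → ρ u' < ρ w → σ u < σ u' → σ u' < σ w →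
    col w u' < col w u
  col_mid : ∀ w u u', G.Adj w u → ρ u < ρ w → G.Adj w u' → ρ u' < ρ w → σ u < σ w → σ w < σ u' →
    col w u < col w u'
  col_right : ∀ w u u', G.Adj w u → ρ u < ρ w → G.Adj w u' → ρ u' < ρ w → σ w < σ u → σ u < σ u' →
    col w u' < col w u
  left_le_X : ∀ v, left v ≤ X v
  left_le_col : ∀ w u, G.Adj w u → ρ u < ρ w → left w ≤ col w u
  left_le_col' : ∀ w u, G.Adj w u → ρ u < ρ w → left u ≤ col w u
  left_eq : ∀ v, left v = X v ∨ (∃ u, G.Adj v u ∧ ρ u < ρ v ∧ left v = col v u) ∨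
    ∃ w, G.Adj w v ∧ ρ v < ρ w ∧ left v = col w v
  X_le_right : ∀ v, X v ≤ right v
  col_le_right : ∀ w u, G.Adj w u → ρ u < ρ w → col w u ≤ right w
  col_le_right' : ∀ w u, G.Adj w u → ρ u < ρ w → col w u ≤ right u
  right_eq : ∀ v, right v = X v ∨ (∃ u, G.Adj v u ∧ ρ u < ρ v ∧ right v = col v u) ∨
    ∃ w, G.Adj w v ∧ ρ v < ρ w ∧ right v = col w v

namespace BarPlan

variable {V : Type*} {G : SimpleGraph V} (P : BarPlan G)

/-- The column `y` belongs to the vertex `w`. -/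
def InBlock (w : V) (y : ℤ) : Prop := P.X w ≤ y ∧ ∀ v, P.σ w < P.σ v → y < P.X v

variable {P}

theorem inBlock_X (w : V) : P.InBlock w (P.X w) := ⟨le_rfl, fun v h => P.X_lt_X w v h⟩

theorem inBlock_col {w u : V} (h : G.Adj w u) (hr : P.ρ u < P.ρ w) : P.InBlock w (P.col w u) :=
  ⟨(P.X_lt_col w u h hr).le, fun v hv => P.col_lt_X w u v h hr hv⟩

theorem exists_inBlock_left (v : V) : ∃ b, P.InBlock b (P.left v) := by
  rcases P.left_eq v with h | ⟨u, h1, h2, h⟩ | ⟨w, h1, h2, h⟩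
  · exact ⟨v, h ▸ inBlock_X v⟩
  · exact ⟨v, h ▸ inBlock_col h1 h2⟩
  · exact ⟨w, h ▸ inBlock_col h1 h2⟩

theorem lt_of_inBlock_of_lt {v w : V} {y z : ℤ} (hy : P.InBlock v y) (hz : P.InBlock w z)
    (h : P.σ v < P.σ w) : y < z := (hy.2 w h).trans_le hz.1

/-- Apart from `X v` and its own columns, which lie in its own block, a bar is extended only by
edges to upper neighbours, whose columns lie in their blocks. -/
theorem exists_upper_right {v w : V} {y : ℤ} (hy : P.InBlock w y) (hvw : P.σ v < P.σ w)
    (h : y ≤ P.right v) :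
    ∃ m, G.Adj m v ∧ P.ρ v < P.ρ m ∧ P.σ w ≤ P.σ m ∧ y ≤ P.col m v := by
  rcases P.right_eq v with h1 | ⟨u, h1, h2, h3⟩ | ⟨m, h1, h2, h3⟩
  · have := lt_of_inBlock_of_lt (inBlock_X v) hy hvw
    omega
  · have := lt_of_inBlock_of_lt (inBlock_col h1 h2) hy hvw
    omega
  · refine ⟨m, h1, h2, ?_, h3 ▸ h⟩
    by_contra! hlt
    have := lt_of_inBlock_of_lt (inBlock_col h1 h2) hy hlt
    omega

theorem exists_upper_left {v w : V} {y : ℤ} (hy : P.InBlock w y) (hvw : P.σ w < P.σ v)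
    (h : P.left v ≤ y) :
    ∃ m, G.Adj m v ∧ P.ρ v < P.ρ m ∧ P.σ m ≤ P.σ w ∧ P.col m v ≤ y := by
  rcases P.left_eq v with h1 | ⟨u, h1, h2, h3⟩ | ⟨m, h1, h2, h3⟩
  · have := lt_of_inBlock_of_lt hy (inBlock_X v) hvw
    omega
  · have := lt_of_inBlock_of_lt hy (inBlock_col h1 h2) hvw
    omega
  · refine ⟨m, h1, h2, ?_, h3 ▸ h⟩
    by_contra! hlt
    have := lt_of_inBlock_of_lt hy (inBlock_col h1 h2) hlt
    omega

/-- The inner points of an edge whose ends are in different rows are above the lower end. -/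
theorem row_lt_of_between {u w k : V} (h : G.Adj w u) (hr : P.ρ u < P.ρ w)
    (hk : (P.σ u < P.σ k ∧ P.σ k < P.σ w) ∨ (P.σ w < P.σ k ∧ P.σ k < P.σ u)) : P.ρ u < P.ρ k := by
  rcases hk with ⟨h1, h2⟩ | ⟨h1, h2⟩
  · have := P.row_chord u w k h.symm h1 h2
    omega
  · have := P.row_chord w u k h h1 h2
    omega

/-- Of two interleaved chords one is level, so edges between different rows never interleave. -/
theorem not_interleaved {u w u' w' : V} (h : G.Adj w u) (hr : P.ρ u < P.ρ w) (h' : G.Adj w' u')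
    (hr' : P.ρ u' < P.ρ w') (a b c d : V) (h1 : (a = u ∧ c = w) ∨ (a = w ∧ c = u))
    (h2 : (b = u' ∧ d = w') ∨ (b = w' ∧ d = u')) (hab : P.σ a < P.σ b) (hbc : P.σ b < P.σ c)
    (hcd : P.σ c < P.σ d) : False := by
  rcases h1 with ⟨rfl, rfl⟩ | ⟨rfl, rfl⟩ <;> rcases h2 with ⟨rfl, rfl⟩ | ⟨rfl, rfl⟩ <;>
    have := P.row_level a b c d (by first | exact h | exact h.symm)
      (by first | exact h' | exact h'.symm) hab hbc hcd <;> omega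

/-- The bar of `v` gets into the block of `w` only on its way to an upper neighbour `m` at or beyond
`w`. Then `w` is `m` or lies between the ends of the chord, and is above its lower end `v` in either
case. -/
theorem row_lt_of_mem_bar {v w : V} {y : ℤ} (hy : P.InBlock w y) (hvw : v ≠ w)
    (h1 : P.left v ≤ y) (h2 : y ≤ P.right v) : P.ρ v < P.ρ w := by
  rcases lt_trichotomy (P.σ v) (P.σ w) with h | h | h
  · obtain ⟨m, h3, h4, h5, -⟩ := exists_upper_right hy h h2
    rcases eq_or_lt_of_le h5 with h5 | h5
    · rwa [P.σ_inj h5]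
    · exact row_lt_of_between h3 h4 (Or.inl ⟨h, h5⟩)
  · exact (hvw (P.σ_inj h)).elim
  · obtain ⟨m, h3, h4, h5, -⟩ := exists_upper_left hy h h1
    rcases eq_or_lt_of_le h5 with h5 | h5
    · rwa [← P.σ_inj h5]
    · exact row_lt_of_between h3 h4 (Or.inr ⟨h5, h⟩)

/-- If the bars met, `v` would reach right for an upper neighbour `m'` and `w` would reach left for
an upper neighbour `m`, with `v < m ≤ m' < w` in the order `σ`. For `m < m'` the two chords
interleave; for `m = m'` the columns contradict `col_mid`. -/
theorem right_lt_left {v w : V} (hr : P.ρ v = P.ρ w) (hσ : P.σ v < P.σ w) :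
    P.right v < P.left w := by
  by_contra! hle
  obtain ⟨b, hb⟩ := P.exists_inBlock_left w
  rcases lt_trichotomy (P.σ b) (P.σ w) with hbw | hbw | hbw
  · obtain ⟨m, m1, m2, m3, m4⟩ := exists_upper_left hb hbw le_rfl
    have hvm : P.σ v < P.σ m := by
      by_contra! h
      rcases eq_or_lt_of_le h with h | h
      · rw [P.σ_inj h] at m2
        omega
      · have := row_lt_of_between m1 m2 (k := v) (Or.inr ⟨h, hσ⟩)
        omega
    obtain ⟨m', n1, n2, n3, n4⟩ := exists_upper_right hb (hvm.trans_le m3) hle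
    have hmw : P.σ m' < P.σ w := by
      by_contra! h
      rcases eq_or_lt_of_le h with h | h
      · rw [← P.σ_inj h] at n2
        omega
      · have := row_lt_of_between n1 n2 (k := w) (Or.inl ⟨hσ, h⟩)
        omega
    rcases eq_or_lt_of_le (m3.trans n3) with h | h
    · obtain rfl := P.σ_inj h
      have := P.col_mid m v w n1 n2 m1 m2 hvm hmw
      omega
    · exact not_interleaved n1 n2 m1 m2 v m m' w (Or.inl ⟨rfl, rfl⟩) (Or.inr ⟨rfl, rfl⟩) hvm h hmw
  · obtain rfl := P.σ_inj hbw
    have h1 := P.left_le_X v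
    have h2 := P.X_lt_X v b hσ
    have := row_lt_of_mem_bar hb (v := v) (fun h => by rw [h] at hσ; exact lt_irrefl _ hσ)
      (by have := hb.1; omega) hle
    omega
  · have := lt_of_inBlock_of_lt (inBlock_X w) hb hbw
    have := P.left_le_X w
    omega

/-- Vertical edges do not meet the bars in the rows between their ends. -/
theorem not_mem_bar_of_row_between {u w k : V} (h : G.Adj w u) (hr : P.ρ u < P.ρ w)
    (hk1 : P.ρ u < P.ρ k) (hk2 : P.ρ k < P.ρ w) (h1 : P.left k ≤ P.col w u)
    (h2 : P.col w u ≤ P.right k) : False := by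
  have hb := inBlock_col h hr
  have huw : P.σ u ≠ P.σ w := fun h' => h.ne (P.σ_inj h').symm
  have hku : P.σ k ≠ P.σ u := fun h' => by rw [P.σ_inj h'] at hk1; omega
  have hkw : P.σ k ≠ P.σ w := fun h' => by rw [P.σ_inj h'] at hk2; omega
  have hnb : ∀ {m : V}, G.Adj m k → P.ρ k < P.ρ m →
      ¬ ((P.σ k < P.σ u ∧ P.σ u < P.σ m) ∨ (P.σ m < P.σ u ∧ P.σ u < P.σ k)) := fun hm1 hm2 h' => by
    have := row_lt_of_between hm1 hm2 h'
    omega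
  rcases lt_or_gt_of_ne hkw with hkw | hkw
  · obtain ⟨m, m1, m2, m3, m4⟩ := exists_upper_right hb hkw h2
    have hmu : P.σ m ≠ P.σ u := fun h' => by rw [P.σ_inj h'] at m2; omega
    have hn := hnb m1 m2
    rcases eq_or_lt_of_le m3 with h' | h'
    · obtain rfl := P.σ_inj h'
      rcases lt_or_gt_of_ne hku with hku | hku
      · have := P.col_mid w k u m1 m2 h hr hkw (by omega)
        omega
      · have := P.col_left w u k h hr m1 m2 hku hkw
        omega
    · rcases lt_or_gt_of_ne hku with hku | hku
      · exact not_interleaved m1 m2 h hr k w m u (Or.inl ⟨rfl, rfl⟩) (Or.inr ⟨rfl, rfl⟩) hkw h'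
          (by omega)
      · exact not_interleaved h hr m1 m2 u k w m (Or.inl ⟨rfl, rfl⟩) (Or.inl ⟨rfl, rfl⟩) hku hkw h'
  · obtain ⟨m, m1, m2, m3, m4⟩ := exists_upper_left hb hkw h1
    have hmu : P.σ m ≠ P.σ u := fun h' => by rw [P.σ_inj h'] at m2; omega
    have hn := hnb m1 m2
    rcases eq_or_lt_of_le m3 with h' | h'
    · obtain rfl := P.σ_inj h'
      rcases lt_or_gt_of_ne hku with hku | hku
      · have := P.col_right m k u m1 m2 h hr hkw hku
        omega
      · have := P.col_mid m u k h hr m1 m2 (by omega) hkw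
        omega
    · rcases lt_or_gt_of_ne hku with hku | hku
      · exact not_interleaved m1 m2 h hr m w k u (Or.inr ⟨rfl, rfl⟩) (Or.inr ⟨rfl, rfl⟩) h' hkw hku
      · exact not_interleaved h hr m1 m2 u m w k (Or.inl ⟨rfl, rfl⟩) (Or.inr ⟨rfl, rfl⟩) (by omega) h'
          hkw

theorem col_injective {u w u' w' : V} (h : G.Adj w u) (hr : P.ρ u < P.ρ w) (h' : G.Adj w' u')
    (hr' : P.ρ u' < P.ρ w') (hc : P.col w u = P.col w' u') : w = w' ∧ u = u' := by
  have hw : w = w' := by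
    apply P.σ_inj
    rcases lt_trichotomy (P.σ w) (P.σ w') with h1 | h1 | h1
    · have := lt_of_inBlock_of_lt (inBlock_col h hr) (inBlock_col h' hr') h1
      omega
    · exact h1
    · have := lt_of_inBlock_of_lt (inBlock_col h' hr') (inBlock_col h hr) h1
      omega
  subst hw
  refine ⟨rfl, ?_⟩
  have hu : P.σ u ≠ P.σ w := fun h1 => h.ne (P.σ_inj h1).symm
  have hu' : P.σ u' ≠ P.σ w := fun h1 => h'.ne (P.σ_inj h1).symm
  apply P.σ_inj
  have a1 := P.col_left w u u' h hr h' hr'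
  have a2 := P.col_left w u' u h' hr' h hr
  have a3 := P.col_mid w u u' h hr h' hr'
  have a4 := P.col_mid w u' u h' hr' h hr
  have a5 := P.col_right w u u' h hr h' hr'
  have a6 := P.col_right w u' u h' hr' h hr
  by_contra hne
  omega

/-- A vertical edge with an end between two adjacent bars in one row, and the other end outside,
passes between the two bars. -/
theorem between_of_crosses_level {m h p q : V} (hρ : P.ρ m = P.ρ h) (hmq : P.σ m < P.σ q)
    (hqh : P.σ q < P.σ h) (hpq : G.Adj q p) (hr : P.ρ p < P.ρ q) (hp : P.σ p < P.σ m ∨ P.σ h < P.σ p)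
    (hmh : G.Adj m h) : P.right m < P.col q p ∧ P.col q p < P.left h := by
  have hb := inBlock_col hpq hr
  have hins : ∀ k, P.σ m < P.σ k → P.σ k < P.σ h → P.ρ m < P.ρ k := fun k h1 h2 => by
    have := P.row_chord m h k hmh h1 h2
    omega
  constructor
  · by_contra! hle
    obtain ⟨k, k1, k2, k3, k4⟩ := exists_upper_right hb hmq hle
    have hkh : P.σ k < P.σ h := by
      by_contra! h'
      rcases eq_or_lt_of_le h' with h' | h'
      · rw [← P.σ_inj h'] at k2
        omega
      · have := row_lt_of_between k1 k2 (k := h) (Or.inl ⟨by omega, h'⟩)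
        omega
    rcases eq_or_lt_of_le k3 with h' | h'
    · obtain rfl := P.σ_inj h'
      rcases hp with hp | hp
      · have := P.col_left q p m hpq hr k1 k2 hp hmq
        omega
      · have := P.col_mid q m p k1 k2 hpq hr hmq (by omega)
        omega
    · rcases hp with hp | hp
      · exact not_interleaved hpq hr k1 k2 p m q k (Or.inl ⟨rfl, rfl⟩) (Or.inl ⟨rfl, rfl⟩) hp hmq h'
      · exact not_interleaved k1 k2 hpq hr m q k p (Or.inl ⟨rfl, rfl⟩) (Or.inr ⟨rfl, rfl⟩) hmq h'
          (by omega)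
  · by_contra! hle
    obtain ⟨k, k1, k2, k3, k4⟩ := exists_upper_left hb hqh hle
    have hkm : P.σ m < P.σ k := by
      by_contra! h'
      rcases eq_or_lt_of_le h' with h' | h'
      · rw [P.σ_inj h'] at k2
        omega
      · have := row_lt_of_between k1 k2 (k := m) (Or.inr ⟨h', by omega⟩)
        omega
    rcases eq_or_lt_of_le k3 with h' | h'
    · obtain rfl := P.σ_inj h'
      rcases hp with hp | hp
      · have := P.col_mid k p h hpq hr k1 k2 (by omega) hqh
        omega
      · have := P.col_right k h p k1 k2 hpq hr hqh hp
        omega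
    · rcases hp with hp | hp
      · exact not_interleaved hpq hr k1 k2 p k q h (Or.inl ⟨rfl, rfl⟩) (Or.inr ⟨rfl, rfl⟩) (by omega) h'
          hqh
      · exact not_interleaved k1 k2 hpq hr k q h p (Or.inr ⟨rfl, rfl⟩) (Or.inr ⟨rfl, rfl⟩) h' hqh hp

end BarPlan

/-! ### Segments of the grid -/

theorem mem_openSegment_vertical {x a b : ℤ} (hab : a < b) {p : ℝ × ℝ} :
    p ∈ openSegment ℝ (gridPoint (x, a)) (gridPoint (x, b)) ↔ p.1 = x ∧ (a : ℝ) < p.2 ∧ p.2 < b := by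
  have h : (a : ℝ) < b := by exact_mod_cast hab
  simp only [gridPoint]
  rw [← Prod.image_mk_openSegment_right, openSegment_eq_Ioo h]
  constructor
  · rintro ⟨y, hy, rfl⟩
    exact ⟨rfl, hy⟩
  · rintro ⟨h1, h2⟩
    exact ⟨p.2, h2, Prod.ext h1.symm rfl⟩

theorem mem_openSegment_horizontal {y a b : ℤ} (hab : a < b) {p : ℝ × ℝ} :
    p ∈ openSegment ℝ (gridPoint (a, y)) (gridPoint (b, y)) ↔ ((a : ℝ) < p.1 ∧ p.1 < b) ∧ p.2 = y := by
  have h : (a : ℝ) < b := by exact_mod_cast hab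
  simp only [gridPoint]
  rw [← Prod.image_mk_openSegment_left, openSegment_eq_Ioo h]
  constructor
  · rintro ⟨y, hy, rfl⟩
    exact ⟨hy, rfl⟩
  · rintro ⟨h1, h2⟩
    exact ⟨p.1, h1, Prod.ext rfl h2.symm⟩

theorem mem_bar_iff {l r y : ℤ} {p : ℝ × ℝ} :
    p ∈ Set.Icc (l : ℝ) r ×ˢ {(y : ℝ)} ↔ ((l : ℝ) ≤ p.1 ∧ p.1 ≤ r) ∧ p.2 = y := by
  simp [Set.mem_prod]

/-! ### The representation drawn from a plan -/

namespace BarPlan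

variable {V : Type*} {G : SimpleGraph V} (P : BarPlan G)

/-- The end of a dart on the bar of its tail. -/
def attach (d : G.Dart) : ℤ × ℤ :=
  if P.ρ d.snd < P.ρ d.fst then (P.col d.fst d.snd, P.ρ d.fst)
  else if P.ρ d.fst < P.ρ d.snd then (P.col d.snd d.fst, P.ρ d.fst)
  else if P.σ d.fst < P.σ d.snd then (P.right d.fst, P.ρ d.fst)
  else (P.left d.fst, P.ρ d.fst)

variable {P}

theorem attach_of_gt {d : G.Dart} (h : P.ρ d.snd < P.ρ d.fst) :
    P.attach d = (P.col d.fst d.snd, (P.ρ d.fst : ℤ)) := by simp [attach, h]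

theorem attach_of_lt {d : G.Dart} (h : P.ρ d.fst < P.ρ d.snd) :
    P.attach d = (P.col d.snd d.fst, (P.ρ d.fst : ℤ)) := by simp [attach, h, h.le]

theorem attach_of_eq_of_lt {d : G.Dart} (h : P.ρ d.fst = P.ρ d.snd) (h' : P.σ d.fst < P.σ d.snd) :
    P.attach d = (P.right d.fst, (P.ρ d.fst : ℤ)) := by simp [attach, h, h']

theorem attach_of_eq_of_gt {d : G.Dart} (h : P.ρ d.fst = P.ρ d.snd) (h' : P.σ d.snd < P.σ d.fst) :
    P.attach d = (P.left d.fst, (P.ρ d.fst : ℤ)) := by simp [attach, h, h'.le]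

/-- A dart that is directed upwards, or to the right. -/
def Forward (P : BarPlan G) (d : G.Dart) : Prop :=
  P.ρ d.fst < P.ρ d.snd ∨ (P.ρ d.fst = P.ρ d.snd ∧ P.σ d.fst < P.σ d.snd)

theorem forward_or_symm (d : G.Dart) : P.Forward d ∨ P.Forward d.symm := by
  have h : P.σ d.fst ≠ P.σ d.snd := fun h => d.adj.ne (P.σ_inj h)
  have h1 : d.symm.fst = d.snd := rfl
  have h2 : d.symm.snd = d.fst := rfl
  simp only [Forward, h1, h2]
  omega

variable (P) in
/-- The segment of an edge. -/
def seg (d : G.Dart) : Set (ℝ × ℝ) :=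
  openSegment ℝ (gridPoint (P.attach d)) (gridPoint (P.attach d.symm))

theorem seg_symm (d : G.Dart) : P.seg d.symm = P.seg d := by
  simp only [seg, SimpleGraph.Dart.symm_symm]
  exact openSegment_symm _ _ _

theorem mem_seg_of_lt {d : G.Dart} (h : P.ρ d.fst < P.ρ d.snd) {p : ℝ × ℝ} :
    p ∈ P.seg d ↔ p.1 = P.col d.snd d.fst ∧ (P.ρ d.fst : ℝ) < p.2 ∧ p.2 < P.ρ d.snd := by
  rw [seg, attach_of_lt h, attach_of_gt (d := d.symm) h]
  have h1 : d.symm.fst = d.snd := rfl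
  have h2 : d.symm.snd = d.fst := rfl
  rw [h1, h2, mem_openSegment_vertical (by exact_mod_cast h)]
  simp

theorem mem_seg_of_eq {d : G.Dart} (h : P.ρ d.fst = P.ρ d.snd) (h' : P.σ d.fst < P.σ d.snd)
    {p : ℝ × ℝ} :
    p ∈ P.seg d ↔ ((P.right d.fst : ℝ) < p.1 ∧ p.1 < P.left d.snd) ∧ p.2 = P.ρ d.fst := by
  rw [seg, attach_of_eq_of_lt h h', attach_of_eq_of_gt (d := d.symm) h.symm h']
  have h1 : d.symm.fst = d.snd := rfl
  rw [h1, ← h, mem_openSegment_horizontal (right_lt_left h h')]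
  simp

/-- A bar in the row of a level edge that meets it would belong to a vertex between the ends, but
such vertices are in higher rows. Vertical edges are covered by `not_mem_bar_of_row_between`. -/
theorem disjoint_seg_bar (d : G.Dart) (v : V) : Disjoint (P.seg d)
    (Set.Icc (P.left v : ℝ) (P.right v) ×ˢ {((P.ρ v : ℤ) : ℝ)}) := by
  have key : ∀ d : G.Dart, P.Forward d → Disjoint (P.seg d)
      (Set.Icc (P.left v : ℝ) (P.right v) ×ˢ {((P.ρ v : ℤ) : ℝ)}) := by
    intro d hd
    rw [Set.disjoint_left]
    intro p hp hb
    rw [mem_bar_iff] at hb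
    obtain ⟨⟨hb1, hb2⟩, hb3⟩ := hb
    rcases hd with hd | ⟨hd, hd'⟩
    · rw [mem_seg_of_lt hd] at hp
      obtain ⟨hp1, hp2, hp3⟩ := hp
      rw [hp1] at hb1 hb2
      rw [hb3] at hp2 hp3
      norm_cast at hb1 hb2 hp2 hp3
      exact not_mem_bar_of_row_between d.adj.symm hd hp2 hp3 hb1 hb2
    · rw [mem_seg_of_eq hd hd'] at hp
      obtain ⟨⟨hp1, hp2⟩, hp3⟩ := hp
      rw [hb3] at hp3
      norm_cast at hp3
      have h1 : (P.right d.fst : ℝ) < P.right v := by linarith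
      have h2 : (P.left v : ℝ) < P.left d.snd := by linarith
      norm_cast at h1 h2
      have hv1 : P.σ d.fst < P.σ v := by
        by_contra! h
        rcases eq_or_lt_of_le h with h | h
        · rw [P.σ_inj h] at h1
          omega
        · have := right_lt_left hp3 h
          have h3 := P.left_le_X d.fst
          have h4 := P.X_le_right d.fst
          omega
      have hv2 : P.σ v < P.σ d.snd := by
        by_contra! h
        rcases eq_or_lt_of_le h with h | h
        · rw [P.σ_inj h] at h2
          omega
        · have := right_lt_left (hd.symm.trans hp3.symm) h
          have h3 := P.left_le_X d.snd
          have h4 := P.X_le_right d.snd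
          omega
      have := P.row_chord _ _ v d.adj hv1 hv2
      omega
  rcases P.forward_or_symm d with h | h
  · exact key d h
  · rw [← seg_symm]
    exact key d.symm h

theorem seg_inter_subsingleton (d e : G.Dart) (hde : d.edge ≠ e.edge) :
    (P.seg d ∩ P.seg e).Subsingleton := by
  have key : ∀ d e : G.Dart, P.Forward d → P.Forward e → d.edge ≠ e.edge →
      (P.seg d ∩ P.seg e).Subsingleton := by
    intro d e hd he hde p hp q hq
    have hne : ¬ (d.fst = e.fst ∧ d.snd = e.snd) := fun h =>
      hde (by rw [SimpleGraph.Dart.ext d e (Prod.ext h.1 h.2)])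
    rcases hd with hd | ⟨hd, hd'⟩ <;> rcases he with he | ⟨he, he'⟩
    · rw [Set.mem_inter_iff, mem_seg_of_lt hd, mem_seg_of_lt he] at hp
      have h1 := hp.1.1.symm.trans hp.2.1
      norm_cast at h1
      have := col_injective d.adj.symm hd e.adj.symm he h1
      exact (hne ⟨this.2, this.1⟩).elim
    · rw [Set.mem_inter_iff, mem_seg_of_lt hd, mem_seg_of_eq he he'] at hp hq
      exact Prod.ext (hp.1.1.trans hq.1.1.symm) (hp.2.2.trans hq.2.2.symm)
    · rw [Set.mem_inter_iff, mem_seg_of_lt he, mem_seg_of_eq hd hd'] at hp hq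
      exact Prod.ext (hp.2.1.trans hq.2.1.symm) (hp.1.2.trans hq.1.2.symm)
    · rw [Set.mem_inter_iff, mem_seg_of_eq he he', mem_seg_of_eq hd hd'] at hp
      obtain ⟨⟨⟨h1, h2⟩, h3⟩, ⟨h4, h5⟩, h6⟩ := hp
      have hr := h3.symm.trans h6
      norm_cast at hr
      have h7 : (P.right d.fst : ℝ) < P.left e.snd := by linarith
      have h8 : (P.right e.fst : ℝ) < P.left d.snd := by linarith
      norm_cast at h7 h8
      have aux : ∀ d e : G.Dart, P.ρ d.fst = P.ρ d.snd → P.σ d.fst < P.σ d.snd →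
          P.ρ d.fst = P.ρ e.fst → P.right e.fst < P.left d.snd → ¬ P.σ d.fst < P.σ e.fst := by
        intro d e hd hd' hr h8 hlt
        have g1 := P.left_le_X d.snd
        have g2 := P.X_le_right d.snd
        have g3 := P.left_le_X e.fst
        have g4 := P.X_le_right e.fst
        rcases lt_trichotomy (P.σ e.fst) (P.σ d.snd) with h | h | h
        · have := P.row_chord _ _ e.fst d.adj hlt h
          omega
        · rw [P.σ_inj h] at h8
          omega
        · have := right_lt_left (hd.symm.trans hr) h
          omega
      have n1 := aux d e hd hd' hr h8
      have n2 := aux e d he he' hr.symm h7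
      have hf : d.fst = e.fst := P.σ_inj (by omega)
      have hs : P.σ d.snd = P.σ e.snd := by
        rcases lt_trichotomy (P.σ d.snd) (P.σ e.snd) with h | h | h
        · have := P.row_chord _ _ d.snd e.adj (by rw [← hf]; exact hd') h
          omega
        · exact h
        · have := P.row_chord _ _ e.snd d.adj (by rw [hf]; exact he') h
          omega
      exact (hne ⟨hf, P.σ_inj hs⟩).elim
  rcases P.forward_or_symm d with hd | hd <;> rcases P.forward_or_symm e with he | he
  · exact key d e hd he hde
  · rw [← seg_symm e]
    exact key d e.symm hd he (by rwa [SimpleGraph.Dart.edge_symm])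
  · rw [← seg_symm d]
    exact key d.symm e hd he (by rwa [SimpleGraph.Dart.edge_symm])
  · rw [← seg_symm d, ← seg_symm e]
    exact key d.symm e.symm hd he (by rwa [SimpleGraph.Dart.edge_symm, SimpleGraph.Dart.edge_symm])

theorem attach_cases (d : G.Dart) :
    (P.ρ d.snd < P.ρ d.fst ∧ P.attach d = (P.col d.fst d.snd, (P.ρ d.fst : ℤ)) ∧
      P.attach d.symm = (P.col d.fst d.snd, (P.ρ d.snd : ℤ))) ∨
    (P.ρ d.fst < P.ρ d.snd ∧ P.attach d = (P.col d.snd d.fst, (P.ρ d.fst : ℤ)) ∧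
      P.attach d.symm = (P.col d.snd d.fst, (P.ρ d.snd : ℤ))) ∨
    (P.ρ d.fst = P.ρ d.snd ∧ P.σ d.fst < P.σ d.snd ∧ P.attach d = (P.right d.fst, (P.ρ d.fst : ℤ)) ∧
      P.attach d.symm = (P.left d.snd, (P.ρ d.snd : ℤ))) ∨
    (P.ρ d.fst = P.ρ d.snd ∧ P.σ d.snd < P.σ d.fst ∧ P.attach d = (P.left d.fst, (P.ρ d.fst : ℤ)) ∧
      P.attach d.symm = (P.right d.snd, (P.ρ d.snd : ℤ))) := by
  have hσ : P.σ d.fst ≠ P.σ d.snd := fun h => d.adj.ne (P.σ_inj h)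
  rcases lt_trichotomy (P.ρ d.fst) (P.ρ d.snd) with h | h | h
  · exact Or.inr (Or.inl ⟨h, attach_of_lt h, attach_of_gt (d := d.symm) h⟩)
  · rcases lt_or_gt_of_ne hσ with h' | h'
    · exact Or.inr (Or.inr (Or.inl ⟨h, h', attach_of_eq_of_lt h h',
        attach_of_eq_of_gt (d := d.symm) h.symm h'⟩))
    · exact Or.inr (Or.inr (Or.inr ⟨h, h', attach_of_eq_of_gt h h',
        attach_of_eq_of_lt (d := d.symm) h.symm h'⟩))
  · exact Or.inl ⟨h, attach_of_gt h, attach_of_lt (d := d.symm) h⟩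

theorem left_le_attach (d : G.Dart) : P.left d.fst ≤ (P.attach d).1 := by
  rcases P.attach_cases d with ⟨h, h1, -⟩ | ⟨h, h1, -⟩ | ⟨-, -, h1, -⟩ | ⟨-, -, h1, -⟩ <;> rw [h1]
  · exact P.left_le_col _ _ d.adj h
  · exact P.left_le_col' _ _ d.adj.symm h
  · exact (P.left_le_X _).trans (P.X_le_right _)

theorem attach_le_right (d : G.Dart) : (P.attach d).1 ≤ P.right d.fst := by
  rcases P.attach_cases d with ⟨h, h1, -⟩ | ⟨h, h1, -⟩ | ⟨-, -, h1, -⟩ | ⟨-, -, h1, -⟩ <;> rw [h1]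
  · exact P.col_le_right _ _ d.adj h
  · exact P.col_le_right' _ _ d.adj.symm h
  · exact (P.left_le_X _).trans (P.X_le_right _)

theorem attach_snd (d : G.Dart) : (P.attach d).2 = P.ρ d.fst := by
  rcases P.attach_cases d with ⟨h, h1, -⟩ | ⟨h, h1, -⟩ | ⟨-, -, h1, -⟩ | ⟨-, -, h1, -⟩ <;> rw [h1]

variable (P) in
/-- The representation with the given coordinates. -/
def rep : BarVisRep G where
  left := P.left
  right := P.right
  row v := P.ρ v
  left_le_right v := (P.left_le_X v).trans (P.X_le_right v)
  attach := P.attach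
  left_le_attach := left_le_attach
  attach_le_right := attach_le_right
  attach_row := attach_snd
  axis_parallel d := by
    rcases P.attach_cases d with ⟨h, h1, h2⟩ | ⟨h, h1, h2⟩ | ⟨h, -, h1, h2⟩ | ⟨h, -, h1, h2⟩ <;>
      rw [h1, h2] <;> simp [h]
  bars_disjoint v w hvw := by
    rw [Set.disjoint_left]
    intro p hv hw
    rw [mem_bar_iff] at hv hw
    have h1 := hv.2.symm.trans hw.2
    norm_cast at h1
    rcases lt_trichotomy (P.σ v) (P.σ w) with h | h | h
    · have h2 : (P.right v : ℝ) < P.left w := by exact_mod_cast right_lt_left h1 h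
      linarith [hv.1.2, hw.1.1]
    · exact hvw (P.σ_inj h)
    · have h2 : (P.right w : ℝ) < P.left v := by exact_mod_cast right_lt_left h1.symm h
      linarith [hv.1.1, hw.1.2]
  edge_disjoint_bar d v := disjoint_seg_bar d v
  edges_no_overlap d e h := seg_inter_subsingleton d e h

end BarPlan

/-! ### Crossings of the representation -/

namespace BarPlan

variable {V : Type*} {G : SimpleGraph V} {P : BarPlan G}

/-- The column of `e` belongs to its upper end, which must therefore lie between the ends of `d`.
The lower end lies outside, because all vertices between the ends of `d` are above its row. -/
theorem inter_nonempty_iff {d e : G.Dart} (h : P.ρ d.fst = P.ρ d.snd) (h' : P.σ d.fst < P.σ d.snd)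
    (he : P.ρ e.fst < P.ρ e.snd) : (P.seg d ∩ P.seg e).Nonempty ↔
      (P.σ d.fst < P.σ e.snd ∧ P.σ e.snd < P.σ d.snd) ∧
        (P.σ e.fst < P.σ d.fst ∨ P.σ d.snd < P.σ e.fst) := by
  have hb := inBlock_col e.adj.symm he
  constructor
  · rintro ⟨p, hp⟩
    rw [Set.mem_inter_iff, mem_seg_of_eq h h', mem_seg_of_lt he] at hp
    obtain ⟨⟨⟨h1, h2⟩, h3⟩, h4, h5, h6⟩ := hp
    rw [h4] at h1 h2
    rw [h3] at h5 h6
    norm_cast at h1 h2 h5 h6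
    have a1 : P.σ e.snd ≠ P.σ d.fst := fun h => by rw [P.σ_inj h] at h6; omega
    have a2 : P.σ e.snd ≠ P.σ d.snd := fun h => by rw [P.σ_inj h] at h6; omega
    have a3 : P.σ e.fst ≠ P.σ d.fst := fun h => by rw [P.σ_inj h] at h5; omega
    have a4 : P.σ e.fst ≠ P.σ d.snd := fun h => by rw [P.σ_inj h] at h5; omega
    have b1 : ¬ P.σ e.snd < P.σ d.fst := fun h => by
      have := lt_of_inBlock_of_lt hb (inBlock_X d.fst) h
      have := P.X_le_right d.fst
      omega
    have b2 : ¬ P.σ d.snd < P.σ e.snd := fun h => by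
      have := lt_of_inBlock_of_lt (inBlock_X d.snd) hb h
      have := P.left_le_X d.snd
      omega
    have b3 : ¬ (P.σ d.fst < P.σ e.fst ∧ P.σ e.fst < P.σ d.snd) := fun h => by
      have := P.row_chord _ _ e.fst d.adj h.1 h.2
      omega
    omega
  · rintro ⟨⟨h1, h2⟩, h3⟩
    have h4 := between_of_crosses_level h h1 h2 e.adj.symm he h3 d.adj
    have h5 := P.row_chord _ _ e.snd d.adj h1 h2
    have h6 : P.ρ e.fst < P.ρ d.fst := by
      rcases h3 with h3 | h3
      · exact row_lt_of_between e.adj.symm he (Or.inl ⟨h3, h1⟩)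
      · have := row_lt_of_between e.adj.symm he (k := d.snd) (Or.inr ⟨h2, h3⟩)
        omega
    refine ⟨(P.col e.snd e.fst, P.ρ d.fst), ?_⟩
    rw [Set.mem_inter_iff, mem_seg_of_eq h h', mem_seg_of_lt he]
    have h7 : P.ρ d.fst < P.ρ e.snd := by omega
    dsimp only
    exact ⟨⟨⟨by exact_mod_cast h4.1, by exact_mod_cast h4.2⟩, rfl⟩, rfl, by exact_mod_cast h6,
      by exact_mod_cast h7⟩

theorem chordCross_swap {a b c d : ℕ} :
    ChordCross c d b a ↔ ChordCross a b c d := by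
  unfold ChordCross
  omega

/-- A level chord crosses no level chord. -/
theorem not_chordCross_of_level {d e : G.Dart} (hd : P.ρ d.fst = P.ρ d.snd)
    (he : P.ρ e.fst = P.ρ e.snd) : ¬ ChordCross (P.σ d.fst) (P.σ d.snd) (P.σ e.fst) (P.σ e.snd) := by
  intro h
  have a1 := P.row_chord _ _ e.fst d.adj
  have a2 := P.row_chord _ _ e.snd d.adj
  have a3 := P.row_chord _ _ e.fst d.adj.symm
  have a4 := P.row_chord _ _ e.snd d.adj.symm
  have b1 := P.row_chord _ _ d.fst e.adj
  have b2 := P.row_chord _ _ d.snd e.adj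
  have b3 := P.row_chord _ _ d.fst e.adj.symm
  have b4 := P.row_chord _ _ d.snd e.adj.symm
  have c1 : P.σ e.fst ≠ P.σ e.snd := fun h => e.adj.ne (P.σ_inj h)
  unfold ChordCross at h
  omega

/-- Of two crossing chords, one is level. -/
theorem level_of_chordCross {d e : G.Dart}
    (h : ChordCross (P.σ d.fst) (P.σ d.snd) (P.σ e.fst) (P.σ e.snd)) :
    P.ρ d.fst = P.ρ d.snd ∨ P.ρ e.fst = P.ρ e.snd := by
  rcases h with ⟨-, ⟨h2, h3⟩, h4 | h4⟩ | ⟨-, ⟨h2, h3⟩, h4 | h4⟩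
  · exact (P.row_level _ _ _ _ e.adj d.adj h4 h2 h3).symm
  · exact (P.row_level _ _ _ _ d.adj e.adj.symm h2 h3 h4).imp id Eq.symm
  · exact (P.row_level _ _ _ _ e.adj.symm d.adj.symm h4 h2 h3).symm.imp Eq.symm Eq.symm
  · exact (P.row_level _ _ _ _ d.adj.symm e.adj h2 h3 h4).imp Eq.symm id

theorem rep_edgeSeg (d : G.Dart) : P.rep.edgeSeg d = P.seg d := rfl

/-- The dart `e` crosses the horizontal dart `d` from below or from above. -/
theorem crossesFromRight_level_iff {d e : G.Dart} (hd : P.ρ d.fst = P.ρ d.snd)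
    (he : P.ρ e.fst ≠ P.ρ e.snd) : P.rep.CrossesFromRight d e ↔
      ChordCross (P.σ d.fst) (P.σ d.snd) (P.σ e.fst) (P.σ e.snd) := by
  unfold BarVisRep.CrossesFromRight BarVisRep.dir
  rw [rep_edgeSeg, rep_edgeSeg]
  change (P.seg d ∩ P.seg e).Nonempty ∧ 0 < (P.attach d.symm - P.attach d).1 *
    (P.attach e.symm - P.attach e).2 - (P.attach d.symm - P.attach d).2 *
    (P.attach e.symm - P.attach e).1 ↔ _
  have d1 : d.symm.fst = d.snd := rfl
  have d2 : d.symm.snd = d.fst := rfl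
  have e1 : e.symm.fst = e.snd := rfl
  have e2 : e.symm.snd = e.fst := rfl
  have r1 := fun h => right_lt_left hd h
  have r2 := fun h => right_lt_left hd.symm h
  have a1 := P.row_chord _ _ e.fst d.adj
  have a2 := P.row_chord _ _ e.snd d.adj
  have a3 := P.row_chord _ _ e.fst d.adj.symm
  have a4 := P.row_chord _ _ e.snd d.adj.symm
  have b1 := P.row_chord _ _ d.fst e.adj
  have b2 := P.row_chord _ _ d.snd e.adj
  have b3 := P.row_chord _ _ d.fst e.adj.symm
  have b4 := P.row_chord _ _ d.snd e.adj.symm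
  rcases P.attach_cases d with ⟨h, -⟩ | ⟨h, -⟩ | ⟨-, h, h1, h2⟩ | ⟨-, h, h1, h2⟩
  · omega
  · omega
  · have r1 := r1 h
    rcases P.attach_cases e with ⟨g, g1, g2⟩ | ⟨g, g1, g2⟩ | ⟨g, -⟩ | ⟨g, -⟩
    · rw [h1, h2, g1, g2, ← seg_symm e, inter_nonempty_iff hd h (e := e.symm) g, e1, e2]
      simp only [Prod.mk_sub_mk, sub_self, mul_zero, sub_zero]
      have : (P.left d.snd - P.right d.fst) * ((P.ρ e.snd : ℤ) - P.ρ e.fst) < 0 :=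
        mul_neg_of_pos_of_neg (by omega) (by omega)
      unfold ChordCross
      omega
    · rw [h1, h2, g1, g2, inter_nonempty_iff hd h (e := e) g]
      simp only [Prod.mk_sub_mk, sub_self, mul_zero, sub_zero]
      have : 0 < (P.left d.snd - P.right d.fst) * ((P.ρ e.snd : ℤ) - P.ρ e.fst) :=
        mul_pos (by omega) (by omega)
      unfold ChordCross
      omega
    · exact (he g).elim
    · exact (he g).elim
  · have r2 := r2 h
    rcases P.attach_cases e with ⟨g, g1, g2⟩ | ⟨g, g1, g2⟩ | ⟨g, -⟩ | ⟨g, -⟩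
    · rw [h1, h2, g1, g2, ← seg_symm e, ← seg_symm d,
        inter_nonempty_iff (d := d.symm) hd.symm h (e := e.symm) g, e1, e2, d1, d2]
      simp only [Prod.mk_sub_mk, sub_self, mul_zero, sub_zero]
      have : 0 < (P.right d.snd - P.left d.fst) * ((P.ρ e.snd : ℤ) - P.ρ e.fst) :=
        mul_pos_of_neg_of_neg (by omega) (by omega)
      unfold ChordCross
      omega
    · rw [h1, h2, g1, g2, ← seg_symm d, inter_nonempty_iff (d := d.symm) hd.symm h (e := e) g, d1, d2]
      simp only [Prod.mk_sub_mk, sub_self, mul_zero, sub_zero]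
      have : (P.right d.snd - P.left d.fst) * ((P.ρ e.snd : ℤ) - P.ρ e.fst) < 0 :=
        mul_neg_of_neg_of_pos (by omega) (by omega)
      unfold ChordCross
      omega
    · exact (he g).elim
    · exact (he g).elim

theorem _root_.BarVisRep.edgeSeg_symm (Γ : BarVisRep G) (d : G.Dart) :
    Γ.edgeSeg d.symm = Γ.edgeSeg d := by
  unfold BarVisRep.edgeSeg
  rw [SimpleGraph.Dart.symm_symm]
  exact openSegment_symm _ _ _

theorem _root_.BarVisRep.dir_symm (Γ : BarVisRep G) (d : G.Dart) : Γ.dir d.symm = - Γ.dir d := by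
  unfold BarVisRep.dir
  rw [SimpleGraph.Dart.symm_symm]
  abel

theorem _root_.BarVisRep.crossesFromRight_swap (Γ : BarVisRep G) (d e : G.Dart) :
    Γ.CrossesFromRight e d.symm ↔ Γ.CrossesFromRight d e := by
  unfold BarVisRep.CrossesFromRight
  rw [Γ.edgeSeg_symm, Γ.dir_symm, Set.inter_comm]
  refine and_congr_right fun _ => ?_
  simp only [Prod.fst_neg, Prod.snd_neg]
  constructor <;> intro h <;> linarith

/-- Two horizontal or two vertical segments have determinant zero, and two level or two non-level
chords do not cross. In the mixed case the horizontal dart can be put first by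
`crossesFromRight_swap`. -/
theorem crossesFromRight_iff (d e : G.Dart) : P.rep.CrossesFromRight d e ↔
    ChordCross (P.σ d.fst) (P.σ d.snd) (P.σ e.fst) (P.σ e.snd) := by
  by_cases hd : P.ρ d.fst = P.ρ d.snd <;> by_cases he : P.ρ e.fst = P.ρ e.snd
  · refine iff_of_false (fun h => ?_) (not_chordCross_of_level hd he)
    have h1 : (P.rep.dir d).2 = 0 := by
      change (P.attach d.symm - P.attach d).2 = 0
      rw [Prod.snd_sub, attach_snd, attach_snd, hd]
      exact sub_self _
    have h2 : (P.rep.dir e).2 = 0 := by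
      change (P.attach e.symm - P.attach e).2 = 0
      rw [Prod.snd_sub, attach_snd, attach_snd, he]
      exact sub_self _
    have := h.2
    rw [h1, h2] at this
    simp at this
  · exact crossesFromRight_level_iff hd he
  · rw [← BarVisRep.crossesFromRight_swap, crossesFromRight_level_iff he (d := e) (e := d.symm) (Ne.symm hd)]
    exact chordCross_swap
  · refine iff_of_false (fun h => ?_) (fun h => by
      have := level_of_chordCross h
      omega)
    have key : ∀ d : G.Dart, P.ρ d.fst ≠ P.ρ d.snd → (P.rep.dir d).1 = 0 := by
      intro d hd
      change (P.attach d.symm - P.attach d).1 = 0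
      rcases P.attach_cases d with ⟨h, h1, h2⟩ | ⟨h, h1, h2⟩ | ⟨h, h1, h2⟩ | ⟨h, h1, h2⟩
      · simp [h1, h2]
      · simp [h1, h2]
      · exact (hd h).elim
      · exact (hd h).elim
    have := h.2
    rw [key d hd, key e he] at this
    simp at this

end BarPlan

/-! ### The order of the edges around a bar -/

namespace BarPlan

variable {V : Type*} {G : SimpleGraph V} {P : BarPlan G}

theorem rep_place (d : G.Dart) : P.rep.place d =
    if (P.attach d.symm - P.attach d).2 = 0 then
      if 0 < (P.attach d.symm - P.attach d).1 then 0 else (P.right d.fst - P.left d.fst) + 2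
    else
      if 0 < (P.attach d.symm - P.attach d).2 then 1 + (P.right d.fst - (P.attach d).1)
      else (P.right d.fst - P.left d.fst) + 3 + ((P.attach d).1 - P.left d.fst) := rfl

theorem place_up {d : G.Dart} (h : P.ρ d.fst < P.ρ d.snd) :
    P.rep.place d = 1 + (P.right d.fst - P.col d.snd d.fst) := by
  rw [rep_place, attach_of_lt h, attach_of_gt (d := d.symm) h]
  have h1 : d.symm.fst = d.snd := rfl
  simp only [Prod.mk_sub_mk, h1]
  rw [if_neg (by omega), if_pos (by omega)]

theorem place_down {d : G.Dart} (h : P.ρ d.snd < P.ρ d.fst) :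
    P.rep.place d = (P.right d.fst - P.left d.fst) + 3 + (P.col d.fst d.snd - P.left d.fst) := by
  rw [rep_place, attach_of_gt h, attach_of_lt (d := d.symm) h]
  have h1 : d.symm.fst = d.snd := rfl
  simp only [Prod.mk_sub_mk, h1]
  rw [if_neg (by omega), if_neg (by omega)]

theorem place_right {d : G.Dart} (h : P.ρ d.fst = P.ρ d.snd) (h' : P.σ d.fst < P.σ d.snd) :
    P.rep.place d = 0 := by
  have := right_lt_left h h'
  rw [rep_place, attach_of_eq_of_lt h h', attach_of_eq_of_gt (d := d.symm) h.symm h']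
  have h1 : d.symm.fst = d.snd := rfl
  simp only [Prod.mk_sub_mk, h1]
  rw [if_pos (by omega), if_pos (by omega)]

theorem place_left {d : G.Dart} (h : P.ρ d.fst = P.ρ d.snd) (h' : P.σ d.snd < P.σ d.fst) :
    P.rep.place d = (P.right d.fst - P.left d.fst) + 2 := by
  have := right_lt_left h.symm h'
  rw [rep_place, attach_of_eq_of_gt h h', attach_of_eq_of_lt (d := d.symm) h.symm h']
  have h1 : d.symm.fst = d.snd := rfl
  simp only [Prod.mk_sub_mk, h1]
  rw [if_pos (by omega), if_neg (by omega)]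

theorem place_cases (d : G.Dart) :
    (P.ρ d.fst < P.ρ d.snd ∧ P.rep.place d = 1 + (P.right d.fst - P.col d.snd d.fst) ∧
      P.left d.fst ≤ P.col d.snd d.fst ∧ P.col d.snd d.fst ≤ P.right d.fst ∧
      (P.σ d.snd < P.σ d.fst → P.col d.snd d.fst < P.X d.fst) ∧
      (P.σ d.fst < P.σ d.snd → P.X d.fst < P.col d.snd d.fst)) ∨
    (P.ρ d.snd < P.ρ d.fst ∧
      P.rep.place d = (P.right d.fst - P.left d.fst) + 3 + (P.col d.fst d.snd - P.left d.fst) ∧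
      P.left d.fst ≤ P.col d.fst d.snd ∧ P.col d.fst d.snd ≤ P.right d.fst) ∨
    (P.ρ d.fst = P.ρ d.snd ∧ P.σ d.fst < P.σ d.snd ∧ P.rep.place d = 0) ∨
    (P.ρ d.fst = P.ρ d.snd ∧ P.σ d.snd < P.σ d.fst ∧
      P.rep.place d = (P.right d.fst - P.left d.fst) + 2) := by
  have hσ : P.σ d.fst ≠ P.σ d.snd := fun h => d.adj.ne (P.σ_inj h)
  rcases lt_trichotomy (P.ρ d.fst) (P.ρ d.snd) with h | h | h
  · refine Or.inl ⟨h, place_up h, P.left_le_col' _ _ d.adj.symm h, P.col_le_right' _ _ d.adj.symm h,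
      fun h' => lt_of_inBlock_of_lt (inBlock_col d.adj.symm h) (inBlock_X _) h',
      fun h' => lt_of_inBlock_of_lt (inBlock_X _) (inBlock_col d.adj.symm h) h'⟩
  · rcases lt_or_gt_of_ne hσ with h' | h'
    · exact Or.inr (Or.inr (Or.inl ⟨h, h', place_right h h'⟩))
    · exact Or.inr (Or.inr (Or.inr ⟨h, h', place_left h h'⟩))
  · exact Or.inr (Or.inl ⟨h, place_down h, P.left_le_col _ _ d.adj h, P.col_le_right _ _ d.adj h⟩)

variable (P) in
/-- The place on a bar from which the outer face is visible. -/
def topPlace (v : V) : ℤ := 1 + (P.right v - P.X v)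

/-- From `topPlace` the walk meets the upper neighbours on the left, the level one on the left, the
lower ones, the level one on the right, and the upper ones on the right. This is the order `KeyLT`:
by `row_chord`, everything nearer than a level or upper neighbour on the same side is upper, and
within the upper and the lower neighbours the order of the columns decides. -/
theorem cyclicBetween_of_keyLT {d e : G.Dart} (hde : d.fst = e.fst)
    (h : KeyLT (P.σ d.fst) (P.σ d.snd) (P.σ e.snd)) :
    BarVisRep.CyclicBetween (P.topPlace d.fst) (P.rep.place d) (P.rep.place e) := by
  have hσd : P.σ d.fst ≠ P.σ d.snd := fun h => d.adj.ne (P.σ_inj h)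
  have hσe : P.σ e.fst ≠ P.σ e.snd := fun h => e.adj.ne (P.σ_inj h)
  have hd := P.place_cases d
  have he := P.place_cases e
  have hX1 := P.left_le_X d.fst
  have hX2 := P.X_le_right d.fst
  have hde' : G.Adj d.fst e.snd := hde ▸ e.adj
  rw [← hde] at he hσe
  unfold BarVisRep.CyclicBetween topPlace
  rcases h with ⟨h1, h2⟩ | ⟨h1, h2⟩ | ⟨h1, h2, h3⟩
  · have a := P.row_chord _ _ d.snd hde'.symm h2 h1
    rcases hd with ⟨d1, d2, d3, d4, d5, -⟩ | ⟨d1, d2, d3, d4⟩ | ⟨d1, d2, d3⟩ | ⟨d1, d2, d3⟩ <;>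
      rcases he with ⟨e1, e2, e3, e4, e5, -⟩ | ⟨e1, e2, e3, e4⟩ | ⟨e1, e2, e3⟩ | ⟨e1, e2, e3⟩ <;>
      try omega
    · have := lt_of_inBlock_of_lt (inBlock_col hde'.symm e1) (inBlock_col d.adj.symm d1) h2
      omega
    · have := P.col_left d.fst e.snd d.snd hde' e1 d.adj d1 h2 h1
      omega
  · rcases hd with ⟨d1, d2, d3, d4, d5, -⟩ | ⟨d1, d2, d3, d4⟩ | ⟨d1, d2, d3⟩ | ⟨d1, d2, d3⟩ <;>
      rcases he with ⟨e1, e2, e3, e4, -, e5⟩ | ⟨e1, e2, e3, e4⟩ | ⟨e1, e2, e3⟩ | ⟨e1, e2, e3⟩ <;>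
      try omega
    have := P.col_mid d.fst d.snd e.snd d.adj d1 hde' e1 h1 h2
    omega
  · have a := P.row_chord _ _ e.snd d.adj h2 h3
    rcases hd with ⟨d1, d2, d3, d4, -, d5⟩ | ⟨d1, d2, d3, d4⟩ | ⟨d1, d2, d3⟩ | ⟨d1, d2, d3⟩ <;>
      rcases he with ⟨e1, e2, e3, e4, -, e5⟩ | ⟨e1, e2, e3, e4⟩ | ⟨e1, e2, e3⟩ | ⟨e1, e2, e3⟩ <;>
      try omega
    · have := lt_of_inBlock_of_lt (inBlock_col hde'.symm e1) (inBlock_col d.adj.symm d1) h3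
      omega
    · have := P.col_right d.fst e.snd d.snd hde' e1 d.adj d1 h2 h3
      omega

theorem not_cyclicBetween_rot {E : OuterOnePlane G} {sel : G.Dart → G.Dart}
    (hE : E.ChordOrder P.σ sel) (d e : G.Dart) (hde : e.fst = d.fst) :
    ¬ BarVisRep.CyclicBetween (P.rep.place d) (P.rep.place e) (P.rep.place (E.rot d)) := by
  intro hcyc
  have hr := E.rot_fst d
  have hne1 : e ≠ d := by
    rintro rfl
    unfold BarVisRep.CyclicBetween at hcyc
    omega
  have hne2 : E.rot d ≠ e := by
    rintro rfl
    unfold BarVisRep.CyclicBetween at hcyc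
    omega
  have hne3 : E.rot d ≠ d := by
    intro h
    rw [h] at hcyc
    unfold BarVisRep.CyclicBetween at hcyc
    omega
  have hsnd : ∀ x y : G.Dart, x.fst = y.fst → x ≠ y → P.σ x.snd ≠ P.σ y.snd := fun x y h1 h2 h3 =>
    h2 (SimpleGraph.Dart.ext x y (Prod.ext h1 (P.σ_inj h3)))
  have n1 := hsnd e d hde hne1
  have n2 := hsnd (E.rot d) e (hr.trans hde.symm) hne2
  have n3 := hsnd (E.rot d) d hr hne3
  have m1 : P.σ d.fst ≠ P.σ d.snd := fun h => d.adj.ne (P.σ_inj h)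
  have m2 : P.σ d.fst ≠ P.σ e.snd := fun h => e.adj.ne (hde.trans (P.σ_inj h))
  have m3 : P.σ d.fst ≠ P.σ (E.rot d).snd := fun h => (E.rot d).adj.ne (hr.trans (P.σ_inj h))
  have k1 := hE.rot_key e d hde
  rw [if_neg hne2] at k1
  classical
  rw [if_congr (or_iff_right hne2) rfl rfl, if_congr (or_iff_right hne1.symm) rfl rfl] at k1
  rw [hde] at k1
  have p1 := fun h => P.cyclicBetween_of_keyLT (d := d) (e := e) hde.symm h
  have p2 := fun h => P.cyclicBetween_of_keyLT (d := e) (e := d) hde (by rw [hde]; exact h)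
  have p3 := fun h => P.cyclicBetween_of_keyLT (d := e) (e := E.rot d) (hde.trans hr.symm)
    (by rw [hde]; exact h)
  have p4 := fun h => P.cyclicBetween_of_keyLT (d := E.rot d) (e := e) (hr.trans hde.symm)
    (by rw [hr]; exact h)
  have p5 := fun h => P.cyclicBetween_of_keyLT (d := d) (e := E.rot d) hr.symm h
  have p6 := fun h => P.cyclicBetween_of_keyLT (d := E.rot d) (e := d) hr (by rw [hr]; exact h)
  rw [hde] at p2 p3
  rw [hr] at p4 p6
  -- After the last dart the order starts again: `E.rot d` precedes `e`, and `e` precedes `d`, so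
  -- `e` is not on the way from `d` to `E.rot d`.
  by_cases hsel : d = sel d
  · rw [if_pos hsel] at k1
    have q1 : KeyLT (P.σ d.fst) (P.σ e.snd) (P.σ d.snd) := by
      by_contra h
      rw [if_neg h] at k1
      split_ifs at k1 <;> norm_num at k1
    have q2 : ¬ KeyLT (P.σ d.fst) (P.σ e.snd) (P.σ (E.rot d).snd) := by
      intro h
      rw [if_pos h, if_pos q1] at k1
      norm_num at k1
    have q3 : KeyLT (P.σ d.fst) (P.σ (E.rot d).snd) (P.σ e.snd) := by
      unfold KeyLT at q2 ⊢
      omega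
    have p2 := p2 q1
    have p4 := p4 q3
    unfold BarVisRep.CyclicBetween at hcyc p2 p4
    omega
  · rw [if_neg hsel] at k1
    -- Otherwise `E.rot d` comes after `d` without passing the outer face, and `e` is before both of
    -- them or after both.
    have k2 := hE.rot_key (E.rot d) d hr
    rw [if_pos (Or.inl rfl), if_pos rfl, if_congr (or_iff_right hne3.symm) rfl rfl, if_neg hsel] at k2
    rw [hr] at k2
    have q1 : ¬ KeyLT (P.σ d.fst) (P.σ (E.rot d).snd) (P.σ d.snd) := by
      intro h
      rw [if_pos h] at k2
      norm_num at k2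
    have q2 : KeyLT (P.σ d.fst) (P.σ d.snd) (P.σ (E.rot d).snd) := by
      unfold KeyLT at q1 ⊢
      omega
    have q3 : KeyLT (P.σ d.fst) (P.σ e.snd) (P.σ (E.rot d).snd) ↔
        KeyLT (P.σ d.fst) (P.σ e.snd) (P.σ d.snd) := by
      constructor
      · intro h
        by_contra h'
        rw [if_pos h, if_neg h'] at k1
        norm_num at k1
      · intro h
        by_contra h'
        rw [if_neg h', if_pos h] at k1
        norm_num at k1
    have p5 := p5 q2
    by_cases q4 : KeyLT (P.σ d.fst) (P.σ e.snd) (P.σ d.snd)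
    · have p2 := p2 q4
      unfold BarVisRep.CyclicBetween at hcyc p2 p5
      omega
    · have q5 : KeyLT (P.σ d.fst) (P.σ (E.rot d).snd) (P.σ e.snd) := by
        rw [q3.symm] at q4
        unfold KeyLT at q4 ⊢
        omega
      have p4 := p4 q5
      unfold BarVisRep.CyclicBetween at hcyc p4 p5
      omega

end BarPlan

/-! ### Compact coordinates -/

/-- The elements of a finite set of integers can be replaced by their ranks. -/
theorem exists_rank (S : Finset ℤ) : ∃ r : ℤ → ℕ,
    (∀ a ∈ S, ∀ b ∈ S, a < b → r a < r b) ∧ ∀ a ∈ S, r a < S.card := by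
  refine ⟨fun z => (S.filter (· < z)).card, fun a ha b hb hab => ?_, fun a ha => ?_⟩
  · refine Finset.card_lt_card (Finset.ssubset_iff_of_subset ?_ |>.2 ⟨a, ?_, ?_⟩)
    · intro x hx
      rw [Finset.mem_filter] at hx ⊢
      exact ⟨hx.1, hx.2.trans hab⟩
    · simp [ha, hab]
    · simp
  · refine Finset.card_lt_card (Finset.ssubset_iff_of_subset (Finset.filter_subset _ _) |>.2
      ⟨a, ha, by simp⟩)

/-- A relation whose arcs do not cross has a linear number of arcs. -/
theorem ncard_arcs_le {V : Type*} [Finite V] {s : V → ℤ} (hs : Function.Injective s)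
    {R : V → V → Prop}
    (hR : ∀ u w u' w', R w u → R w' u' → s u < s u' → s u' < s w → s w < s w' → False) :
    {p : V × V | R p.1 p.2 ∧ s p.2 < s p.1}.ncard ≤ 2 * Nat.card V := by
  classical
  -- `A` contains the shortest arc of each `w`. Any other arc of `w` is charged to the next
  -- neighbour `m` of `w` inside it.
  set A := {p : V × V | (R p.1 p.2 ∧ s p.2 < s p.1) ∧
    ∀ m, R p.1 m → s p.2 < s m → s m < s p.1 → False}
  set B := {p : V × V | (R p.1 p.2 ∧ s p.2 < s p.1) ∧
    ∃ m, R p.1 m ∧ s p.2 < s m ∧ s m < s p.1}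
  have hAB : {p : V × V | R p.1 p.2 ∧ s p.2 < s p.1} ⊆ A ∪ B := by
    intro p hp
    by_cases h : ∃ m, R p.1 m ∧ s p.2 < s m ∧ s m < s p.1
    · exact Or.inr ⟨hp, h⟩
    · exact Or.inl ⟨hp, fun m h1 h2 h3 => h ⟨m, h1, h2, h3⟩⟩
  have hA : A.ncard ≤ Nat.card V := by
    rw [← Set.ncard_univ]
    refine Set.ncard_le_ncard_of_injOn Prod.fst (fun _ _ => Set.mem_univ _) ?_
    rintro ⟨w, u⟩ ⟨h1, h2⟩ ⟨w', u'⟩ ⟨h3, h4⟩ h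
    obtain rfl : w = w' := h
    dsimp only at h1 h2 h3 h4
    have a1 := h2 u' h3.1
    have a2 := h4 u h1.1
    have : u = u' := hs (by
      rcases lt_trichotomy (s u) (s u') with h | h | h
      · exact (a1 h h3.2).elim
      · exact h
      · exact (a2 h h1.2).elim)
    rw [this]
  have hnext : ∀ p : V × V, ∃ m, p ∈ B → (R p.1 m ∧ s p.2 < s m ∧ s m < s p.1) ∧
      ∀ m', (R p.1 m' ∧ s p.2 < s m' ∧ s m' < s p.1) → s m ≤ s m' := by
    intro p
    by_cases hpB : p ∈ B
    swap
    · exact ⟨p.1, fun h => (hpB h).elim⟩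
    have hp := hpB.2
    obtain ⟨m, hm1, hm2⟩ := Set.exists_min_image {m | R p.1 m ∧ s p.2 < s m ∧ s m < s p.1} s
      (Set.toFinite _) hp
    exact ⟨m, fun _ => ⟨hm1, hm2⟩⟩
  have hB : B.ncard ≤ Nat.card V := by
    rw [← Set.ncard_univ]
    choose g hg using hnext
    refine Set.ncard_le_ncard_of_injOn g (fun _ _ => Set.mem_univ _) ?_
    rintro ⟨w, u⟩ h1 ⟨w', u'⟩ h2 h
    obtain ⟨a1, a2⟩ := hg _ h1
    obtain ⟨b1, b2⟩ := hg _ h2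
    rw [← h] at b1 b2
    generalize g (w, u) = m at *
    obtain ⟨⟨h1, h1'⟩, -⟩ := h1
    obtain ⟨⟨h2, h2'⟩, -⟩ := h2
    dsimp only at *
    -- If arcs of two vertices are charged to the same `m`, then the arc of the nearer vertex and
    -- the arc from `m` to the farther one interleave.
    have hw : w = w' := hs (by
      rcases lt_trichotomy (s w) (s w') with h | h | h
      · exact (hR u w m w' h1 b1.1 a1.2.1 a1.2.2 h).elim
      · exact h
      · exact (hR u' w' m w h2 a1.1 b1.2.1 b1.2.2 h).elim)
    subst hw
    have hu : u = u' := hs (by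
      rcases lt_trichotomy (s u) (s u') with h | h | h
      · have := a2 u' ⟨h2, h, h2'⟩
        omega
      · exact h
      · have := b2 u ⟨h1, h, h1'⟩
        omega)
    rw [hu]
  calc _ ≤ (A ∪ B).ncard := Set.ncard_le_ncard hAB
    _ ≤ A.ncard + B.ncard := Set.ncard_union_le _ _
    _ ≤ _ := by omega

namespace BarPlan

variable {V : Type*} {G : SimpleGraph V}

/-- The columns in use. -/
def columns (P : BarPlan G) : Set ℤ :=
  Set.range P.X ∪ (fun p : V × V => P.col p.1 p.2) '' {p | G.Adj p.1 p.2 ∧ P.ρ p.2 < P.ρ p.1}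

theorem X_mem_columns (P : BarPlan G) (v : V) : P.X v ∈ P.columns := Or.inl ⟨v, rfl⟩

theorem col_mem_columns (P : BarPlan G) {w u : V} (h : G.Adj w u) (hr : P.ρ u < P.ρ w) :
    P.col w u ∈ P.columns := Or.inr ⟨(w, u), ⟨h, hr⟩, rfl⟩

theorem left_mem_columns (P : BarPlan G) (v : V) : P.left v ∈ P.columns := by
  rcases P.left_eq v with h | ⟨u, h1, h2, h⟩ | ⟨w, h1, h2, h⟩ <;> rw [h]
  exacts [P.X_mem_columns v, P.col_mem_columns h1 h2, P.col_mem_columns h1 h2]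

theorem right_mem_columns (P : BarPlan G) (v : V) : P.right v ∈ P.columns := by
  rcases P.right_eq v with h | ⟨u, h1, h2, h⟩ | ⟨w, h1, h2, h⟩ <;> rw [h]
  exacts [P.X_mem_columns v, P.col_mem_columns h1 h2, P.col_mem_columns h1 h2]

theorem finite_columns [Finite V] (P : BarPlan G) : P.columns.Finite :=
  (Set.finite_range _).union ((Set.toFinite _).image _)

/-- One column `X v` for each vertex, and one for each edge between different rows. Such edges do
not interleave, so there are at most `2n` with the lower end on the left and `2n` with the lower end
on the right. -/
theorem ncard_columns_le [Finite V] (P : BarPlan G) : P.columns.ncard ≤ 5 * Nat.card V := by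
  have h1 : (Set.range P.X).ncard ≤ Nat.card V := by
    rw [← Set.image_univ, ← Set.ncard_univ]
    exact Set.ncard_image_le
  have hR : ∀ u w u' w', (G.Adj w u ∧ P.ρ u < P.ρ w) → (G.Adj w' u' ∧ P.ρ u' < P.ρ w') →
      P.σ u < P.σ u' → P.σ u' < P.σ w → P.σ w < P.σ w' → False := fun u w u' w' h h' a b c =>
    not_interleaved h.1 h.2 h'.1 h'.2 u u' w w' (Or.inl ⟨rfl, rfl⟩) (Or.inl ⟨rfl, rfl⟩) a b c
  have hR' : ∀ u w u' w', (G.Adj w u ∧ P.ρ u < P.ρ w) → (G.Adj w' u' ∧ P.ρ u' < P.ρ w') →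
      P.σ w' < P.σ w → P.σ w < P.σ u' → P.σ u' < P.σ u → False := fun u w u' w' h h' a b c =>
    not_interleaved h'.1 h'.2 h.1 h.2 w' w u' u (Or.inr ⟨rfl, rfl⟩) (Or.inr ⟨rfl, rfl⟩) a b c
  have h2 := ncard_arcs_le (s := fun v => (P.σ v : ℤ)) (fun a b h => P.σ_inj (by dsimp only at h; omega))
    (R := fun w u => G.Adj w u ∧ P.ρ u < P.ρ w) (fun u w u' w' h h' a b c =>
      hR u w u' w' h h' (by omega) (by omega) (by omega))
  have h3 := ncard_arcs_le (s := fun v => -(P.σ v : ℤ))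
    (fun a b h => P.σ_inj (by dsimp only at h; omega))
    (R := fun w u => G.Adj w u ∧ P.ρ u < P.ρ w) (fun u w u' w' h h' a b c =>
      hR' u w u' w' h h' (by omega) (by omega) (by omega))
  have h4 : {p : V × V | G.Adj p.1 p.2 ∧ P.ρ p.2 < P.ρ p.1} ⊆
      {p : V × V | (G.Adj p.1 p.2 ∧ P.ρ p.2 < P.ρ p.1) ∧ (P.σ p.2 : ℤ) < P.σ p.1} ∪
      {p : V × V | (G.Adj p.1 p.2 ∧ P.ρ p.2 < P.ρ p.1) ∧ -(P.σ p.2 : ℤ) < -P.σ p.1} := by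
    intro p hp
    have : P.σ p.1 ≠ P.σ p.2 := fun h => hp.1.ne (P.σ_inj h)
    rcases lt_or_gt_of_ne this with h | h
    · exact Or.inr ⟨hp, by omega⟩
    · exact Or.inl ⟨hp, by omega⟩
  calc P.columns.ncard ≤ (Set.range P.X).ncard +
      ((fun p : V × V => P.col p.1 p.2) '' {p | G.Adj p.1 p.2 ∧ P.ρ p.2 < P.ρ p.1}).ncard :=
        Set.ncard_union_le _ _
    _ ≤ Nat.card V + {p : V × V | G.Adj p.1 p.2 ∧ P.ρ p.2 < P.ρ p.1}.ncard :=
        add_le_add h1 (Set.ncard_image_le)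
    _ ≤ Nat.card V + (2 * Nat.card V + 2 * Nat.card V) := by
        gcongr
        exact (Set.ncard_le_ncard h4).trans ((Set.ncard_union_le _ _).trans (add_le_add h2 h3))
    _ = _ := by ring

/-- The plan with the columns changed by a map that is increasing on the columns in use. -/
def mapColumns (P : BarPlan G) (r : ℤ → ℤ) (hr : ∀ a ∈ P.columns, ∀ b ∈ P.columns, a < b → r a < r b) :
    BarPlan G :=
  have hr' : ∀ a ∈ P.columns, ∀ b ∈ P.columns, a ≤ b → r a ≤ r b := fun a ha b hb h =>
    (eq_or_lt_of_le h).elim (fun h => (congrArg r h).le) (fun h => (hr a ha b hb h).le)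
  { σ := P.σ
    ρ := P.ρ
    X := fun v => r (P.X v)
    col := fun w u => r (P.col w u)
    left := fun v => r (P.left v)
    right := fun v => r (P.right v)
    σ_inj := P.σ_inj
    row_chord := P.row_chord
    row_level := P.row_level
    X_lt_X := fun v w h => hr _ (P.X_mem_columns v) _ (P.X_mem_columns w) (P.X_lt_X v w h)
    X_lt_col := fun w u h h1 =>
      hr _ (P.X_mem_columns w) _ (P.col_mem_columns h h1) (P.X_lt_col w u h h1)
    col_lt_X := fun w u v h h1 h2 =>
      hr _ (P.col_mem_columns h h1) _ (P.X_mem_columns v) (P.col_lt_X w u v h h1 h2)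
    col_left := fun w u u' h1 h2 h3 h4 h5 h6 =>
      hr _ (P.col_mem_columns h3 h4) _ (P.col_mem_columns h1 h2) (P.col_left w u u' h1 h2 h3 h4 h5 h6)
    col_mid := fun w u u' h1 h2 h3 h4 h5 h6 =>
      hr _ (P.col_mem_columns h1 h2) _ (P.col_mem_columns h3 h4) (P.col_mid w u u' h1 h2 h3 h4 h5 h6)
    col_right := fun w u u' h1 h2 h3 h4 h5 h6 =>
      hr _ (P.col_mem_columns h3 h4) _ (P.col_mem_columns h1 h2) (P.col_right w u u' h1 h2 h3 h4 h5 h6)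
    left_le_X := fun v => hr' _ (P.left_mem_columns v) _ (P.X_mem_columns v) (P.left_le_X v)
    left_le_col := fun w u h h1 =>
      hr' _ (P.left_mem_columns w) _ (P.col_mem_columns h h1) (P.left_le_col w u h h1)
    left_le_col' := fun w u h h1 =>
      hr' _ (P.left_mem_columns u) _ (P.col_mem_columns h h1) (P.left_le_col' w u h h1)
    left_eq := fun v => (P.left_eq v).imp (congrArg r) (Or.imp
      (fun ⟨u, h1, h2, h3⟩ => ⟨u, h1, h2, congrArg r h3⟩)
      (fun ⟨u, h1, h2, h3⟩ => ⟨u, h1, h2, congrArg r h3⟩))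
    X_le_right := fun v => hr' _ (P.X_mem_columns v) _ (P.right_mem_columns v) (P.X_le_right v)
    col_le_right := fun w u h h1 =>
      hr' _ (P.col_mem_columns h h1) _ (P.right_mem_columns w) (P.col_le_right w u h h1)
    col_le_right' := fun w u h h1 =>
      hr' _ (P.col_mem_columns h h1) _ (P.right_mem_columns u) (P.col_le_right' w u h h1)
    right_eq := fun v => (P.right_eq v).imp (congrArg r) (Or.imp
      (fun ⟨u, h1, h2, h3⟩ => ⟨u, h1, h2, congrArg r h3⟩)
      (fun ⟨u, h1, h2, h3⟩ => ⟨u, h1, h2, congrArg r h3⟩)) }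

/-- The row function determines columns. -/
theorem exists_of_rows [Finite V] {σ ρ : V → ℕ} (hσ : Function.Injective σ)
    (hc : ∀ u w k, G.Adj u w → σ u < σ k → σ k < σ w → min (ρ u) (ρ w) < ρ k)
    (hl : ∀ a b c d, G.Adj a c → G.Adj b d → σ a < σ b → σ b < σ c → σ c < σ d →
      ρ a = ρ c ∨ ρ b = ρ d) : ∃ P : BarPlan G, P.σ = σ ∧ P.ρ = ρ := by
  classical
  obtain ⟨M, hM⟩ : ∃ M : ℤ, ∀ v, (σ v : ℤ) < M := by
    obtain ⟨M, hM⟩ := (Set.finite_range σ).bddAbove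
    exact ⟨M + 1, fun v => by have := hM ⟨v, rfl⟩; omega⟩
  -- Every vertex gets a block of width `2 * M`. As all positions are below `M`, lower neighbours on
  -- the left use offsets below `M` and those on the right use offsets above `M`.
  let X : V → ℤ := fun v => σ v * (2 * M)
  let col : V → V → ℤ := fun w u => σ w * (2 * M) +
    if σ u < σ w then (σ w : ℤ) - σ u else 2 * M - (σ u - σ w)
  have hX : ∀ v w, σ v < σ w → X v + 2 * M ≤ X w := by
    intro v w h
    have h1 : (σ v : ℤ) + 1 ≤ σ w := by exact_mod_cast h
    have h2 := hM v
    change (σ v : ℤ) * (2 * M) + 2 * M ≤ σ w * (2 * M)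
    nlinarith
  have hcl : ∀ w u, σ u < σ w → col w u = X w + (σ w - σ u) := fun w u h => by simp [col, X, h]
  have hcr : ∀ w u, σ w < σ u → col w u = X w + 2 * M - (σ u - σ w) := fun w u h => by
    simp only [col, X, not_lt.2 h.le, if_false]
    ring
  have hX1 : ∀ w u, G.Adj w u → X w < col w u ∧ col w u < X w + 2 * M := by
    intro w u h
    have : σ w ≠ σ u := fun h' => h.ne (hσ h')
    have h1 := hM w
    have h2 := hM u
    rcases lt_or_gt_of_ne this with h | h
    · rw [hcr w u h]
      omega
    · rw [hcl w u h]
      omega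
  let S : V → Set ℤ := fun v => {X v} ∪ ((fun u => col v u) '' {u | G.Adj v u ∧ ρ u < ρ v} ∪
    (fun w => col w v) '' {w | G.Adj w v ∧ ρ v < ρ w})
  have hSf : ∀ v, (S v).Finite := fun v =>
    (Set.finite_singleton _).union (((Set.toFinite _).image _).union ((Set.toFinite _).image _))
  have hSn : ∀ v, (S v).Nonempty := fun v => ⟨X v, Or.inl rfl⟩
  choose l hl1 hl2 using fun v => Set.exists_min_image (S v) id (hSf v) (hSn v)
  choose t ht1 ht2 using fun v => Set.exists_max_image (S v) id (hSf v) (hSn v)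
  have hSc : ∀ v y, y ∈ S v → y = X v ∨ (∃ u, G.Adj v u ∧ ρ u < ρ v ∧ y = col v u) ∨
      ∃ w, G.Adj w v ∧ ρ v < ρ w ∧ y = col w v := by
    rintro v y (h | ⟨u, ⟨h1, h2⟩, h⟩ | ⟨u, ⟨h1, h2⟩, h⟩)
    · exact Or.inl h
    · exact Or.inr (Or.inl ⟨u, h1, h2, h.symm⟩)
    · exact Or.inr (Or.inr ⟨u, h1, h2, h.symm⟩)
  have hS1 : ∀ w u, G.Adj w u → ρ u < ρ w → col w u ∈ S w := fun w u h h1 =>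
    Or.inr (Or.inl ⟨u, ⟨h, h1⟩, rfl⟩)
  have hS2 : ∀ w u, G.Adj w u → ρ u < ρ w → col w u ∈ S u := fun w u h h1 =>
    Or.inr (Or.inr ⟨w, ⟨h, h1⟩, rfl⟩)
  refine ⟨{ σ := σ, ρ := ρ, X := X, col := col, left := l, right := t, σ_inj := hσ,
            row_chord := hc, row_level := hl,
            X_lt_X := fun v w h => ?_
            X_lt_col := fun w u h _ => (hX1 w u h).1
            col_lt_X := fun w u v h _ h2 => ?_
            col_left := fun w u u' _ _ _ _ h1 h2 => ?_
            col_mid := fun w u u' _ _ _ _ h1 h2 => ?_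
            col_right := fun w u u' _ _ _ _ h1 h2 => ?_
            left_le_X := fun v => hl2 v _ (Or.inl rfl)
            left_le_col := fun w u h h1 => hl2 w _ (hS1 w u h h1)
            left_le_col' := fun w u h h1 => hl2 u _ (hS2 w u h h1)
            left_eq := fun v => hSc v _ (hl1 v)
            X_le_right := fun v => ht2 v _ (Or.inl rfl)
            col_le_right := fun w u h h1 => ht2 w _ (hS1 w u h h1)
            col_le_right' := fun w u h h1 => ht2 u _ (hS2 w u h h1)
            right_eq := fun v => hSc v _ (ht1 v) }, rfl, rfl⟩
  · have := hX v w h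
    have := hM v
    omega
  · have := hX w v h2
    have := (hX1 w u h).2
    omega
  · rw [hcl w u (h1.trans h2), hcl w u' h2]
    omega
  · rw [hcl w u h1, hcr w u' h2]
    have := hM w
    have := hM u'
    omega
  · rw [hcr w u h1, hcr w u' (h1.trans h2)]
    omega

end BarPlan

/-! ### From the chord order to a compact plan -/

namespace OuterOnePlane

variable {V : Type*} {G : SimpleGraph V} {E : OuterOnePlane G} {σ : V → ℕ} {sel : G.Dart → G.Dart}

/-- An edge interleaved with `x` is the edge of `E.cross x`, in one of its directions. -/
theorem ChordOrder.crossedOnce (hE : E.ChordOrder σ sel) :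
    CrossedOnce (fun a b => ∃ x : G.Dart, (σ x.fst : ℤ) = a ∧ (σ x.snd : ℤ) = b ∧ a < b) := by
  rintro _ _ _ _ _ _ ⟨x, rfl, rfl, hx⟩ ⟨y, rfl, rfl, hy⟩ ⟨z, rfl, rfl, hz⟩ h1 h2
  have key : ∀ y : G.Dart, (σ y.fst : ℤ) < σ y.snd →
      ((σ x.fst : ℤ) < σ y.fst ∧ (σ y.fst : ℤ) < σ x.snd ∧ (σ x.snd : ℤ) < σ y.snd ∨
      (σ y.fst : ℤ) < σ x.fst ∧ (σ x.fst : ℤ) < σ y.snd ∧ (σ y.snd : ℤ) < σ x.snd) →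
      ∃ h : x ∈ E.crossed, (E.cross ⟨x, h⟩ : G.Dart) = y ∨ (E.cross ⟨x, h⟩ : G.Dart) = y.symm := by
    intro y hy h
    rcases h with h | h
    · have : ChordCross (σ x.fst) (σ x.snd) (σ y.symm.fst) (σ y.symm.snd) := by
        change ChordCross (σ x.fst) (σ x.snd) (σ y.snd) (σ y.fst)
        unfold ChordCross
        omega
      obtain ⟨h1, h2⟩ := (hE.cross_iff _ _).2 this
      exact ⟨h1, Or.inr h2⟩
    · have : ChordCross (σ x.fst) (σ x.snd) (σ y.fst) (σ y.snd) := by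
        unfold ChordCross
        omega
      obtain ⟨h1, h2⟩ := (hE.cross_iff _ _).2 this
      exact ⟨h1, Or.inl h2⟩
  obtain ⟨a, a1⟩ := key y hy h1
  obtain ⟨b, b1⟩ := key z hz h2
  have hsymm : y ≠ z.symm := by
    rintro rfl
    have h1 : (σ z.snd : ℤ) < σ z.fst := hy
    omega
  have : y = z := by
    rcases a1 with a1 | a1 <;> rcases b1 with b1 | b1
    · exact a1.symm.trans b1
    · exact (hsymm (a1.symm.trans b1)).elim
    · refine (hsymm ?_).elim
      rw [← b1, a1, SimpleGraph.Dart.symm_symm]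
    · exact SimpleGraph.Dart.symm_involutive.injective (a1.symm.trans b1)
  rw [this]
  exact ⟨rfl, rfl⟩

/-- The products in the recursion can make the rows large, but both conditions only compare rows, so
the values can be replaced by their ranks. -/
theorem ChordOrder.exists_rows [Finite V] (hE : E.ChordOrder σ sel) : ∃ ρ : V → ℕ,
    (∀ u w k, G.Adj u w → σ u < σ k → σ k < σ w → min (ρ u) (ρ w) < ρ k) ∧
    (∀ a b c d, G.Adj a c → G.Adj b d → σ a < σ b → σ b < σ c → σ c < σ d →
      ρ a = ρ c ∨ ρ b = ρ d) ∧ ∀ v, ρ v < Nat.card V := by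
  classical
  obtain ⟨M, hM⟩ : ∃ M : ℕ, ∀ v, σ v ≤ M := by
    obtain ⟨M, hM⟩ := (Set.finite_range σ).bddAbove
    exact ⟨M, fun v => hM ⟨v, rfl⟩⟩
  obtain ⟨f, hf⟩ := exists_isRowFunction (M + 1) _ hE.crossedOnce 0 M (by omega) (by push_cast; omega)
  have _ := Fintype.ofFinite V
  obtain ⟨r, hr1, hr2⟩ := exists_rank (Finset.univ.image fun v => (f (σ v) : ℤ))
  have hmem : ∀ v, (f (σ v) : ℤ) ∈ Finset.univ.image fun v => (f (σ v) : ℤ) := fun v =>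
    Finset.mem_image_of_mem _ (Finset.mem_univ v)
  have hr : ∀ u v, f (σ u) < f (σ v) → r (f (σ u)) < r (f (σ v)) := fun u v h =>
    hr1 _ (hmem u) _ (hmem v) (by exact_mod_cast h)
  refine ⟨fun v => r (f (σ v)), fun u w k h h1 h2 => ?_, fun a b c d h h' h1 h2 h3 => ?_, fun v => ?_⟩
  · have h3 := hf.chord (σ u) (σ w) (σ k) ⟨⟨(u, w), h⟩, rfl, rfl, by omega⟩ (by omega)
      (by exact_mod_cast hM w) (by omega) (by omega)
    rw [min_lt_iff] at h3 ⊢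
    exact h3.imp (hr _ _) (hr _ _)
  · have h3 := hf.level (σ a) (σ b) (σ c) (σ d) (by omega) (by omega) (by omega) (by omega)
      (by exact_mod_cast hM d) ⟨⟨(a, c), h⟩, rfl, rfl, by omega⟩ ⟨⟨(b, d), h'⟩, rfl, rfl, by omega⟩
    exact h3.imp (fun h => by dsimp only; rw [h]) (fun h => by dsimp only; rw [h])
  · refine (hr2 _ (hmem v)).trans_le (Finset.card_image_le.trans ?_)
    rw [Finset.card_univ, Nat.card_eq_fintype_card]

theorem ChordOrder.exists_barPlan [Finite V] (hE : E.ChordOrder σ sel) : ∃ P : BarPlan G, P.σ = σ ∧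
    (∀ v, 0 ≤ P.left v ∧ P.right v < (5 * Nat.card V : ℕ)) ∧ ∀ v, P.ρ v < Nat.card V := by
  obtain ⟨ρ, h1, h2, h3⟩ := hE.exists_rows
  obtain ⟨P, rfl, rfl⟩ := BarPlan.exists_of_rows hE.inj h1 h2
  obtain ⟨r, hr1, hr2⟩ := exists_rank P.finite_columns.toFinset
  simp only [Set.Finite.mem_toFinset] at hr1 hr2
  refine ⟨P.mapColumns (fun x => r x) fun a ha b hb h => by exact_mod_cast hr1 a ha b hb h, rfl,
    fun v => ⟨Int.natCast_nonneg _, ?_⟩, h3⟩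
  have h4 := hr2 _ (P.right_mem_columns v)
  rw [← Set.ncard_eq_toFinset_card _ P.finite_columns] at h4
  have h5 := P.ncard_columns_le
  change (r (P.right v) : ℤ) < _
  exact_mod_cast h4.trans_le h5

end OuterOnePlane

namespace BarPlan

variable {V : Type*} {G : SimpleGraph V} {P : BarPlan G}

theorem area_rep_le {a b : ℕ} (hx : ∀ v, 0 ≤ P.left v ∧ P.right v < a) (hy : ∀ v, P.ρ v < b) :
    P.rep.area ≤ a * b := by
  have key : ∀ p ∈ P.rep.drawing, ((0 : ℝ) ≤ p.1 ∧ p.1 ≤ (a : ℝ) - 1) ∧ (0 : ℝ) ≤ p.2 ∧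
      p.2 ≤ (b : ℝ) - 1 := by
    have hxa : ∀ v, (0 : ℝ) ≤ P.left v ∧ (P.right v : ℝ) ≤ (a : ℝ) - 1 := by
      intro v
      have h1 : (P.right v) ≤ (a : ℤ) - 1 := by have := hx v; omega
      exact ⟨by exact_mod_cast (hx v).1, by exact_mod_cast h1⟩
    have hyb : ∀ v, (0 : ℝ) ≤ P.ρ v ∧ (P.ρ v : ℝ) ≤ (b : ℝ) - 1 := by
      intro v
      have h1 : (P.ρ v : ℤ) ≤ (b : ℤ) - 1 := by have := hy v; omega
      exact ⟨by positivity, by exact_mod_cast h1⟩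
    let K : Set (ℝ × ℝ) := Set.Icc 0 ((a : ℝ) - 1) ×ˢ Set.Icc 0 ((b : ℝ) - 1)
    have hK : Convex ℝ K := (convex_Icc _ _).prod (convex_Icc _ _)
    have hatt : ∀ d, gridPoint (P.attach d) ∈ K := by
      intro d
      have h1 : (P.left d.fst : ℝ) ≤ (P.attach d).1 := by exact_mod_cast left_le_attach d
      have h2 : ((P.attach d).1 : ℝ) ≤ P.right d.fst := by exact_mod_cast attach_le_right d
      have h3 : ((P.attach d).2 : ℝ) = P.ρ d.fst := by exact_mod_cast attach_snd d
      have h4 := hxa d.fst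
      have h5 := hyb d.fst
      refine ⟨⟨?_, ?_⟩, ?_, ?_⟩ <;> simp only [gridPoint] <;> linarith
    suffices h : ∀ p ∈ P.rep.drawing, p ∈ K from fun p hp => ⟨(h p hp).1, (h p hp).2⟩
    rintro p (hp | hp)
    · obtain ⟨v, hv⟩ := Set.mem_iUnion.1 hp
      change p ∈ Set.Icc (P.left v : ℝ) (P.right v) ×ˢ {((P.ρ v : ℤ) : ℝ)} at hv
      rw [mem_bar_iff] at hv
      have h4 := hxa v
      have h5 := hyb v
      have h6 : p.2 = (P.ρ v : ℝ) := by exact_mod_cast hv.2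
      exact ⟨⟨by linarith [hv.1.1], by linarith [hv.1.2]⟩, by rw [h6]; exact h5⟩
    · obtain ⟨d, hd⟩ := Set.mem_iUnion.1 hp
      exact hK.openSegment_subset (hatt d) (hatt d.symm) hd
  have hcount : ∀ (c : ℕ) (S : Set ℤ), (∀ x ∈ S, 0 ≤ x ∧ x ≤ (c : ℤ) - 1) → S.ncard ≤ c := by
    intro c S hS
    have : S ⊆ (Finset.Ico (0 : ℤ) c : Set ℤ) := fun x hx => by
      have := hS x hx
      simp only [Finset.coe_Ico, Set.mem_Ico]
      omega
    refine (Set.ncard_le_ncard this (Finset.finite_toSet _)).trans ?_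
    rw [Set.ncard_coe_finset]
    simp
  refine Nat.mul_le_mul (hcount _ _ ?_) (hcount _ _ ?_)
  · rintro x ⟨p, hp, hpx⟩
    have := (key p hp).1
    rw [hpx] at this
    exact ⟨by exact_mod_cast this.1, by exact_mod_cast this.2⟩
  · rintro x ⟨p, hp, hpx⟩
    have := (key p hp).2
    rw [hpx] at this
    exact ⟨by exact_mod_cast this.1, by exact_mod_cast this.2⟩

end BarPlan

/-! ### The outer region -/

/-- The inner product of the plane. -/
def planeDot (n z : ℝ × ℝ) : ℝ := n.1 * z.1 + n.2 * z.2

theorem isLinearMap_planeDot (n : ℝ × ℝ) : IsLinearMap ℝ (planeDot n) where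
  map_add x y := by simp only [planeDot, Prod.fst_add, Prod.snd_add]; ring
  map_smul c x := by simp only [planeDot, Prod.smul_fst, Prod.smul_snd, smul_eq_mul]; ring

theorem planeDot_add_smul (n x y : ℝ × ℝ) (t : ℝ) :
    planeDot n (x + t • y) = planeDot n x + t * planeDot n y := by
  rw [(isLinearMap_planeDot n).map_add, (isLinearMap_planeDot n).map_smul, smul_eq_mul]

theorem planeDot_self_pos {n : ℝ × ℝ} (hn : n ≠ 0) : 0 < planeDot n n := by
  by_contra! h
  unfold planeDot at h
  have h1 : n.1 = 0 := by nlinarith [mul_self_nonneg n.1, mul_self_nonneg n.2]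
  have h2 : n.2 = 0 := by nlinarith [mul_self_nonneg n.1, mul_self_nonneg n.2]
  exact hn (Prod.ext h1 h2)

theorem eventually_add_smul_mem {U : Set (ℝ × ℝ)} {q : ℝ × ℝ} (hU : U ∈ nhds q) (n : ℝ × ℝ) :
    ∀ᶠ ε : ℝ in nhdsWithin 0 (Set.Ioi 0), q + ε • n ∈ U := by
  have h : Filter.Tendsto (fun ε : ℝ => q + ε • n) (nhds 0) (nhds q) := by
    have : Continuous fun ε : ℝ => q + ε • n := by fun_prop
    simpa using this.tendsto 0
  exact (h.mono_left nhdsWithin_le_nhds).eventually hU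

theorem eventually_pos_lt {a : ℝ} (ha : 0 < a) :
    ∀ᶠ ε : ℝ in nhdsWithin 0 (Set.Ioi 0), 0 < ε ∧ ε < a :=
  Ioo_mem_nhdsGT ha

namespace BarVisRep

variable {V : Type*} {G : SimpleGraph V} (Γ : BarVisRep G)

theorem subset_outerRegion {U : Set (ℝ × ℝ)} (hU : IsPreconnected U) (hD : U ⊆ Γ.drawingᶜ)
    {p : ℝ × ℝ} (hp : p ∈ U) (hpo : p ∈ Γ.outerRegion) : U ⊆ Γ.outerRegion := by
  intro q hq
  have h := hU.subset_connectedComponentIn hp hD hq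
  refine ⟨hD hq, ?_⟩
  rw [← connectedComponentIn_eq h]
  exact hpo.2

theorem tailPt_mem_bar (d : G.Dart) : Γ.tailPt d ∈ Γ.bar d.fst := by
  refine ⟨⟨?_, ?_⟩, ?_⟩
  · change (Γ.left d.fst : ℝ) ≤ ((Γ.attach d).1 : ℝ)
    exact_mod_cast Γ.left_le_attach d
  · change ((Γ.attach d).1 : ℝ) ≤ (Γ.right d.fst : ℝ)
    exact_mod_cast Γ.attach_le_right d
  · change ((Γ.attach d).2 : ℝ) = (Γ.row d.fst : ℝ)
    exact_mod_cast Γ.attach_row d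

theorem isClosed_bar (v : V) : IsClosed (Γ.bar v) := isClosed_Icc.prod isClosed_singleton

theorem not_mem_bar_of_mem_edgeSeg {q : ℝ × ℝ} {d : G.Dart} (h : q ∈ Γ.edgeSeg d) (v : V) :
    q ∉ Γ.bar v := fun hv => Set.disjoint_left.1 (Γ.edge_disjoint_bar d v) h hv

theorem exists_mem_bar_of_mem_segment {q : ℝ × ℝ} {d : G.Dart}
    (h : q ∈ segment ℝ (Γ.tailPt d) (Γ.tailPt d.symm)) (hq : q ∉ Γ.edgeSeg d) :
    ∃ v ∈ d.edge, q ∈ Γ.bar v := by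
  rw [← insert_endpoints_openSegment] at h
  rcases h with h | h | h
  · exact ⟨d.fst, Sym2.mem_mk_left _ _, h ▸ Γ.tailPt_mem_bar d⟩
  · exact ⟨d.snd, Sym2.mem_mk_right _ _, h ▸ Γ.tailPt_mem_bar d.symm⟩
  · exact (hq h).elim

/-- Near a point of no bar, only the edges through this point are drawn. -/
theorem exists_ball_edges [Finite V] {q : ℝ × ℝ} (S : Set G.Dart) (hq : ∀ v, q ∉ Γ.bar v)
    (hS : ∀ e, e ∉ S → q ∉ Γ.edgeSeg e) :
    ∃ r > 0, ∀ z ∈ Metric.ball q r, z ∈ Γ.drawing → ∃ e ∈ S, z ∈ Γ.edgeSeg e := by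
  set R : Set (ℝ × ℝ) := (⋃ v, Γ.bar v) ∪
    ⋃ e : {e // e ∉ S}, segment ℝ (Γ.tailPt e) (Γ.tailPt (e : G.Dart).symm) with hR
  have hRc : IsClosed R := by
    refine (isClosed_iUnion_of_finite Γ.isClosed_bar).union (isClosed_iUnion_of_finite fun e => ?_)
    rw [segment_eq_image']
    exact (isCompact_Icc.image (by fun_prop)).isClosed
  have hqR : q ∉ R := by
    rintro (h | h)
    · obtain ⟨v, hv⟩ := Set.mem_iUnion.1 h
      exact hq v hv
    · obtain ⟨e, he⟩ := Set.mem_iUnion.1 h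
      obtain ⟨v, -, hv⟩ := Γ.exists_mem_bar_of_mem_segment he (hS e e.2)
      exact hq v hv
  obtain ⟨r, hr, h⟩ := Metric.isOpen_iff.1 hRc.isOpen_compl q hqR
  refine ⟨r, hr, fun z hz hzD => ?_⟩
  rcases hzD with hzD | hzD
  · exact (h hz (Or.inl hzD)).elim
  · obtain ⟨e, he⟩ := Set.mem_iUnion.1 hzD
    by_cases heS : e ∈ S
    · exact ⟨e, heS, he⟩
    · exact (h hz (Or.inr (Set.mem_iUnion.2 ⟨⟨e, heS⟩, openSegment_subset_segment _ _ _ he⟩))).elim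

/-- The vector from the tail end to the head end of a dart. -/
def vec (d : G.Dart) : ℝ × ℝ := gridPoint (Γ.dir d)

theorem tailPt_symm (d : G.Dart) : Γ.tailPt d.symm = Γ.tailPt d + Γ.vec d := by
  simp only [tailPt, vec, dir, gridPoint]
  ext <;> simp

theorem mem_edgeSeg_iff {d : G.Dart} {q : ℝ × ℝ} :
    q ∈ Γ.edgeSeg d ↔ ∃ t : ℝ, 0 < t ∧ t < 1 ∧ q = Γ.tailPt d + t • Γ.vec d := by
  rw [edgeSeg, openSegment_eq_image', tailPt_symm, add_sub_cancel_left]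
  constructor
  · rintro ⟨t, ⟨h1, h2⟩, rfl⟩
    exact ⟨t, h1, h2, rfl⟩
  · rintro ⟨t, h1, h2, rfl⟩
    exact ⟨t, ⟨h1, h2⟩, rfl⟩

theorem vec_symm (d : G.Dart) : Γ.vec d.symm = - Γ.vec d := by
  simp only [vec, Γ.dir_symm, gridPoint]
  ext <;> simp

theorem vec_ne_zero (d : G.Dart) : Γ.vec d ≠ 0 := by
  intro h
  have h1 := Γ.tailPt_symm d
  rw [h, add_zero] at h1
  have h2 := Γ.tailPt_mem_bar d.symm
  rw [h1] at h2
  exact Set.disjoint_left.1 (Γ.bars_disjoint d.fst d.snd d.adj.ne) (Γ.tailPt_mem_bar d) h2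

theorem leftNormal_eq (d : G.Dart) : Γ.leftNormal d = (-(Γ.vec d).2, (Γ.vec d).1) := by
  simp [leftNormal, vec, gridPoint]

theorem leftNormal_ne_zero (d : G.Dart) : Γ.leftNormal d ≠ 0 := by
  intro h
  rw [leftNormal_eq] at h
  refine Γ.vec_ne_zero d (Prod.ext ?_ ?_)
  · exact congrArg Prod.snd h
  · exact neg_eq_zero.1 (congrArg Prod.fst h)

theorem planeDot_leftNormal_vec (d : G.Dart) : planeDot (Γ.leftNormal d) (Γ.vec d) = 0 := by
  rw [leftNormal_eq]
  simp only [planeDot]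
  ring

theorem vec_axis (d : G.Dart) : (Γ.vec d).1 = 0 ∨ (Γ.vec d).2 = 0 := by
  simp only [vec, gridPoint, dir, Prod.fst_sub, Prod.snd_sub]
  rcases Γ.axis_parallel d with h | h
  · left
    rw [h]
    simp
  · right
    rw [h]
    simp

/-- The determinant that tells how `e` passes `d`. -/
theorem crossesFromRight_iff_vec {d e : G.Dart} : Γ.CrossesFromRight d e ↔
    (Γ.edgeSeg d ∩ Γ.edgeSeg e).Nonempty ∧
      0 < (Γ.vec d).1 * (Γ.vec e).2 - (Γ.vec d).2 * (Γ.vec e).1 := by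
  unfold CrossesFromRight vec gridPoint
  refine and_congr_right fun _ => ?_
  dsimp only
  exact_mod_cast Iff.rfl

/-- Parallel edges through a common inner point would share a short segment, that is, overlap. -/
theorem det_ne_zero {d e : G.Dart} (hde : d.edge ≠ e.edge)
    (h : (Γ.edgeSeg d ∩ Γ.edgeSeg e).Nonempty) :
    (Γ.vec d).1 * (Γ.vec e).2 - (Γ.vec d).2 * (Γ.vec e).1 ≠ 0 := by
  intro h0
  obtain ⟨z, hzd, hze⟩ := h
  have hsub := Γ.edges_no_overlap d e hde
  obtain ⟨t, t0, t1, ht⟩ := Γ.mem_edgeSeg_iff.1 hzd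
  obtain ⟨s, s0, s1, hs⟩ := Γ.mem_edgeSeg_iff.1 hze
  have hp : 0 < planeDot (Γ.vec e) (Γ.vec e) := planeDot_self_pos (Γ.vec_ne_zero e)
  obtain ⟨l, hl⟩ : ∃ l : ℝ, Γ.vec d = l • Γ.vec e := by
    refine ⟨planeDot (Γ.vec d) (Γ.vec e) / planeDot (Γ.vec e) (Γ.vec e), ?_⟩
    unfold planeDot at hp ⊢
    ext
    · rw [Prod.smul_fst, smul_eq_mul, div_mul_eq_mul_div, eq_div_iff hp.ne']
      linear_combination (Γ.vec e).2 * h0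
    · rw [Prod.smul_snd, smul_eq_mul, div_mul_eq_mul_div, eq_div_iff hp.ne']
      linear_combination -(Γ.vec e).1 * h0
  have ev1 : ∀ᶠ η : ℝ in nhdsWithin 0 (Set.Ioi 0), t + η • 1 < 1 := by
    have : Filter.Tendsto (fun η : ℝ => t + η • 1) (nhds 0) (nhds t) := by
      have : Continuous fun η : ℝ => t + η • (1 : ℝ) := by fun_prop
      simpa using this.tendsto 0
    exact (this.mono_left nhdsWithin_le_nhds).eventually (Iio_mem_nhds t1)
  have ev2 : ∀ᶠ η : ℝ in nhdsWithin 0 (Set.Ioi 0), s + η * l ∈ Set.Ioo (0 : ℝ) 1 := by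
    have : Filter.Tendsto (fun η : ℝ => s + η * l) (nhds 0) (nhds s) := by
      have : Continuous fun η : ℝ => s + η * l := by fun_prop
      simpa using this.tendsto 0
    exact (this.mono_left nhdsWithin_le_nhds).eventually (Ioo_mem_nhds s0 s1)
  obtain ⟨η, ⟨h1, h2⟩, h3⟩ := ((ev1.and ev2).and self_mem_nhdsWithin).exists
  have h3 : 0 < η := h3
  have hz1 : z + η • Γ.vec d ∈ Γ.edgeSeg d := Γ.mem_edgeSeg_iff.2
    ⟨t + η, by linarith, by simpa using h1, by rw [ht, add_smul, add_assoc]⟩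
  have hz2 : z + η • Γ.vec d ∈ Γ.edgeSeg e := Γ.mem_edgeSeg_iff.2
    ⟨s + η * l, h2.1, h2.2, by rw [hs, hl, add_smul, add_assoc, smul_smul]⟩
  have := hsub ⟨hz1, hz2⟩ ⟨hzd, hze⟩
  rw [add_eq_left, smul_eq_zero] at this
  exact this.elim h3.ne' (Γ.vec_ne_zero d)

variable {Γ}

theorem exists_cross_of_inter {E : OuterOnePlane G}
    (hc : ∀ d e : G.Dart, Γ.CrossesFromRight d e ↔
      ∃ h : d ∈ E.crossed, (E.cross ⟨d, h⟩ : G.Dart) = e) {d e : G.Dart} {z : ℝ × ℝ}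
    (hde : d.edge ≠ e.edge) (hd : z ∈ Γ.edgeSeg d) (he : z ∈ Γ.edgeSeg e) :
    ∃ h : d ∈ E.crossed, (E.cross ⟨d, h⟩ : G.Dart).edge = e.edge := by
  have h0 := Γ.det_ne_zero hde ⟨z, hd, he⟩
  rcases lt_or_gt_of_ne h0 with h | h
  · obtain ⟨h1, h2⟩ := (hc d e.symm).1 (Γ.crossesFromRight_iff_vec.2 ⟨⟨z, hd, by rwa [edgeSeg_symm]⟩, by
      rw [vec_symm]; simp only [Prod.fst_neg, Prod.snd_neg]; linarith⟩)
    exact ⟨h1, by rw [h2, SimpleGraph.Dart.edge_symm]⟩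
  · obtain ⟨h1, h2⟩ := (hc d e).1 (Γ.crossesFromRight_iff_vec.2 ⟨⟨z, hd, he⟩, h⟩)
    exact ⟨h1, by rw [h2]⟩

variable (Γ)

/-- Immediately to the left of `d` at the point `q` is the unbounded region. -/
def OuterLeftAt (d : G.Dart) (q : ℝ × ℝ) : Prop :=
  ∀ᶠ ε : ℝ in nhdsWithin 0 (Set.Ioi 0), q + ε • Γ.leftNormal d ∈ Γ.outerRegion

variable {Γ}

theorem planeDot_leftNormal_of_mem {d : G.Dart} {q : ℝ × ℝ} (h : q ∈ Γ.edgeSeg d) :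
    planeDot (Γ.leftNormal d) q = planeDot (Γ.leftNormal d) (Γ.tailPt d) := by
  obtain ⟨t, -, -, rfl⟩ := Γ.mem_edgeSeg_iff.1 h
  rw [planeDot_add_smul, planeDot_leftNormal_vec, mul_zero, add_zero]

theorem outerLeftAt_iff_of_subset {d : G.Dart} {q : ℝ × ℝ} {U : Set (ℝ × ℝ)} (hU : Convex ℝ U)
    (hUD : U ⊆ Γ.drawingᶜ)
    (h : ∀ᶠ ε : ℝ in nhdsWithin 0 (Set.Ioi 0), q + ε • Γ.leftNormal d ∈ U) :
    Γ.OuterLeftAt d q ↔ U ⊆ Γ.outerRegion := by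
  constructor
  · intro h1
    obtain ⟨ε, h2, h3⟩ := (h.and h1).exists
    exact Γ.subset_outerRegion hU.isPreconnected hUD h2 h3
  · intro h1
    exact h.mono fun ε hε => h1 hε

/-- Near `q` nothing but this edge is drawn. So there is a half-disc to the left that avoids the
drawing, and it decides the question for all nearby points of the edge. -/
theorem eventually_outerLeftAt_iff [Finite V] {d : G.Dart} {q : ℝ × ℝ} (hq : q ∈ Γ.edgeSeg d)
    (hne : ∀ e, e.edge ≠ d.edge → q ∉ Γ.edgeSeg e) :
    ∀ᶠ q' in nhds q, q' ∈ Γ.edgeSeg d → (Γ.OuterLeftAt d q ↔ Γ.OuterLeftAt d q') := by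
  obtain ⟨r, hr, h⟩ := Γ.exists_ball_edges {e | e.edge = d.edge} (Γ.not_mem_bar_of_mem_edgeSeg hq) hne
  set n := Γ.leftNormal d
  set U := Metric.ball q r ∩ {z | planeDot n (Γ.tailPt d) < planeDot n z}
  have hU : Convex ℝ U := (convex_ball q r).inter (convex_halfSpace_gt (isLinearMap_planeDot n) _)
  have hUD : U ⊆ Γ.drawingᶜ := by
    rintro z ⟨hz, hz'⟩ hzD
    obtain ⟨e, he, hze⟩ := h z hz hzD
    have hzd : z ∈ Γ.edgeSeg d := by
      rcases (SimpleGraph.dart_edge_eq_iff e d).1 he with rfl | rfl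
      · exact hze
      · rwa [edgeSeg_symm] at hze
    exact absurd (planeDot_leftNormal_of_mem hzd) (ne_of_gt hz')
  have key : ∀ q' ∈ Metric.ball q r, q' ∈ Γ.edgeSeg d →
      (Γ.OuterLeftAt d q' ↔ U ⊆ Γ.outerRegion) := by
    intro q' hq' hq'd
    refine outerLeftAt_iff_of_subset hU hUD ?_
    filter_upwards [eventually_add_smul_mem (Metric.isOpen_ball.mem_nhds hq') n,
      self_mem_nhdsWithin] with ε h1 h2
    refine ⟨h1, ?_⟩
    change _ < planeDot n (q' + ε • n)
    rw [planeDot_add_smul, planeDot_leftNormal_of_mem hq'd]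
    have := mul_pos (show 0 < ε from h2) (planeDot_self_pos (Γ.leftNormal_ne_zero d))
    linarith
  filter_upwards [Metric.ball_mem_nhds q hr] with q' hq' hq'd
  rw [key q (Metric.mem_ball_self hr) hq, key q' hq' hq'd]

theorem outerLeftAt_of_preconnected [Finite V] {d : G.Dart} {S : Set (ℝ × ℝ)} (hS : IsPreconnected S)
    (hSd : S ⊆ Γ.edgeSeg d) (hne : ∀ q ∈ S, ∀ e, e.edge ≠ d.edge → q ∉ Γ.edgeSeg e) {q q' : ℝ × ℝ}
    (hq : q ∈ S) (hq' : q' ∈ S) (h : Γ.OuterLeftAt d q) : Γ.OuterLeftAt d q' := by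
  refine (hS.induction₂ (fun a b => (Γ.OuterLeftAt d a ↔ Γ.OuterLeftAt d b)) ?_ ?_ ?_ hq hq').1 h
  · intro x hx
    filter_upwards [nhdsWithin_le_nhds (eventually_outerLeftAt_iff (hSd hx) (hne x hx)),
      self_mem_nhdsWithin] with y h1 h2
    exact h1 (hSd h2)
  · intro x y z _ _ _ h1 h2
    exact h1.trans h2
  · intro x y _ _ h1
    exact h1.symm

end BarVisRep

theorem add_smul_mem_segment {p v : ℝ × ℝ} {a t b : ℝ} (h1 : a ≤ t) (h2 : t ≤ b) :
    p + t • v ∈ segment ℝ (p + a • v) (p + b • v) := by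
  rw [segment_eq_image']
  rcases eq_or_lt_of_le (h1.trans h2) with h | h
  · exact ⟨0, by simp, by rw [show t = a by linarith]; simp⟩
  · have h3 : 0 < b - a := by linarith
    refine ⟨(t - a) / (b - a), ⟨by apply div_nonneg <;> linarith, by rw [div_le_one h3]; linarith⟩, ?_⟩
    dsimp only
    have h4 : p + b • v - (p + a • v) = (b - a) • v := by rw [sub_smul]; abel
    rw [h4, smul_smul, div_mul_cancel₀ _ h3.ne', add_assoc, ← add_smul]
    congr 2
    ring

/-! ### Pieces of edges along the unbounded region -/

namespace BarVisRep

variable {V : Type*} {G : SimpleGraph V} {Γ : BarVisRep G}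

theorem segment_tailPt_subset {d : G.Dart} {t t' : ℝ} (h0 : 0 ≤ t) (h : t ≤ t') :
    segment ℝ (Γ.tailPt d) (Γ.tailPt d + t • Γ.vec d) ⊆
      segment ℝ (Γ.tailPt d) (Γ.tailPt d + t' • Γ.vec d) := by
  refine (convex_segment _ _).segment_subset (left_mem_segment ℝ _ _) ?_
  have := add_smul_mem_segment (p := Γ.tailPt d) (v := Γ.vec d) h0 h
  rwa [zero_smul, add_zero] at this

theorem pieceSeg_subset {M : OnePlaneMap G} (p : M.Piece) :
    Γ.pieceSeg M p ⊆ Γ.edgeSeg (wholeDart M p) := by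
  rcases p with d | d <;> exact fun q hq => hq.1

theorem pieceSeg_edgePerm {M : OnePlaneMap G} (p : M.Piece) :
    Γ.pieceSeg M (M.edgePerm p) = Γ.pieceSeg M p := by
  have key : ∀ d : M.crossed, Γ.pieceSeg M (Sum.inl (d : G.Dart).symm) = Γ.pieceSeg M (Sum.inr d) := by
    intro d
    ext q
    change (q ∈ Γ.edgeSeg (d : G.Dart).symm ∧ _) ↔ (q ∈ Γ.edgeSeg d ∧ _)
    rw [edgeSeg_symm]
    refine and_congr_right fun _ => ?_
    have h1 : Γ.edgeSeg (M.cross ⟨(d : G.Dart).symm, M.symm_mem_crossed d.2⟩) = Γ.edgeSeg (M.cross d) := by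
      rw [M.cross_symm, edgeSeg_symm]
    constructor
    · intro h
      have := h (M.symm_mem_crossed d.2)
      rwa [h1, segment_symm] at this
    · intro h h'
      rwa [h1, segment_symm]
  rcases p with d | d
  · by_cases h : d ∈ M.crossed
    · rw [M.edgePerm_inl_of_mem h, ← key]
      simp only [SimpleGraph.Dart.symm_symm]
    · rw [M.edgePerm_inl_of_not_mem h]
      have h' : d.symm ∉ M.crossed := fun h1 => h (by
        have := M.symm_mem_crossed h1
        rwa [SimpleGraph.Dart.symm_symm] at this)
      ext q
      change (q ∈ Γ.edgeSeg d.symm ∧ _) ↔ (q ∈ Γ.edgeSeg d ∧ _)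
      rw [edgeSeg_symm]
      exact and_congr_right fun _ => iff_of_true (fun h2 => (h' h2).elim) (fun h2 => (h h2).elim)
  · rw [M.edgePerm_inr, key]

theorem isPreconnected_pieceSeg {M : OnePlaneMap G} (p : M.Piece) :
    IsPreconnected (Γ.pieceSeg M p) := by
  have key : ∀ d : G.Dart, IsPreconnected (Γ.pieceSeg M (Sum.inl d)) := by
    intro d
    set S := {t : ℝ | (0 < t ∧ t < 1) ∧ ∀ h : d ∈ M.crossed,
      Disjoint (segment ℝ (Γ.tailPt d) (Γ.tailPt d + t • Γ.vec d)) (Γ.edgeSeg (M.cross ⟨d, h⟩))}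
    have hS : S.OrdConnected := by
      refine ⟨fun a ha b hb t ht => ⟨⟨ha.1.1.trans_le ht.1, ht.2.trans_lt hb.1.2⟩, fun h => ?_⟩⟩
      exact (hb.2 h).mono_left (segment_tailPt_subset (ha.1.1.le.trans ht.1) ht.2)
    have hSi : Γ.pieceSeg M (Sum.inl d) = (fun t : ℝ => Γ.tailPt d + t • Γ.vec d) '' S := by
      ext q
      constructor
      · rintro ⟨h1, h2⟩
        obtain ⟨t, t0, t1, rfl⟩ := Γ.mem_edgeSeg_iff.1 h1
        exact ⟨t, ⟨⟨t0, t1⟩, h2⟩, rfl⟩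
      · rintro ⟨t, ⟨⟨t0, t1⟩, h2⟩, rfl⟩
        exact ⟨Γ.mem_edgeSeg_iff.2 ⟨t, t0, t1, rfl⟩, h2⟩
    rw [hSi]
    exact hS.isPreconnected.image _ (by fun_prop)
  rcases p with d | d
  · exact key d
  · rw [← pieceSeg_edgePerm, M.edgePerm_inr]
    exact key _

variable {E : OuterOnePlane G}

theorem not_mem_edgeSeg_of_mem_pieceSeg
    (hc : ∀ d e : G.Dart, Γ.CrossesFromRight d e ↔
      ∃ h : d ∈ E.crossed, (E.cross ⟨d, h⟩ : G.Dart) = e)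
    (p : E.toOnePlaneMap.Piece) {q : ℝ × ℝ} (hq : q ∈ Γ.pieceSeg E.toOnePlaneMap p) (e : G.Dart)
    (he : e.edge ≠ (wholeDart E.toOnePlaneMap p).edge) : q ∉ Γ.edgeSeg e := by
  intro h
  have hedge : ∀ d f : G.Dart, d.edge = f.edge → Γ.edgeSeg d = Γ.edgeSeg f := by
    intro d f hdf
    rcases (SimpleGraph.dart_edge_eq_iff d f).1 hdf with rfl | rfl
    · rfl
    · exact edgeSeg_symm _ _
  obtain ⟨h1, h2⟩ := exists_cross_of_inter hc he.symm (pieceSeg_subset p hq) h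
  rw [← hedge _ _ h2] at h
  rcases p with d | d
  · exact Set.disjoint_left.1 (hq.2 h1) (right_mem_segment ℝ _ _) h
  · exact Set.disjoint_left.1 hq.2 (left_mem_segment ℝ _ _) h

/-- A piece is connected and meets no other edge, so one of its points decides for all. -/
theorem outerOnLeft_iff [Finite V]
    (hc : ∀ d e : G.Dart, Γ.CrossesFromRight d e ↔
      ∃ h : d ∈ E.crossed, (E.cross ⟨d, h⟩ : G.Dart) = e)
    (p : E.toOnePlaneMap.Piece) {q : ℝ × ℝ} (hq : q ∈ Γ.pieceSeg E.toOnePlaneMap p) :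
    Γ.OuterOnLeft E.toOnePlaneMap p ↔ Γ.OuterLeftAt (wholeDart E.toOnePlaneMap p) q :=
  ⟨fun h => h q hq, fun h _ hq' => outerLeftAt_of_preconnected (isPreconnected_pieceSeg p)
    (pieceSeg_subset p) (fun _ hx => not_mem_edgeSeg_of_mem_pieceSeg hc p hx) hq hq' h⟩

theorem eventually_mem_pieceSeg (Γ : BarVisRep G) (M : OnePlaneMap G) (d : G.Dart) :
    ∀ᶠ t : ℝ in nhdsWithin 0 (Set.Ioi 0), Γ.tailPt d + t • Γ.vec d ∈ Γ.pieceSeg M (Sum.inl d) := by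
  have h1 : ∀ᶠ t : ℝ in nhdsWithin 0 (Set.Ioi 0), Γ.tailPt d + t • Γ.vec d ∈ Γ.edgeSeg d := by
    filter_upwards [eventually_pos_lt one_pos] with t ht
    exact Γ.mem_edgeSeg_iff.2 ⟨t, ht.1, ht.2, rfl⟩
  by_cases h : d ∈ M.crossed
  swap
  · filter_upwards [h1] with t ht
    exact ⟨ht, fun h' => (h h').elim⟩
  set e := (M.cross ⟨d, h⟩ : G.Dart) with he
  have hcl : IsClosed (segment ℝ (Γ.tailPt e) (Γ.tailPt e.symm)) := by
    rw [segment_eq_image']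
    exact (isCompact_Icc.image (by fun_prop)).isClosed
  have hn : Γ.tailPt d ∉ segment ℝ (Γ.tailPt e) (Γ.tailPt e.symm) := by
    intro hmem
    obtain ⟨v, hv, hv'⟩ := Γ.exists_mem_bar_of_mem_segment hmem (fun h2 =>
      Γ.not_mem_bar_of_mem_edgeSeg h2 _ (Γ.tailPt_mem_bar d))
    have : v = d.fst := by
      by_contra hne
      exact Set.disjoint_left.1 (Γ.bars_disjoint v d.fst hne) hv' (Γ.tailPt_mem_bar d)
    rw [this] at hv
    exact M.cross_disjoint ⟨d, h⟩ d.fst (Sym2.mem_mk_left _ _) hv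
  obtain ⟨r, hr, hb⟩ := Metric.isOpen_iff.1 hcl.isOpen_compl _ hn
  filter_upwards [h1, eventually_add_smul_mem (Metric.ball_mem_nhds (Γ.tailPt d) hr) (Γ.vec d)]
    with t ht ht'
  refine ⟨ht, fun h' => ?_⟩
  rw [Set.disjoint_left]
  intro z hz hz'
  exact hb ((convex_ball _ r).segment_subset (Metric.mem_ball_self hr) ht' hz)
    (openSegment_subset_segment _ _ _ hz')

theorem planeDot_neg (n x : ℝ × ℝ) : planeDot n (-x) = - planeDot n x := by
  simp only [planeDot, Prod.fst_neg, Prod.snd_neg]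
  ring

/-- The unbounded region continues past a crossing. -/
theorem outerOnLeft_cross [Finite V]
    (hc : ∀ d e : G.Dart, Γ.CrossesFromRight d e ↔
      ∃ h : d ∈ E.crossed, (E.cross ⟨d, h⟩ : G.Dart) = e) (d : E.crossed)
    (hd : Γ.OuterOnLeft E.toOnePlaneMap (Sum.inl d)) :
    Γ.OuterOnLeft E.toOnePlaneMap (Sum.inr (E.cross d)) := by
  obtain ⟨d, hdc⟩ := d
  set e := (E.cross ⟨d, hdc⟩ : G.Dart) with he
  obtain ⟨⟨x, hxd, hxe⟩, hdet⟩ := Γ.crossesFromRight_iff_vec.1 ((hc d e).2 ⟨hdc, rfl⟩)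
  have hedge : d.edge ≠ e.edge := fun h => E.cross_disjoint ⟨d, hdc⟩ d.fst
    (Sym2.mem_mk_left _ _) (by change d.fst ∈ e.edge; rw [← h]; exact Sym2.mem_mk_left _ _)
  have hsub := Γ.edges_no_overlap d e hedge
  -- Axis-parallel vectors with nonzero determinant are perpendicular.
  have hperp : planeDot (Γ.vec d) (Γ.vec e) = 0 := by
    unfold planeDot
    rcases Γ.vec_axis d with h1 | h1 <;> rcases Γ.vec_axis e with h2 | h2 <;> rw [h1, h2] at hdet ⊢ <;>
      simp at hdet ⊢
  have hperp' : planeDot (Γ.vec e) (Γ.vec d) = 0 := by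
    rw [← hperp]
    unfold planeDot
    ring
  have hdd := planeDot_self_pos (Γ.vec_ne_zero d)
  have hee := planeDot_self_pos (Γ.vec_ne_zero e)
  have hen : 0 < planeDot (Γ.vec e) (Γ.leftNormal d) := by
    rw [leftNormal_eq]
    unfold planeDot
    dsimp only
    linarith
  have hdn : planeDot (Γ.vec d) (Γ.leftNormal e) < 0 := by
    rw [leftNormal_eq]
    unfold planeDot
    dsimp only
    linarith
  obtain ⟨r, hr, hb⟩ := Γ.exists_ball_edges {f | f.edge = d.edge ∨ f.edge = e.edge}
    (Γ.not_mem_bar_of_mem_edgeSeg hxd) (fun f hf hxf => by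
      obtain ⟨_, h2⟩ := exists_cross_of_inter hc (fun h => hf (Or.inl h.symm)) hxd hxf
      exact hf (Or.inr h2.symm))
  obtain ⟨t, t0, t1, ht⟩ := Γ.mem_edgeSeg_iff.1 hxd
  obtain ⟨s, s0, s1, hs⟩ := Γ.mem_edgeSeg_iff.1 hxe
  have hdline : ∀ z ∈ Γ.edgeSeg d, planeDot (Γ.vec e) z = planeDot (Γ.vec e) x := by
    intro z hz
    obtain ⟨t', -, -, rfl⟩ := Γ.mem_edgeSeg_iff.1 hz
    rw [ht, planeDot_add_smul, planeDot_add_smul, hperp']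
    ring
  have heline : ∀ z ∈ Γ.edgeSeg e, planeDot (Γ.vec d) z = planeDot (Γ.vec d) x := by
    intro z hz
    obtain ⟨t', -, -, rfl⟩ := Γ.mem_edgeSeg_iff.1 hz
    rw [hs, planeDot_add_smul, planeDot_add_smul, hperp]
    ring
  -- The quarter-disc at the crossing that lies before it in the direction of `d` and behind it in
  -- the direction of `e`. It touches the left side of the first piece of `d` and the left side of
  -- the second piece of `e`.
  set Q := Metric.ball x r ∩ ({z | planeDot (Γ.vec d) z < planeDot (Γ.vec d) x} ∩
    {z | planeDot (Γ.vec e) x < planeDot (Γ.vec e) z})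
  have hQ : Convex ℝ Q := (convex_ball x r).inter
    ((convex_halfSpace_lt (isLinearMap_planeDot _) _).inter
      (convex_halfSpace_gt (isLinearMap_planeDot _) _))
  have hQD : Q ⊆ Γ.drawingᶜ := by
    rintro z ⟨hz, hz1, hz2⟩ hzD
    obtain ⟨f, hf, hzf⟩ := hb z hz hzD
    rcases hf with hf | hf
    · have : z ∈ Γ.edgeSeg d := by
        rcases (SimpleGraph.dart_edge_eq_iff f d).1 hf with rfl | rfl
        · exact hzf
        · rwa [edgeSeg_symm] at hzf
      exact absurd (hdline z this) (ne_of_gt hz2)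
    · have : z ∈ Γ.edgeSeg e := by
        rcases (SimpleGraph.dart_edge_eq_iff f e).1 hf with rfl | rfl
        · exact hzf
        · rwa [edgeSeg_symm] at hzf
      exact absurd (heline z this) (ne_of_lt hz1)
  have hQopen : Metric.ball x r ∈ nhds x := Metric.ball_mem_nhds x hr
  -- a point of `d` before the crossing
  have hbefore : Γ.OuterOnLeft E.toOnePlaneMap (Sum.inl d) ↔ Q ⊆ Γ.outerRegion := by
    obtain ⟨η, h1, h2, h3⟩ := ((eventually_add_smul_mem hQopen (-Γ.vec d)).and
      (eventually_pos_lt t0)).exists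
    have hq : x + η • (-Γ.vec d) = Γ.tailPt d + (t - η) • Γ.vec d := by
      rw [ht, sub_smul, smul_neg]
      abel
    have hqp : x + η • (-Γ.vec d) ∈ Γ.pieceSeg E.toOnePlaneMap (Sum.inl d) := by
      rw [hq]
      refine ⟨Γ.mem_edgeSeg_iff.2 ⟨t - η, by linarith, by linarith, rfl⟩, fun h => ?_⟩
      rw [Set.disjoint_left]
      intro z hz hze
      have hz1 : z ∈ Γ.edgeSeg d := by
        rw [segment_eq_image'] at hz
        obtain ⟨θ, ⟨θ0, θ1⟩, rfl⟩ := hz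
        dsimp only at hze ⊢
        rw [add_sub_cancel_left, smul_smul] at hze ⊢
        rcases eq_or_lt_of_le θ0 with rfl | θ0
        · rw [zero_mul, zero_smul, add_zero] at hze
          exact (Γ.not_mem_bar_of_mem_edgeSeg hze _ (Γ.tailPt_mem_bar d)).elim
        · exact Γ.mem_edgeSeg_iff.2 ⟨_, mul_pos θ0 (by linarith), by nlinarith, rfl⟩
      obtain rfl := hsub ⟨hz1, hze⟩ ⟨hxd, hxe⟩
      have hlt : ∀ y ∈ segment ℝ (Γ.tailPt d) (Γ.tailPt d + (t - η) • Γ.vec d),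
          planeDot (Γ.vec d) y ≤ planeDot (Γ.vec d) (Γ.tailPt d + (t - η) • Γ.vec d) := by
        intro y hy
        refine (convex_halfSpace_le (isLinearMap_planeDot (Γ.vec d)) _).segment_subset ?_ ?_ hy
        · change planeDot _ _ ≤ planeDot _ _
          rw [planeDot_add_smul]
          have := mul_pos (show 0 < t - η by linarith) hdd
          linarith
        · exact le_refl (planeDot _ _)
      have h4 := hlt z hz
      rw [← hq, planeDot_add_smul, planeDot_neg] at h4
      nlinarith
    rw [outerOnLeft_iff hc _ hqp]
    refine outerLeftAt_iff_of_subset hQ hQD ?_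
    filter_upwards [eventually_add_smul_mem (Metric.isOpen_ball.mem_nhds h1) (Γ.leftNormal d),
      self_mem_nhdsWithin] with ε hε hε0
    have hε0 : 0 < ε := hε0
    refine ⟨hε, ?_, ?_⟩
    · change planeDot _ (_ + ε • Γ.leftNormal d) < _
      rw [planeDot_add_smul, planeDot_add_smul, planeDot_neg]
      have : planeDot (Γ.vec d) (Γ.leftNormal d) = 0 := by
        rw [← Γ.planeDot_leftNormal_vec d]
        unfold planeDot
        ring
      rw [this]
      have := mul_pos h2 hdd
      linarith
    · change _ < planeDot _ (_ + ε • Γ.leftNormal d)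
      rw [planeDot_add_smul, planeDot_add_smul, planeDot_neg, hperp']
      have := mul_pos hε0 hen
      linarith
  -- a point of `e` behind the crossing
  have hafter : Γ.OuterOnLeft E.toOnePlaneMap (Sum.inr (E.cross ⟨d, hdc⟩)) ↔ Q ⊆ Γ.outerRegion := by
    obtain ⟨η, h1, h2, h3⟩ := ((eventually_add_smul_mem hQopen (Γ.vec e)).and
      (eventually_pos_lt (show 0 < 1 - s by linarith))).exists
    have hq : x + η • Γ.vec e = Γ.tailPt e + (s + η) • Γ.vec e := by
      rw [hs, add_smul]
      abel
    have hqp : x + η • Γ.vec e ∈ Γ.pieceSeg E.toOnePlaneMap (Sum.inr (E.cross ⟨d, hdc⟩)) := by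
      rw [hq]
      refine ⟨Γ.mem_edgeSeg_iff.2 ⟨s + η, by linarith, by linarith, rfl⟩, ?_⟩
      change Disjoint (segment ℝ _ (Γ.tailPt e.symm)) _
      rw [E.cross_cross, edgeSeg_symm, Set.disjoint_left, Γ.tailPt_symm e]
      intro z hz hze
      have hz1 : z ∈ Γ.edgeSeg e := by
        rw [segment_eq_image'] at hz
        obtain ⟨θ, ⟨θ0, θ1⟩, rfl⟩ := hz
        dsimp only at hze ⊢
        have hzz : Γ.tailPt e + (s + η) • Γ.vec e +
            θ • (Γ.tailPt e + Γ.vec e - (Γ.tailPt e + (s + η) • Γ.vec e)) =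
            Γ.tailPt e + (s + η + θ * (1 - (s + η))) • Γ.vec e := by
          module
        rw [hzz] at hze ⊢
        rcases eq_or_lt_of_le θ1 with rfl | θ1
        · rw [show s + η + 1 * (1 - (s + η)) = 1 by ring, one_smul, ← Γ.tailPt_symm e] at hze
          exact (Γ.not_mem_bar_of_mem_edgeSeg hze _ (Γ.tailPt_mem_bar e.symm)).elim
        · exact Γ.mem_edgeSeg_iff.2 ⟨_, by nlinarith, by nlinarith, rfl⟩
      obtain rfl := hsub ⟨hze, hz1⟩ ⟨hxd, hxe⟩
      have hlt : ∀ y ∈ segment ℝ (Γ.tailPt e + (s + η) • Γ.vec e) (Γ.tailPt e + Γ.vec e),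
          planeDot (Γ.vec e) (Γ.tailPt e + (s + η) • Γ.vec e) ≤ planeDot (Γ.vec e) y := by
        intro y hy
        refine (convex_halfSpace_ge (isLinearMap_planeDot (Γ.vec e)) _).segment_subset ?_ ?_ hy
        · exact le_refl (planeDot _ _)
        · change planeDot _ _ ≤ planeDot _ _
          rw [planeDot_add_smul, (isLinearMap_planeDot (Γ.vec e)).map_add]
          nlinarith
      have h4 := hlt z hz
      rw [← hq, planeDot_add_smul] at h4
      nlinarith
    rw [outerOnLeft_iff hc _ hqp]
    refine outerLeftAt_iff_of_subset hQ hQD ?_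
    change ∀ᶠ ε : ℝ in _, x + η • Γ.vec e + ε • Γ.leftNormal e ∈ Q
    filter_upwards [eventually_add_smul_mem (Metric.isOpen_ball.mem_nhds h1) (Γ.leftNormal e),
      self_mem_nhdsWithin] with ε hε hε0
    have hε0 : 0 < ε := hε0
    refine ⟨hε, ?_, ?_⟩
    · change planeDot _ (_ + ε • Γ.leftNormal e) < _
      rw [planeDot_add_smul, planeDot_add_smul, hperp]
      nlinarith
    · change _ < planeDot _ (_ + ε • Γ.leftNormal e)
      have : planeDot (Γ.vec e) (Γ.leftNormal e) = 0 := by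
        rw [← Γ.planeDot_leftNormal_vec e]
        unfold planeDot
        ring
      rw [planeDot_add_smul, planeDot_add_smul, this]
      have := mul_pos h2 hee
      linarith
  exact hafter.2 (hbefore.1 hd)

end BarVisRep

theorem slot_bounds {h : ℤ} (hh : 0 < h) {t : ℝ} (h0 : 0 < t) (h1 : t < 1 / (h : ℝ)) :
    0 < t * h ∧ t * h < 1 := by
  have hh' : (0 : ℝ) < h := by exact_mod_cast hh
  exact ⟨mul_pos h0 hh', (lt_div_iff₀ hh').1 h1⟩

/-! ### Grid cells around a bar -/

namespace BarPlan

variable {V : Type*} {G : SimpleGraph V} {P : BarPlan G}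

/-- An open grid cell is contained in the unbounded region. -/
def OuterCell (P : BarPlan G) (x y : ℤ) : Prop :=
  Set.Ioo (x : ℝ) (x + 1) ×ˢ Set.Ioo (y : ℝ) (y + 1) ⊆ P.rep.outerRegion

theorem mem_drawing {z : ℝ × ℝ} (h : z ∈ P.rep.drawing) :
    (∃ v, ((P.left v : ℝ) ≤ z.1 ∧ z.1 ≤ P.right v) ∧ z.2 = P.ρ v) ∨
    (∃ d : G.Dart, P.ρ d.fst < P.ρ d.snd ∧
      (z.1 = P.col d.snd d.fst ∧ (P.ρ d.fst : ℝ) < z.2 ∧ z.2 < P.ρ d.snd)) ∨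
    (∃ d : G.Dart, P.ρ d.fst = P.ρ d.snd ∧ P.σ d.fst < P.σ d.snd ∧
      ((P.right d.fst : ℝ) < z.1 ∧ z.1 < P.left d.snd) ∧ z.2 = P.ρ d.fst) := by
  rcases h with h | h
  · obtain ⟨v, hv⟩ := Set.mem_iUnion.1 h
    left
    change z ∈ Set.Icc (P.left v : ℝ) (P.right v) ×ˢ {((P.ρ v : ℤ) : ℝ)} at hv
    rw [mem_bar_iff] at hv
    exact ⟨v, hv.1, by exact_mod_cast hv.2⟩
  · obtain ⟨d, hd⟩ := Set.mem_iUnion.1 h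
    right
    have key : ∀ d, P.Forward d → z ∈ P.seg d →
        (∃ d : G.Dart, P.ρ d.fst < P.ρ d.snd ∧
          (z.1 = P.col d.snd d.fst ∧ (P.ρ d.fst : ℝ) < z.2 ∧ z.2 < P.ρ d.snd)) ∨
        (∃ d : G.Dart, P.ρ d.fst = P.ρ d.snd ∧ P.σ d.fst < P.σ d.snd ∧
          ((P.right d.fst : ℝ) < z.1 ∧ z.1 < P.left d.snd) ∧ z.2 = P.ρ d.fst) := fun d hf hd => by
      rcases hf with hf | ⟨hf, hf'⟩
      · exact Or.inl ⟨d, hf, (mem_seg_of_lt hf).1 hd⟩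
      · exact Or.inr ⟨d, hf, hf', (mem_seg_of_eq hf hf').1 hd⟩
    rcases P.forward_or_symm d with hf | hf
    · exact key d hf hd
    · exact key d.symm hf (by rw [seg_symm]; exact hd)

theorem outerCell_of_subset {x y x' y' : ℤ} {U : Set (ℝ × ℝ)} (hU : Convex ℝ U)
    (hUD : U ⊆ P.rep.drawingᶜ) (h : Set.Ioo (x : ℝ) (x + 1) ×ˢ Set.Ioo (y : ℝ) (y + 1) ⊆ U)
    (h' : Set.Ioo (x' : ℝ) (x' + 1) ×ˢ Set.Ioo (y' : ℝ) (y' + 1) ⊆ U) (hc : P.OuterCell x y) :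
    P.OuterCell x' y' := by
  have hmem : ((x : ℝ) + 1 / 2, (y : ℝ) + 1 / 2) ∈ Set.Ioo (x : ℝ) (x + 1) ×ˢ Set.Ioo (y : ℝ) (y + 1) :=
    ⟨⟨by dsimp only; linarith, by dsimp only; linarith⟩, ⟨by dsimp only; linarith, by dsimp only; linarith⟩⟩
  exact h'.trans (P.rep.subset_outerRegion hU.isPreconnected hUD (h hmem) (hc hmem))

theorem vertical_disjoint_drawing {x y : ℤ} (hd : ∀ d : G.Dart, P.ρ d.fst < P.ρ d.snd →
    P.col d.snd d.fst = x → ¬ ((P.ρ d.fst : ℤ) ≤ y ∧ y < P.ρ d.snd)) :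
    Set.Ioo (x - 1 : ℝ) (x + 1) ×ˢ Set.Ioo (y : ℝ) (y + 1) ⊆ P.rep.drawingᶜ := by
  rintro z ⟨⟨z1, z2⟩, z3, z4⟩ hz
  rcases mem_drawing hz with ⟨v, -, h⟩ | ⟨d, h, h1, h2, h3⟩ | ⟨d, -, -, -, h⟩
  · rw [h] at z3 z4
    have z3 : y < (P.ρ v : ℤ) := by exact_mod_cast z3
    have z4 : (P.ρ v : ℤ) < y + 1 := by exact_mod_cast z4
    omega
  · rw [h1] at z1 z2
    have z1 : x - 1 < P.col d.snd d.fst := by exact_mod_cast z1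
    have z2 : P.col d.snd d.fst < x + 1 := by exact_mod_cast z2
    have h4 := h2.trans z4
    have h5 := z3.trans h3
    have h4 : (P.ρ d.fst : ℤ) < y + 1 := by exact_mod_cast h4
    have h5 : y < (P.ρ d.snd : ℤ) := by exact_mod_cast h5
    exact hd d h (by omega) ⟨by omega, h5⟩
  · rw [h] at z3 z4
    have z3 : y < (P.ρ d.fst : ℤ) := by exact_mod_cast z3
    have z4 : (P.ρ d.fst : ℤ) < y + 1 := by exact_mod_cast z4
    omega

theorem horizontal_disjoint_drawing {x y : ℤ}
    (hv : ∀ v, (P.ρ v : ℤ) = y → ¬ (P.left v ≤ x ∧ x < P.right v))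
    (hd : ∀ d : G.Dart, P.ρ d.fst = P.ρ d.snd → P.σ d.fst < P.σ d.snd → (P.ρ d.fst : ℤ) = y →
      ¬ (P.right d.fst ≤ x ∧ x < P.left d.snd)) :
    Set.Ioo (x : ℝ) (x + 1) ×ˢ Set.Ioo (y - 1 : ℝ) (y + 1) ⊆ P.rep.drawingᶜ := by
  rintro z ⟨⟨z1, z2⟩, z3, z4⟩ hz
  rcases mem_drawing hz with ⟨v, ⟨h1, h2⟩, h⟩ | ⟨d, h, h1, h2, h3⟩ | ⟨d, h1, h2, ⟨h3, h4⟩, h⟩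
  · rw [h] at z3 z4
    have z3 : y - 1 < (P.ρ v : ℤ) := by exact_mod_cast z3
    have z4 : (P.ρ v : ℤ) < y + 1 := by exact_mod_cast z4
    have h1 := h1.trans_lt z2
    have h2 := z1.trans_le h2
    have h1 : P.left v < x + 1 := by exact_mod_cast h1
    have h2 : x < P.right v := by exact_mod_cast h2
    exact hv v (by omega) ⟨by omega, h2⟩
  · rw [h1] at z1 z2
    have z1 : x < P.col d.snd d.fst := by exact_mod_cast z1
    have z2 : P.col d.snd d.fst < x + 1 := by exact_mod_cast z2
    omega
  · rw [h] at z3 z4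
    have z3 : y - 1 < (P.ρ d.fst : ℤ) := by exact_mod_cast z3
    have z4 : (P.ρ d.fst : ℤ) < y + 1 := by exact_mod_cast z4
    have h3 := h3.trans z2
    have h4 := z1.trans h4
    have h3 : P.right d.fst < x + 1 := by exact_mod_cast h3
    have h4 : x < P.left d.snd := by exact_mod_cast h4
    exact hd d h1 h2 (by omega) ⟨by omega, h4⟩

theorem outerCell_vertical {x y : ℤ} (hd : ∀ d : G.Dart, P.ρ d.fst < P.ρ d.snd →
    P.col d.snd d.fst = x → ¬ ((P.ρ d.fst : ℤ) ≤ y ∧ y < P.ρ d.snd)) :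
    P.OuterCell (x - 1) y ↔ P.OuterCell x y := by
  have hU := vertical_disjoint_drawing hd
  have hc : Convex ℝ (Set.Ioo (x - 1 : ℝ) (x + 1) ×ˢ Set.Ioo (y : ℝ) (y + 1)) :=
    (convex_Ioo _ _).prod (convex_Ioo _ _)
  have h1 : Set.Ioo ((x - 1 : ℤ) : ℝ) ((x - 1 : ℤ) + 1) ×ˢ Set.Ioo (y : ℝ) (y + 1) ⊆
      Set.Ioo (x - 1 : ℝ) (x + 1) ×ˢ Set.Ioo (y : ℝ) (y + 1) := by
    refine Set.prod_mono (Set.Ioo_subset_Ioo ?_ ?_) le_rfl <;> push_cast <;> linarith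
  have h2 : Set.Ioo (x : ℝ) (x + 1) ×ˢ Set.Ioo (y : ℝ) (y + 1) ⊆
      Set.Ioo (x - 1 : ℝ) (x + 1) ×ˢ Set.Ioo (y : ℝ) (y + 1) :=
    Set.prod_mono (Set.Ioo_subset_Ioo (by linarith) le_rfl) le_rfl
  exact ⟨outerCell_of_subset hc hU h1 h2, outerCell_of_subset hc hU h2 h1⟩

theorem outerCell_horizontal {x y : ℤ}
    (hv : ∀ v, (P.ρ v : ℤ) = y → ¬ (P.left v ≤ x ∧ x < P.right v))
    (hd : ∀ d : G.Dart, P.ρ d.fst = P.ρ d.snd → P.σ d.fst < P.σ d.snd → (P.ρ d.fst : ℤ) = y →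
      ¬ (P.right d.fst ≤ x ∧ x < P.left d.snd)) :
    P.OuterCell x (y - 1) ↔ P.OuterCell x y := by
  have hU := horizontal_disjoint_drawing hv hd
  have hc : Convex ℝ (Set.Ioo (x : ℝ) (x + 1) ×ˢ Set.Ioo (y - 1 : ℝ) (y + 1)) :=
    (convex_Ioo _ _).prod (convex_Ioo _ _)
  have h1 : Set.Ioo (x : ℝ) (x + 1) ×ˢ Set.Ioo ((y - 1 : ℤ) : ℝ) ((y - 1 : ℤ) + 1) ⊆
      Set.Ioo (x : ℝ) (x + 1) ×ˢ Set.Ioo (y - 1 : ℝ) (y + 1) := by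
    refine Set.prod_mono le_rfl (Set.Ioo_subset_Ioo ?_ ?_) <;> push_cast <;> linarith
  have h2 : Set.Ioo (x : ℝ) (x + 1) ×ˢ Set.Ioo (y : ℝ) (y + 1) ⊆
      Set.Ioo (x : ℝ) (x + 1) ×ˢ Set.Ioo (y - 1 : ℝ) (y + 1) :=
    Set.prod_mono le_rfl (Set.Ioo_subset_Ioo (by linarith) le_rfl)
  exact ⟨outerCell_of_subset hc hU h1 h2, outerCell_of_subset hc hU h2 h1⟩

theorem left_le_right (v : V) : P.left v ≤ P.right v := (P.left_le_X v).trans (P.X_le_right v)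

/-- Bars in the same row are disjoint. -/
theorem eq_of_mem_bar {v w : V} {x : ℤ} (hr : P.ρ v = P.ρ w) (h1 : P.left v ≤ x)
    (h2 : x ≤ P.right v) (h3 : P.left w ≤ x) (h4 : x ≤ P.right w) : v = w := by
  rcases lt_trichotomy (P.σ v) (P.σ w) with h | h | h
  · have := right_lt_left hr h
    omega
  · exact P.σ_inj h
  · have := right_lt_left hr.symm h
    omega

/-- A vertical edge between the two cells either starts on the bar of `v` or would run through it.
-/
theorem outerCell_top {v : V} {x : ℤ} (h1 : P.left v ≤ x) (h2 : x ≤ P.right v)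
    (h : ∀ d : G.Dart, d.fst = v → P.ρ d.fst < P.ρ d.snd → P.col d.snd d.fst ≠ x) :
    P.OuterCell (x - 1) (P.ρ v) ↔ P.OuterCell x (P.ρ v) := by
  refine outerCell_vertical fun d hd hx ⟨h3, h4⟩ => ?_
  rcases eq_or_lt_of_le h3 with h3 | h3
  · have h5 := P.left_le_col' _ _ d.adj.symm hd
    have h6 := P.col_le_right' _ _ d.adj.symm hd
    exact h d (eq_of_mem_bar (x := x) (by omega) (by omega) (by omega) h1 h2) hd hx
  · exact not_mem_bar_of_row_between (k := v) d.adj.symm hd (by omega) (by omega) (by omega) (by omega)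

theorem outerCell_bottom {v : V} {x : ℤ} (h1 : P.left v ≤ x) (h2 : x ≤ P.right v)
    (h : ∀ d : G.Dart, d.fst = v → P.ρ d.snd < P.ρ d.fst → P.col d.fst d.snd ≠ x) :
    P.OuterCell (x - 1) (P.ρ v - 1) ↔ P.OuterCell x (P.ρ v - 1) := by
  refine outerCell_vertical fun d hd hx ⟨h3, h4⟩ => ?_
  rcases eq_or_lt_of_le (show P.ρ v ≤ P.ρ d.snd by omega) with h4 | h4
  · have h5 := P.left_le_col _ _ d.adj.symm hd
    have h6 := P.col_le_right _ _ d.adj.symm hd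
    exact h d.symm (eq_of_mem_bar (v := d.snd) (x := x) (by omega) (by omega) (by omega) h1 h2) hd hx
  · exact not_mem_bar_of_row_between (k := v) d.adj.symm hd (by omega) (by omega) (by omega) (by omega)

theorem not_mem_level {d : G.Dart} {v : V} {x : ℤ} (hd : P.ρ d.fst = P.ρ d.snd)
    (hd' : P.σ d.fst < P.σ d.snd) (hr : P.ρ d.fst = P.ρ v) (h1 : P.left v ≤ x) (h2 : x ≤ P.right v)
    (h3 : P.right d.fst < x) (h4 : x < P.left d.snd) : False := by
  have hz : (((x : ℝ), (P.ρ v : ℝ)) : ℝ × ℝ) ∈ P.seg d := by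
    rw [mem_seg_of_eq hd hd']
    exact ⟨⟨by dsimp only; exact_mod_cast h3, by dsimp only; exact_mod_cast h4⟩, by dsimp only; rw [hr]⟩
  refine P.rep.not_mem_bar_of_mem_edgeSeg (d := d) hz v ?_
  change _ ∈ Set.Icc (P.left v : ℝ) (P.right v) ×ˢ {((P.ρ v : ℤ) : ℝ)}
  rw [mem_bar_iff]
  exact ⟨⟨by dsimp only; exact_mod_cast h1, by dsimp only; exact_mod_cast h2⟩, by dsimp only; norm_cast⟩

theorem outerCell_right {v : V}
    (h : ∀ d : G.Dart, d.fst = v → P.ρ d.fst = P.ρ d.snd → ¬ P.σ d.fst < P.σ d.snd) :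
    P.OuterCell (P.right v) (P.ρ v - 1) ↔ P.OuterCell (P.right v) (P.ρ v) := by
  refine outerCell_horizontal (fun w hw ⟨h1, h2⟩ => ?_) (fun d hd hd' hr ⟨h1, h2⟩ => ?_)
  · have := eq_of_mem_bar (v := w) (w := v) (x := P.right v) (by omega) h1 (by omega)
      (left_le_right v) le_rfl
    subst this
    omega
  · rcases eq_or_lt_of_le h1 with h1 | h1
    · refine h d (eq_of_mem_bar (x := P.right v) (by omega) ?_ (by omega) (left_le_right v) le_rfl) hd hd'
      rw [← h1]
      exact left_le_right _
    · exact not_mem_level hd hd' (by omega) (left_le_right v) le_rfl h1 h2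

theorem outerCell_left {v : V}
    (h : ∀ d : G.Dart, d.fst = v → P.ρ d.fst = P.ρ d.snd → ¬ P.σ d.snd < P.σ d.fst) :
    P.OuterCell (P.left v - 1) (P.ρ v - 1) ↔ P.OuterCell (P.left v - 1) (P.ρ v) := by
  refine outerCell_horizontal (fun w hw ⟨h1, h2⟩ => ?_) (fun d hd hd' hr ⟨h1, h2⟩ => ?_)
  · have := eq_of_mem_bar (v := w) (w := v) (x := P.left v) (by omega) (by omega) (by omega)
      le_rfl (left_le_right v)
    subst this
    omega
  · rcases eq_or_lt_of_le (show P.left v ≤ P.left d.snd by omega) with h2 | h2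
    · exact h d.symm (eq_of_mem_bar (v := d.snd) (x := P.left v) (by omega) (by omega)
        (by rw [h2]; exact left_le_right _) le_rfl (left_le_right v)) hd.symm hd'
    · exact not_mem_level hd hd' (by omega) le_rfl (left_le_right v) (by omega) h2

variable (P) in
/-- The number of places around a bar. -/
def numPlaces (v : V) : ℤ := 2 * (P.right v - P.left v) + 4

variable (P) in
/-- The cell that follows a place around a bar is contained in the unbounded region. -/
def OuterSlot (v : V) (s : ℤ) : Prop :=
  if s ≤ P.right v - P.left v + 1 then P.OuterCell (P.right v - s) (P.ρ v)
  else P.OuterCell (P.left v + (s - (P.right v - P.left v + 3))) (P.ρ v - 1)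

/-- A place without a dart does not separate the cells before and after it. The three cases are the
top side, the left end and the bottom side of the bar. -/
theorem outerSlot_step {v : V} {s : ℤ} (h0 : 0 ≤ s) (h1 : s + 1 < P.numPlaces v)
    (h : ∀ d : G.Dart, d.fst = v → P.rep.place d ≠ s + 1) :
    P.OuterSlot v (s + 1) → P.OuterSlot v s := by
  have hlr := left_le_right (P := P) v
  unfold numPlaces at h1
  unfold OuterSlot
  rcases lt_trichotomy s (P.right v - P.left v + 1) with hs | hs | hs
  · rw [if_pos (by omega), if_pos (by omega)]
    have := outerCell_top (P := P) (v := v) (x := P.right v - s) (by omega) (by omega)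
      (fun d hd hr hx => h d hd (by rw [place_up hr, hd] at *; omega))
    rw [show P.right v - (s + 1) = P.right v - s - 1 by ring]
    exact this.1
  · rw [if_neg (by omega), if_pos (by omega)]
    have := outerCell_left (P := P) (v := v) (fun d hd hr hσ => h d hd (by
      rw [place_left hr hσ, hd]; omega))
    rw [show P.left v + (s + 1 - (P.right v - P.left v + 3)) = P.left v - 1 by omega,
      show P.right v - s = P.left v - 1 by omega]
    exact this.1
  · rw [if_neg (by omega), if_neg (by omega)]
    have := outerCell_bottom (P := P) (v := v)
      (x := P.left v + (s + 1 - (P.right v - P.left v + 3))) (by omega) (by omega)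
      (fun d hd hr hx => h d hd (by rw [place_down hr, hd] at *; omega))
    rw [show P.left v + (s - (P.right v - P.left v + 3)) =
      P.left v + (s + 1 - (P.right v - P.left v + 3)) - 1 by ring]
    exact this.2

theorem outerSlot_wrap {v : V} (h : ∀ d : G.Dart, d.fst = v → P.rep.place d ≠ 0) :
    P.OuterSlot v 0 → P.OuterSlot v (P.numPlaces v - 1) := by
  have hlr := left_le_right (P := P) v
  unfold numPlaces OuterSlot
  rw [if_pos (by omega), if_neg (by omega)]
  have := outerCell_right (P := P) (v := v) (fun d hd hr hσ => h d hd (place_right hr hσ))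
  rw [show P.left v + (2 * (P.right v - P.left v) + 4 - 1 - (P.right v - P.left v + 3)) = P.right v by
    ring, sub_zero]
  exact this.2

theorem outerSlot_descend {v : V} {a b : ℤ} (h0 : 0 ≤ a) (hab : a ≤ b) (h1 : b < P.numPlaces v)
    (h : ∀ d : G.Dart, d.fst = v → ¬ (a < P.rep.place d ∧ P.rep.place d ≤ b)) :
    P.OuterSlot v b → P.OuterSlot v a := by
  obtain ⟨n, rfl⟩ : ∃ n : ℕ, b = a + n := ⟨(b - a).toNat, by omega⟩
  induction n with
  | zero => simp
  | succ n ih =>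
    intro hb
    push_cast at hb h1 h
    refine ih (by omega) (by omega) (fun d hd hh => h d hd (by omega)) ?_
    rw [← add_assoc] at hb
    exact outerSlot_step (by omega) (by omega) (fun d hd hh => h d hd (by omega)) hb

variable (P) in
/-- The slot before a place. -/
def OuterBefore (v : V) (s : ℤ) : Prop :=
  P.OuterSlot v (if s = 0 then P.numPlaces v - 1 else s - 1)

/-- Going clockwise from the slot before `b` to the slot after `a`, possibly past the right end,
meets no dart. -/
theorem outerSlot_of_outerBefore {v : V} {a b : ℤ} (ha : 0 ≤ a) (ha' : a < P.numPlaces v)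
    (hb : 0 ≤ b) (hb' : b < P.numPlaces v)
    (h : ∀ d : G.Dart, d.fst = v → P.rep.place d = a ∨ P.rep.place d = b ∨
      BarVisRep.CyclicBetween b (P.rep.place d) a) :
    P.OuterBefore v b → P.OuterSlot v a := by
  unfold BarVisRep.CyclicBetween at h
  unfold OuterBefore
  rcases lt_or_ge a b with hab | hab
  · rw [if_neg (by omega)]
    exact outerSlot_descend ha (by omega) (by omega) (fun d hd hh => by have := h d hd; omega)
  · have hN : P.OuterSlot v (P.numPlaces v - 1) → P.OuterSlot v a :=
      outerSlot_descend ha (by omega) (by omega) (fun d hd hh => by have := h d hd; omega)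
    by_cases hb0 : b = 0
    · rw [if_pos hb0]
      exact hN
    · rw [if_neg hb0]
      intro h1
      refine hN (outerSlot_wrap (fun d hd hh => by have := h d hd; omega) ?_)
      exact outerSlot_descend le_rfl (by omega) (by omega) (fun d hd hh => by have := h d hd; omega) h1

theorem place_bounds (d : G.Dart) : 0 ≤ P.rep.place d ∧ P.rep.place d < P.numPlaces d.fst := by
  have := left_le_right (P := P) d.fst
  unfold numPlaces
  rcases P.place_cases d with ⟨-, h, h1, h2, -⟩ | ⟨-, h, h1, h2⟩ | ⟨-, -, h⟩ | ⟨-, -, h⟩ <;> omega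

theorem topPlace_bounds (v : V) : 0 < P.topPlace v ∧ P.topPlace v < P.numPlaces v := by
  have := P.left_le_X v
  have := P.X_le_right v
  unfold numPlaces topPlace
  omega

theorem place_injective {d e : G.Dart} (hde : d.fst = e.fst) (h : P.rep.place d = P.rep.place e) :
    d = e := by
  by_contra hne
  have h1 : P.σ d.snd ≠ P.σ e.snd := fun h1 =>
    hne (SimpleGraph.Dart.ext d e (Prod.ext hde (P.σ_inj h1)))
  have h2 : P.σ d.fst ≠ P.σ d.snd := fun h => d.adj.ne (P.σ_inj h)
  have h3 : P.σ d.fst ≠ P.σ e.snd := fun h => e.adj.ne (hde.symm.trans (P.σ_inj h))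
  by_cases hk : KeyLT (P.σ d.fst) (P.σ d.snd) (P.σ e.snd)
  · have := cyclicBetween_of_keyLT (P := P) hde hk
    unfold BarVisRep.CyclicBetween at this
    omega
  · have := cyclicBetween_of_keyLT (P := P) (d := e) (e := d) hde.symm (by
      rw [← hde]
      unfold KeyLT at hk ⊢
      omega)
    unfold BarVisRep.CyclicBetween at this
    omega

/-! ### The two sides of a dart near its tail -/

theorem rep_tailPt (d : G.Dart) : P.rep.tailPt d = gridPoint (P.attach d) := rfl

theorem rep_vec (d : G.Dart) : P.rep.vec d = gridPoint (P.attach d.symm - P.attach d) := rfl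

theorem cell_subset_compl (x y : ℤ) :
    Set.Ioo (x : ℝ) (x + 1) ×ˢ Set.Ioo (y : ℝ) (y + 1) ⊆ P.rep.drawingᶜ := by
  rintro z ⟨⟨z1, z2⟩, z3, z4⟩ hz
  rcases mem_drawing hz with ⟨v, -, h⟩ | ⟨d, h, h1, h2, h3⟩ | ⟨d, -, -, -, h⟩
  · rw [h] at z3 z4
    have z3 : y < (P.ρ v : ℤ) := by exact_mod_cast z3
    have z4 : (P.ρ v : ℤ) < y + 1 := by exact_mod_cast z4
    omega
  · rw [h1] at z1 z2
    have z1 : x < P.col d.snd d.fst := by exact_mod_cast z1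
    have z2 : P.col d.snd d.fst < x + 1 := by exact_mod_cast z2
    omega
  · rw [h] at z3 z4
    have z3 : y < (P.ρ d.fst : ℤ) := by exact_mod_cast z3
    have z4 : (P.ρ d.fst : ℤ) < y + 1 := by exact_mod_cast z4
    omega

theorem outerLeftAt_iff_outerCell {d : G.Dart} {q : ℝ × ℝ} {x y : ℤ}
    (h : ∀ᶠ ε : ℝ in nhdsWithin 0 (Set.Ioi 0), q + ε • P.rep.leftNormal d ∈
      Set.Ioo (x : ℝ) (x + 1) ×ˢ Set.Ioo (y : ℝ) (y + 1)) :
    P.rep.OuterLeftAt d q ↔ P.OuterCell x y :=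
  BarVisRep.outerLeftAt_iff_of_subset ((convex_Ioo _ _).prod (convex_Ioo _ _)) (cell_subset_compl x y) h

/-- The cells to the left and to the right of the beginning of a dart. -/
theorem eventually_outerLeftAt_tail (d : G.Dart) : ∀ᶠ t : ℝ in nhdsWithin 0 (Set.Ioi 0),
    (P.rep.OuterLeftAt d (P.rep.tailPt d + t • P.rep.vec d) ↔
      P.OuterSlot d.fst (P.rep.place d)) ∧
    (P.rep.OuterLeftAt d.symm (P.rep.tailPt d + t • P.rep.vec d) ↔
      P.OuterBefore d.fst (P.rep.place d)) := by
  have hlr := left_le_right (P := P) d.fst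
  unfold OuterBefore OuterSlot numPlaces
  -- On an edge of length `h`, the condition `t * h < 1` keeps the point within the first grid unit,
  -- next to the cells at the bar.
  have key : ∀ (h : ℤ) (hh : 0 < h) (Q : ℝ → Prop),
      (∀ t : ℝ, 0 < t * h → t * h < 1 → Q t) → ∀ᶠ t : ℝ in nhdsWithin 0 (Set.Ioi 0), Q t := by
    intro h hh Q hQ
    filter_upwards [eventually_pos_lt (show (0 : ℝ) < 1 / h by
      have : (0 : ℝ) < h := by exact_mod_cast hh
      positivity)] with t ht
    exact hQ t (slot_bounds hh ht.1 ht.2).1 (slot_bounds hh ht.1 ht.2).2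
  rcases P.attach_cases d with ⟨h, h1, h2⟩ | ⟨h, h1, h2⟩ | ⟨h, h', h1, h2⟩ | ⟨h, h', h1, h2⟩
  · have hp := place_down h
    have h3 := P.left_le_col _ _ d.adj h
    have h4 := P.col_le_right _ _ d.adj h
    refine key (P.ρ d.fst - P.ρ d.snd) (by omega) _ fun t t0 t1 => ?_
    rw [hp, if_neg (by omega), if_neg (by omega), if_neg (by omega)]
    push_cast at t0 t1
    constructor
    · refine outerLeftAt_iff_outerCell (key (P.ρ d.fst - P.ρ d.snd) (by omega) _ fun ε ε0 ε1 => ?_)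
      rw [BarVisRep.leftNormal_eq, rep_tailPt, rep_vec, h1, h2]
      push_cast at ε0 ε1
      simp only [gridPoint, Prod.mk_sub_mk, sub_self, Set.mem_prod, Set.mem_Ioo, Prod.smul_mk,
        Prod.mk_add_mk, smul_eq_mul]
      push_cast
      refine ⟨⟨?_, ?_⟩, ?_, ?_⟩ <;> linarith
    · refine outerLeftAt_iff_outerCell (key (P.ρ d.fst - P.ρ d.snd) (by omega) _ fun ε ε0 ε1 => ?_)
      rw [BarVisRep.leftNormal_eq, BarVisRep.vec_symm, rep_tailPt, rep_vec, h1, h2]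
      push_cast at ε0 ε1
      simp only [gridPoint, Prod.mk_sub_mk, sub_self, Set.mem_prod, Set.mem_Ioo, Prod.smul_mk,
        Prod.mk_add_mk, smul_eq_mul, Prod.neg_mk]
      push_cast
      refine ⟨⟨?_, ?_⟩, ?_, ?_⟩ <;> linarith
  · have hp := place_up h
    have h3 := P.left_le_col' _ _ d.adj.symm h
    have h4 := P.col_le_right' _ _ d.adj.symm h
    refine key (P.ρ d.snd - P.ρ d.fst) (by omega) _ fun t t0 t1 => ?_
    rw [hp, if_neg (show ¬ (1 + (P.right d.fst - P.col d.snd d.fst) = 0) by omega), if_pos (by omega),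
      if_pos (by omega)]
    push_cast at t0 t1
    constructor
    · refine outerLeftAt_iff_outerCell (key (P.ρ d.snd - P.ρ d.fst) (by omega) _ fun ε ε0 ε1 => ?_)
      rw [BarVisRep.leftNormal_eq, rep_tailPt, rep_vec, h1, h2]
      push_cast at ε0 ε1
      simp only [gridPoint, Prod.mk_sub_mk, sub_self, Set.mem_prod, Set.mem_Ioo, Prod.smul_mk,
        Prod.mk_add_mk, smul_eq_mul]
      push_cast
      refine ⟨⟨?_, ?_⟩, ?_, ?_⟩ <;> linarith
    · refine outerLeftAt_iff_outerCell (key (P.ρ d.snd - P.ρ d.fst) (by omega) _ fun ε ε0 ε1 => ?_)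
      rw [BarVisRep.leftNormal_eq, BarVisRep.vec_symm, rep_tailPt, rep_vec, h1, h2]
      push_cast at ε0 ε1
      simp only [gridPoint, Prod.mk_sub_mk, sub_self, Set.mem_prod, Set.mem_Ioo, Prod.smul_mk,
        Prod.mk_add_mk, smul_eq_mul, Prod.neg_mk]
      push_cast
      refine ⟨⟨?_, ?_⟩, ?_, ?_⟩ <;> linarith
  · have hp := place_right h h'
    have h3 := right_lt_left h h'
    have h4 : (P.ρ d.snd : ℝ) = P.ρ d.fst := by exact_mod_cast h.symm
    refine key (P.left d.snd - P.right d.fst) (by omega) _ fun t t0 t1 => ?_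
    rw [hp, if_pos (show (0 : ℤ) = 0 from rfl), if_pos (by omega), if_neg (by omega)]
    push_cast at t0 t1
    constructor
    · refine outerLeftAt_iff_outerCell (key (P.left d.snd - P.right d.fst) (by omega) _ fun ε ε0 ε1 => ?_)
      rw [BarVisRep.leftNormal_eq, rep_tailPt, rep_vec, h1, h2]
      push_cast at ε0 ε1
      simp only [gridPoint, Prod.mk_sub_mk, Set.mem_prod, Set.mem_Ioo, Prod.smul_mk,
        Prod.mk_add_mk, smul_eq_mul]
      push_cast
      rw [h4]
      refine ⟨⟨?_, ?_⟩, ?_, ?_⟩ <;> linarith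
    · refine outerLeftAt_iff_outerCell (key (P.left d.snd - P.right d.fst) (by omega) _ fun ε ε0 ε1 => ?_)
      rw [BarVisRep.leftNormal_eq, BarVisRep.vec_symm, rep_tailPt, rep_vec, h1, h2]
      push_cast at ε0 ε1
      simp only [gridPoint, Prod.mk_sub_mk, Set.mem_prod, Set.mem_Ioo, Prod.smul_mk,
        Prod.mk_add_mk, smul_eq_mul, Prod.neg_mk]
      push_cast
      rw [h4]
      refine ⟨⟨?_, ?_⟩, ?_, ?_⟩ <;> linarith
  · have hp := place_left h h'
    have h3 := right_lt_left h.symm h'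
    have h4 : (P.ρ d.snd : ℝ) = P.ρ d.fst := by exact_mod_cast h.symm
    refine key (P.left d.fst - P.right d.snd) (by omega) _ fun t t0 t1 => ?_
    rw [hp, if_neg (show ¬ (P.right d.fst - P.left d.fst + 2 = 0) by omega), if_neg (by omega),
      if_pos (by omega)]
    push_cast at t0 t1
    constructor
    · refine outerLeftAt_iff_outerCell (key (P.left d.fst - P.right d.snd) (by omega) _ fun ε ε0 ε1 => ?_)
      rw [BarVisRep.leftNormal_eq, rep_tailPt, rep_vec, h1, h2]
      push_cast at ε0 ε1
      simp only [gridPoint, Prod.mk_sub_mk, Set.mem_prod, Set.mem_Ioo, Prod.smul_mk,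
        Prod.mk_add_mk, smul_eq_mul]
      push_cast
      rw [h4]
      refine ⟨⟨?_, ?_⟩, ?_, ?_⟩ <;> linarith
    · refine outerLeftAt_iff_outerCell (key (P.left d.fst - P.right d.snd) (by omega) _ fun ε ε0 ε1 => ?_)
      rw [BarVisRep.leftNormal_eq, BarVisRep.vec_symm, rep_tailPt, rep_vec, h1, h2]
      push_cast at ε0 ε1
      simp only [gridPoint, Prod.mk_sub_mk, Set.mem_prod, Set.mem_Ioo, Prod.smul_mk,
        Prod.mk_add_mk, smul_eq_mul, Prod.neg_mk]
      push_cast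
      rw [h4]
      refine ⟨⟨?_, ?_⟩, ?_, ?_⟩ <;> linarith

/-! ### The ray above a vertex -/

/-- The column `X v` carries no vertical edge, and bars and level edges that meet it are not above
the row of `v`. So the ray is free, and being unbounded it lies in the unbounded region. -/
theorem ray_subset (v : V) :
    {(P.X v : ℝ)} ×ˢ Set.Ioi (P.ρ v : ℝ) ⊆ P.rep.outerRegion := by
  set R : Set (ℝ × ℝ) := {(P.X v : ℝ)} ×ˢ Set.Ioi (P.ρ v : ℝ)
  have hR : Convex ℝ R := (convex_singleton _).prod (convex_Ioi _)
  have hRD : R ⊆ P.rep.drawingᶜ := by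
    rintro z ⟨z1, z2⟩ hz
    have z1 : z.1 = P.X v := z1
    have z2 : (P.ρ v : ℝ) < z.2 := z2
    have hb := inBlock_X (P := P) v
    rcases mem_drawing hz with ⟨w, ⟨h1, h2⟩, h⟩ | ⟨d, h, h1, h2, h3⟩ | ⟨d, h1, h2, ⟨h3, h4⟩, h⟩
    · rw [h] at z2
      rw [z1] at h1 h2
      norm_cast at z2 h1 h2
      have := row_lt_of_mem_bar (v := w) hb (fun h => by rw [h] at z2; omega) h1 h2
      omega
    · rw [z1] at h1
      norm_cast at h1
      have hb' := inBlock_col d.adj.symm h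
      have h5 := P.X_lt_col _ _ d.adj.symm h
      rcases lt_trichotomy (P.σ v) (P.σ d.snd) with h6 | h6 | h6
      · have := lt_of_inBlock_of_lt hb hb' h6
        omega
      · rw [P.σ_inj h6] at h1
        omega
      · have := lt_of_inBlock_of_lt hb' hb h6
        omega
    · rw [h] at z2
      rw [z1] at h3 h4
      norm_cast at z2 h3 h4
      have h5 := P.X_le_right d.fst
      have h6 := P.left_le_X d.snd
      have h7 : P.σ d.fst < P.σ v := by
        rcases lt_trichotomy (P.σ v) (P.σ d.fst) with h | h | h
        · have := P.X_lt_X _ _ h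
          omega
        · rw [P.σ_inj h] at z2
          omega
        · exact h
      have h8 : P.σ v < P.σ d.snd := by
        rcases lt_trichotomy (P.σ v) (P.σ d.snd) with h | h | h
        · exact h
        · rw [P.σ_inj h] at z2
          omega
        · have := P.X_lt_X _ _ h
          omega
      have := P.row_chord _ _ v d.adj h7 h8
      omega
  intro z hz
  refine ⟨hRD hz, fun hbd => ?_⟩
  have hsub := hR.isPreconnected.subset_connectedComponentIn hz hRD
  obtain ⟨C, hC⟩ := (hbd.subset hsub).exists_norm_le
  have h1 := hC ((P.X v : ℝ), (P.ρ v : ℝ) + |C| + 1) ⟨rfl, by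
    change (P.ρ v : ℝ) < _
    have := abs_nonneg C
    linarith⟩
  have h2 := (norm_snd_le ((P.X v : ℝ), (P.ρ v : ℝ) + |C| + 1)).trans h1
  have h3 := le_abs_self C
  have h4 : (0 : ℝ) ≤ P.ρ v := by positivity
  have h5 := le_abs_self ((P.ρ v : ℝ) + |C| + 1)
  rw [Real.norm_eq_abs] at h2
  linarith

theorem outerBefore_topPlace (v : V) : P.OuterBefore v (P.topPlace v) := by
  have h := topPlace_bounds (P := P) v
  have h1 := P.left_le_X v
  unfold OuterBefore OuterSlot
  rw [if_neg h.1.ne']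
  unfold topPlace at h ⊢
  rw [if_pos (by omega), show P.right v - (1 + (P.right v - P.X v) - 1) = P.X v by ring]
  have hb := inBlock_X (P := P) v
  have hfree := vertical_disjoint_drawing (P := P) (x := P.X v) (y := P.ρ v) (fun d hd hx _ => by
    have hb' := inBlock_col d.adj.symm hd
    have h5 := P.X_lt_col _ _ d.adj.symm hd
    rcases lt_trichotomy (P.σ v) (P.σ d.snd) with h6 | h6 | h6
    · have := lt_of_inBlock_of_lt hb hb' h6
      omega
    · rw [P.σ_inj h6] at hx
      omega
    · have := lt_of_inBlock_of_lt hb' hb h6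
      omega)
  have hc : Convex ℝ (Set.Ioo (P.X v - 1 : ℝ) (P.X v + 1) ×ˢ
      Set.Ioo (((P.ρ v : ℤ) : ℝ)) ((P.ρ v : ℤ) + 1)) := (convex_Ioo _ _).prod (convex_Ioo _ _)
  refine Set.Subset.trans ?_ (P.rep.subset_outerRegion hc.isPreconnected hfree
    (p := ((P.X v : ℝ), (P.ρ v : ℝ) + 1 / 2)) ?_ (ray_subset v ?_))
  · exact Set.prod_mono (Set.Ioo_subset_Ioo (by linarith) le_rfl) le_rfl
  · refine ⟨⟨?_, ?_⟩, ?_, ?_⟩ <;> dsimp only <;> push_cast <;> linarith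
  · exact ⟨rfl, by change (P.ρ v : ℝ) < _; linarith⟩

theorem bar_inter_closure_nonempty (v : V) :
    (P.rep.bar v ∩ closure P.rep.outerRegion).Nonempty := by
  refine ⟨((P.X v : ℝ), (P.ρ v : ℝ)), ?_, closure_mono (ray_subset v) ?_⟩
  · change _ ∈ Set.Icc (P.left v : ℝ) (P.right v) ×ˢ {((P.ρ v : ℤ) : ℝ)}
    rw [mem_bar_iff]
    exact ⟨⟨by dsimp only; exact_mod_cast P.left_le_X v,
      by dsimp only; exact_mod_cast P.X_le_right v⟩, by
      dsimp only; norm_cast⟩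
  · rw [closure_prod_eq, closure_Ioi, closure_singleton]
    exact ⟨rfl, Set.self_mem_Ici⟩

end BarPlan

/-! ### Following the outer face along the bars -/

namespace OuterOnePlane

variable {V : Type*} {G : SimpleGraph V} {E : OuterOnePlane G} {sel : G.Dart → G.Dart}

/-- The indicator in `rot_key` can drop only after `sel d`, and it has to be one there in order to
drop. So every other dart comes before `sel d`. -/
theorem ChordOrder.keyLT_sel {σ : V → ℕ} (hE : E.ChordOrder σ sel) {d f : G.Dart}
    (hf : f.fst = d.fst) (hne : f ≠ sel d) : KeyLT (σ d.fst) (σ f.snd) (σ (sel d).snd) := by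
  classical
  have h1 := hE.sel_fst d
  have hk := hE.rot_key f (sel d) (hf.trans h1.symm)
  rw [if_congr (or_iff_right (Ne.symm hne)) rfl rfl, if_pos (hE.sel_congr d (sel d) h1.symm), hf] at hk
  by_contra h
  rw [if_neg h] at hk
  by_cases h2 : E.rot (sel d) = f
  · rw [if_pos (Or.inl h2), if_pos h2] at hk
    norm_num at hk
  · rw [if_neg h2] at hk
    split_ifs at hk <;> norm_num at hk

end OuterOnePlane

namespace BarPlan

variable {V : Type*} {G : SimpleGraph V} {E : OuterOnePlane G} {sel : G.Dart → G.Dart}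
  {P : BarPlan G}

theorem crossing_rep (hE : E.ChordOrder P.σ sel) (d e : G.Dart) :
    P.rep.CrossesFromRight d e ↔ ∃ h : d ∈ E.crossed, (E.cross ⟨d, h⟩ : G.Dart) = e :=
  (crossesFromRight_iff d e).trans (hE.cross_iff d e).symm

theorem outerOnLeft_inl_iff [Finite V] (hE : E.ChordOrder P.σ sel) (d : G.Dart) :
    P.rep.OuterOnLeft E.toOnePlaneMap (Sum.inl d) ↔ P.OuterSlot d.fst (P.rep.place d) := by
  obtain ⟨t, h1, h2, -⟩ := ((P.rep.eventually_mem_pieceSeg E.toOnePlaneMap d).and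
    (eventually_outerLeftAt_tail (P := P) d)).exists
  rw [BarVisRep.outerOnLeft_iff (crossing_rep hE) _ h1]
  exact h2

theorem outerOnLeft_edgePerm_iff [Finite V] (hE : E.ChordOrder P.σ sel) (d : G.Dart) :
    P.rep.OuterOnLeft E.toOnePlaneMap (E.edgePerm (Sum.inl d)) ↔
      P.OuterBefore d.fst (P.rep.place d) := by
  obtain ⟨t, h1, -, h2⟩ := ((P.rep.eventually_mem_pieceSeg E.toOnePlaneMap d).and
    (eventually_outerLeftAt_tail (P := P) d)).exists
  rw [← BarVisRep.pieceSeg_edgePerm] at h1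
  rw [BarVisRep.outerOnLeft_iff (crossing_rep hE) _ h1, ← h2]
  have : BarVisRep.wholeDart E.toOnePlaneMap (E.edgePerm (Sum.inl d)) = d.symm := by
    by_cases h : d ∈ E.crossed
    · rw [E.edgePerm_inl_of_mem h]
      rfl
    · rw [E.edgePerm_inl_of_not_mem h]
      rfl
  rw [this]

theorem outerOnLeft_rot [Finite V] (hE : E.ChordOrder P.σ sel) (d : G.Dart)
    (h : P.OuterBefore d.fst (P.rep.place (E.rot d))) :
    P.OuterSlot d.fst (P.rep.place d) := by
  have hr := E.rot_fst d
  have b1 := place_bounds (P := P) d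
  have b2 := place_bounds (P := P) (E.rot d)
  rw [hr] at b2
  refine outerSlot_of_outerBefore b1.1 b1.2 b2.1 b2.2 (fun f hf => ?_) h
  have hn := not_cyclicBetween_rot hE d f hf
  by_cases h1 : f = d
  · exact Or.inl (by rw [h1])
  by_cases h2 : f = E.rot d
  · exact Or.inr (Or.inl (by rw [h2]))
  have n1 : P.rep.place f ≠ P.rep.place d := fun h => h1 (place_injective hf h)
  have n2 : P.rep.place f ≠ P.rep.place (E.rot d) := fun h =>
    h2 (place_injective (hf.trans hr.symm) h)
  have n3 : P.rep.place d ≠ P.rep.place (E.rot d) := by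
    intro h
    have h3 : d = E.rot d := place_injective hr.symm h
    obtain ⟨n, hn⟩ := E.exists_rot_pow hf.symm
    have h4 : ∀ n : ℕ, (E.rot ^ n) d = d := by
      intro n
      induction n with
      | zero => rfl
      | succ n ih => rw [pow_succ, Equiv.Perm.mul_apply, ← h3, ih]
    exact h1 (by rw [← hn, h4])
  right; right
  unfold BarVisRep.CyclicBetween at hn ⊢
  omega

/-- A step of the boundary walk either turns at a crossing, where `outerOnLeft_cross` applies, or
goes around a bar to the preceding dart, with no dart in between. -/
theorem outerOnLeft_facePerm [Finite V] (hE : E.ChordOrder P.σ sel) (p : E.toOnePlaneMap.Piece)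
    (h : P.rep.OuterOnLeft E.toOnePlaneMap p) :
    P.rep.OuterOnLeft E.toOnePlaneMap (E.facePerm p) := by
  have hface : E.facePerm p = E.vertexPerm⁻¹ (E.edgePerm p) := rfl
  have hend : ∀ d : G.Dart, E.edgePerm p = Sum.inl d →
      P.rep.OuterOnLeft E.toOnePlaneMap (E.facePerm p) := by
    intro d hd
    have hp : p = E.edgePerm (Sum.inl d) := by rw [← hd, E.edgePerm_edgePerm]
    rw [hp, outerOnLeft_edgePerm_iff hE] at h
    have h1 : E.facePerm p = Sum.inl (E.rot⁻¹ d) := by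
      rw [hface, hd, Equiv.Perm.inv_eq_iff_eq, E.vertexPerm_inl, Equiv.Perm.inv_def, Equiv.apply_symm_apply]
    rw [h1, outerOnLeft_inl_iff hE]
    refine outerOnLeft_rot hE _ ?_
    have h2 := E.rot_fst (E.rot⁻¹ d)
    rw [Equiv.Perm.inv_def, Equiv.apply_symm_apply] at h2 ⊢
    rwa [← h2]
  rcases p with d | d
  · by_cases hd : d ∈ E.crossed
    · have h1 := BarVisRep.outerOnLeft_cross (crossing_rep hE) ⟨d, hd⟩ h
      have h2 : E.facePerm (Sum.inl d) = Sum.inr (E.cross ⟨d, hd⟩) := by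
        rw [hface, E.edgePerm_inl_of_mem hd, Equiv.Perm.inv_eq_iff_eq, E.vertexPerm_inr]
        exact congrArg Sum.inr (Subtype.ext (E.cross_cross ⟨d, hd⟩).symm)
      rwa [h2]
    · exact hend d.symm (E.edgePerm_inl_of_not_mem hd)
  · exact hend _ (E.edgePerm_inr d)

/-- No dart lies between `sel d` and `topPlace`, where the free ray starts. -/
theorem outerOnLeft_sel [Finite V] (hE : E.ChordOrder P.σ sel) (d : G.Dart) :
    P.rep.OuterOnLeft E.toOnePlaneMap (Sum.inl (sel d)) := by
  have h1 := hE.sel_fst d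
  have b1 := place_bounds (P := P) (sel d)
  have b2 := topPlace_bounds (P := P) (sel d).fst
  rw [outerOnLeft_inl_iff hE]
  refine outerSlot_of_outerBefore b1.1 b1.2 b2.1.le b2.2 (fun f hf => ?_)
    (outerBefore_topPlace _)
  by_cases hne : f = sel d
  · exact Or.inl (by rw [hne])
  · right; right
    have h2 := hE.keyLT_sel (hf.trans h1) hne
    rw [← hf]
    refine cyclicBetween_of_keyLT hf ?_
    rwa [hf, h1]

/-- The outer darts of a component form one face orbit, which contains some `sel d`; the property
spreads along it. -/
theorem outerOnLeft_of_mem_outer [Finite V] (hE : E.ChordOrder P.σ sel)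
    (p : E.toOnePlaneMap.Piece) (hp : p ∈ E.outer) : P.rep.OuterOnLeft E.toOnePlaneMap p := by
  obtain ⟨d, hd⟩ : ∃ d : G.Dart, E.comp (Sum.inl (sel d)) = E.comp p := by
    rcases p with d | d
    · exact ⟨d, E.comp_inl_of_fst_eq (hE.sel_fst d)⟩
    · exact ⟨d, by rw [E.comp_inr]; exact E.comp_inl_of_fst_eq (hE.sel_fst _)⟩
  have hs := E.outer_sameCycle _ (hE.sel_outer d) p hp hd
  obtain ⟨n, hn⟩ := hs.exists_nat_pow_eq
  rw [← hn]
  have key : ∀ n : ℕ, P.rep.OuterOnLeft E.toOnePlaneMap ((E.facePerm ^ n) (Sum.inl (sel d))) := by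
    intro n
    induction n with
    | zero => exact outerOnLeft_sel hE d
    | succ n ih =>
      rw [pow_succ', Equiv.Perm.mul_apply]
      exact outerOnLeft_facePerm hE _ ih
  exact key n

theorem embeddingPreserving_rep [Finite V] (hE : E.ChordOrder P.σ sel) :
    P.rep.EmbeddingPreserving E where
  rotation := not_cyclicBetween_rot hE
  crossing := crossing_rep hE
  outer_left := outerOnLeft_of_mem_outer hE
  outer_vertex := bar_inter_closure_nonempty

end BarPlan

/-- Every outer-1-plane graph has an embedding-preserving representation of quadratic area. -/
theorem OuterOnePlane.exists_barVisRep {V : Type*} [Finite V] {G : SimpleGraph V}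
    (E : OuterOnePlane G) : ∃ Γ : BarVisRep G, Γ.EmbeddingPreserving E ∧
      Γ.area ≤ 5 * Nat.card V * Nat.card V := by
  obtain ⟨σ, sel, hE⟩ := E.exists_chordOrder
  obtain ⟨P, rfl, hx, hy⟩ := hE.exists_barPlan
  exact ⟨P.rep, BarPlan.embeddingPreserving_rep hE, BarPlan.area_rep_le hx hy⟩

/-! ### Nested crossings -/

theorem Equiv.Perm.SameCycle.map_eq {D A : Type*} [Finite D] {π : Equiv.Perm D} {l : D → A}
    (hl : ∀ p, l (π p) = l p) {p q : D} (h : π.SameCycle p q) : l p = l q := by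
  obtain ⟨n, rfl⟩ := h.exists_nat_pow_eq
  induction n with
  | zero => rfl
  | succ n ih => rw [pow_succ', Equiv.Perm.mul_apply, hl, ← ih ⟨n, by simp⟩]

/-- Labels constant on orbits bound the number of orbits from below; in case of equality they also
separate the orbits. -/
theorem card_le_card_orbits {D A : Type*} [Finite D] {π : Equiv.Perm D} {l : D → A}
    (hl : ∀ p, l (π p) = l p) (hs : Function.Surjective l) :
    Nat.card A ≤ Nat.card (OnePlaneMap.Orbits π) ∧
      (Nat.card (OnePlaneMap.Orbits π) = Nat.card A → ∀ p q, l p = l q → π.SameCycle p q) := by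
  let g : OnePlaneMap.Orbits π → A := Quotient.lift l fun p q (h : π.SameCycle p q) => h.map_eq hl
  have hg : Function.Surjective g := fun a => by
    obtain ⟨p, rfl⟩ := hs a
    exact ⟨Quotient.mk _ p, rfl⟩
  refine ⟨Nat.card_le_card_of_surjective g hg, fun hc p q hpq => ?_⟩
  have hA : Finite A := Finite.of_surjective l hs
  have := ((Nat.bijective_iff_surjective_and_card g).2 ⟨hg, hc⟩).1
    (show g (Quotient.mk _ p) = g (Quotient.mk _ q) from hpq)
  exact Quotient.exact this

/-- A connected map with sufficiently many vertices and faces is planar, and has no other faces. -/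
theorem OnePlaneMap.isPlanar_of_labels {V A B : Type*} [Finite V] {G : SimpleGraph V}
    (M : OnePlaneMap G) (hconn : ∀ p q, M.comp p = M.comp q) {lv : M.Piece → A} {lf : M.Piece → B}
    (hlv : ∀ p, lv (M.vertexPerm p) = lv p) (hlf : ∀ p, lf (M.facePerm p) = lf p)
    (hsv : Function.Surjective lv) (hsf : Function.Surjective lf)
    (hcard : Nat.card M.Piece + 4 ≤ 2 * (Nat.card A + Nat.card B)) :
    M.IsPlanar ∧ ∀ p q, lf p = lf q → M.facePerm.SameCycle p q := by
  -- Euler's inequality bounds the number of vertices plus faces from above, and the labels bound it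
  -- from below by the same number. So both bounds are attained.
  have h1 := euler_inequality (v := M.vertexPerm) (e := M.edgePerm) (f := M.facePerm)
    M.edgePerm_edgePerm M.edgePerm_ne M.vertexPerm_facePerm
  have h2 := card_eq_two_mul_card_orbits M.edgePerm_edgePerm M.edgePerm_ne
  have h3 : Nat.card M.Component ≤ 1 := by
    have : Subsingleton M.Component := ⟨fun a b => by
      induction a using Quot.inductionOn
      induction b using Quot.inductionOn
      exact hconn _ _⟩
    exact Finite.card_le_one_iff_subsingleton.2 this
  obtain ⟨h4, -⟩ := card_le_card_orbits hlv hsv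
  obtain ⟨h5, h6⟩ := card_le_card_orbits hlf hsf
  change _ ≤ _ + 2 * Nat.card M.Component at h1
  refine ⟨?_, h6 ?_⟩
  · unfold OnePlaneMap.IsPlanar
    omega
  · omega

/-- The edges of three chains of nested crossings. In every chain `c` and level `i` there are two
stems `(false, r, c, i)` and two arms `(true, r, c, i)`, and the arms cross the stems. -/
abbrev ChainEdge (k : ℕ) : Type := Bool × Bool × Fin 3 × Fin k

namespace ChainEdge

variable {k : ℕ}

/-- The arms of a level start from a common center, from which also the stems of the next level
start; the center `none` is common to the three chains. -/
def center : ChainEdge k → Option (Fin 3 × Fin k)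
  | (false, _, c, i) => if i.1 = 0 then none else some (c, ⟨i.1 - 1, by omega⟩)
  | (true, _, c, i) => some (c, i)

/-- The next edge around the center. -/
def next : ChainEdge k → ChainEdge k
  | (false, false, c, i) => (false, true, c, i)
  | (false, true, c, i) =>
    if i.1 = 0 then (false, false, c + 1, i) else (true, true, c, ⟨i.1 - 1, by omega⟩)
  | (true, true, c, i) => (true, false, c, i)
  | (true, false, c, i) =>
    if h : i.1 + 1 < k then (false, false, c, ⟨i.1 + 1, h⟩) else (true, true, c, i)

/-- The previous edge around the center. -/
def prev : ChainEdge k → ChainEdge k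
  | (false, true, c, i) => (false, false, c, i)
  | (false, false, c, i) =>
    if i.1 = 0 then (false, true, c - 1, i) else (true, false, c, ⟨i.1 - 1, by omega⟩)
  | (true, false, c, i) => (true, true, c, i)
  | (true, true, c, i) =>
    if h : i.1 + 1 < k then (false, true, c, ⟨i.1 + 1, h⟩) else (true, false, c, i)

theorem prev_next (e : ChainEdge k) : e.next.prev = e := by
  obtain ⟨a, r, c, i⟩ := e
  cases a <;> cases r
  · rfl
  · by_cases h : i.1 = 0
    · simp [next, prev, h]
    · have h1 : i.1 - 1 + 1 < k := by omega
      simp only [next, if_neg h, prev, dif_pos h1, Prod.mk.injEq, true_and, Fin.ext_iff]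
      omega
  · by_cases h : i.1 + 1 < k <;> simp [next, prev, h]
  · rfl

theorem center_next (e : ChainEdge k) : e.next.center = e.center := by
  obtain ⟨a, r, c, i⟩ := e
  cases a <;> cases r
  · rfl
  · by_cases h : i.1 = 0 <;> simp [next, center, h]
  · by_cases h : i.1 + 1 < k <;> simp [next, center, h]
  · rfl

/-- The rotation around the centers. -/
noncomputable def nextPerm (k : ℕ) : Equiv.Perm (ChainEdge k) :=
  Equiv.ofBijective next (Finite.injective_iff_bijective.1 (Function.LeftInverse.injective prev_next))

theorem nextPerm_apply (e : ChainEdge k) : nextPerm k e = e.next := rfl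

theorem sameCycle_next (e : ChainEdge k) : (nextPerm k).SameCycle e e.next :=
  ⟨1, by simp [nextPerm_apply]⟩

theorem sameCycle_of_center_eq_some {e : ChainEdge k} {c : Fin 3} {i : Fin k}
    (h : e.center = some (c, i)) : (nextPerm k).SameCycle (true, true, c, i) e := by
  have h1 : (nextPerm k).SameCycle (true, true, c, i) (true, false, c, i) := sameCycle_next _
  obtain ⟨a, r, c', i'⟩ := e
  cases a
  · by_cases h0 : i'.1 = 0
    · simp [center, h0] at h
    · simp only [center, if_neg h0, Option.some.injEq, Prod.mk.injEq] at h
      obtain ⟨rfl, rfl⟩ := h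
      have h2 := h1.trans (sameCycle_next _)
      have h3 : next (true, false, c', (⟨i'.1 - 1, by omega⟩ : Fin k)) = (false, false, c', i') := by
        have : i'.1 - 1 + 1 < k := by omega
        simp only [next, dif_pos this, Prod.mk.injEq, true_and, Fin.ext_iff]
        omega
      rw [h3] at h2
      cases r
      · exact h2
      · exact h2.trans (sameCycle_next _)
  · simp only [center, Option.some.injEq, Prod.mk.injEq] at h
    obtain ⟨rfl, rfl⟩ := h
    cases r
    · exact h1
    · exact Equiv.Perm.SameCycle.refl _ _

theorem sameCycle_of_center_eq_none {e : ChainEdge k} (h : e.center = none) (i : Fin k)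
    (hi : i.1 = 0) : (nextPerm k).SameCycle (false, false, 0, i) e := by
  obtain ⟨a, r, c, i'⟩ := e
  cases a
  · have h0 : i'.1 = 0 := by
      by_contra h0
      simp [center, h0] at h
    obtain rfl : i = i' := Fin.ext (by omega)
    have h1 : ∀ c, (nextPerm k).SameCycle (false, false, c, i) (false, true, c, i) := fun c =>
      sameCycle_next _
    have h2 : ∀ c, (nextPerm k).SameCycle (false, false, c, i) (false, false, c + 1, i) := fun c => by
      have := (h1 c).trans (sameCycle_next _)
      simpa [next, hi] using this
    have h3 : (nextPerm k).SameCycle (false, false, 0, i) (false, false, c, i) := by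
      fin_cases c
      · exact Equiv.Perm.SameCycle.refl _ _
      · exact h2 0
      · exact (h2 0).trans (h2 1)
    cases r
    · exact h3
    · exact h3.trans (h1 c)
  · simp [center] at h

theorem sameCycle_of_center_eq {e e' : ChainEdge k} (h : e.center = e'.center) :
    (nextPerm k).SameCycle e e' := by
  rcases hc : e.center with _ | ⟨c, i⟩
  · have hk : 0 < k := by
      obtain ⟨a, r, c, i⟩ := e
      exact i.pos
    exact (sameCycle_of_center_eq_none hc ⟨0, hk⟩ rfl).symm.trans
      (sameCycle_of_center_eq_none (h.symm.trans hc) ⟨0, hk⟩ rfl)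
  · exact (sameCycle_of_center_eq_some hc).symm.trans (sameCycle_of_center_eq_some (h.symm.trans hc))

end ChainEdge

/-- The edges of the chains with a direction, `true` for the direction from the center. -/
abbrev ChainDart (k : ℕ) : Type := ChainEdge k × Bool

namespace ChainDart

variable {k : ℕ}

def reverse (x : ChainDart k) : ChainDart k := (x.1, !x.2)

/-- The rotation around the centers and the leaves. -/
noncomputable def rotPerm (k : ℕ) : Equiv.Perm (ChainDart k) where
  toFun x := if x.2 then (ChainEdge.nextPerm k x.1, true) else x
  invFun x := if x.2 then ((ChainEdge.nextPerm k).symm x.1, true) else x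
  left_inv := by rintro ⟨e, _ | _⟩ <;> simp
  right_inv := by rintro ⟨e, _ | _⟩ <;> simp

/-- The dart that crosses a given dart from right to left. -/
def crossPerm (k : ℕ) : Equiv.Perm (ChainDart k) where
  toFun x := ((!x.1.1, x.1.2.1, x.1.2.2), xor x.2 (x.1.1 == x.1.2.1))
  invFun x := ((!x.1.1, x.1.2.1, x.1.2.2), xor x.2 (!x.1.1 == x.1.2.1))
  left_inv := by rintro ⟨⟨_ | _, _ | _, c, i⟩, _ | _⟩ <;> rfl
  right_inv := by rintro ⟨⟨_ | _, _ | _, c, i⟩, _ | _⟩ <;> rfl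

theorem crossPerm_crossPerm (x : ChainDart k) : crossPerm k (crossPerm k x) = x.reverse := by
  obtain ⟨⟨_ | _, _ | _, c, i⟩, _ | _⟩ := x <;> rfl

/-- The bounded face that contains the beginning of the first piece of a dart on its left. -/
def firstFace (x : ChainDart k) : Option (Fin 3 × Fin k) :=
  if x.1.1 = x.1.2.1 ∧ x.2 = true then some x.1.2.2 else none

/-- The bounded face to the left of the second piece of a dart. -/
def secondFace (x : ChainDart k) : Option (Fin 3 × Fin k) :=
  if x.1.1 ≠ x.1.2.1 ∧ x.2 = false then some x.1.2.2 else none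

/-- The steps of a boundary walk at a crossing and, in the next lemma, at a vertex. -/
theorem secondFace_crossPerm (x : ChainDart k) : (crossPerm k x).secondFace = x.firstFace := by
  obtain ⟨⟨_ | _, _ | _, c, i⟩, _ | _⟩ := x <;> rfl

theorem secondFace_reverse_rotPerm (x : ChainDart k) :
    (rotPerm k x).reverse.secondFace = x.firstFace := by
  obtain ⟨⟨a, r, c, i⟩, o⟩ := x
  cases o
  · cases a <;> cases r <;> rfl
  · change secondFace (ChainEdge.next (a, r, c, i), false) = _
    cases a <;> cases r
    · rfl
    · by_cases h : i.1 = 0 <;> simp [ChainEdge.next, h, secondFace, firstFace]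
    · by_cases h : i.1 + 1 < k <;> simp [ChainEdge.next, h, secondFace, firstFace]
    · rfl

end ChainDart

/-! ### The chains as a planar map -/

section ChainMap

variable {V : Type*} {k : ℕ} (φ : Option (Fin 3 × Fin k) ⊕ ChainEdge k ≃ V)

/-- The graph of the chains: every edge joins its center to a leaf. -/
def chainGraph : SimpleGraph V where
  Adj a b := ∃ e : ChainEdge k, (a = φ (Sum.inl e.center) ∧ b = φ (Sum.inr e)) ∨
    (a = φ (Sum.inr e) ∧ b = φ (Sum.inl e.center))
  symm := ⟨by
    rintro a b ⟨e, ⟨h1, h2⟩ | ⟨h1, h2⟩⟩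
    · exact ⟨e, Or.inr ⟨h2, h1⟩⟩
    · exact ⟨e, Or.inl ⟨h2, h1⟩⟩⟩
  loopless := ⟨by
    rintro a ⟨e, ⟨h1, h2⟩ | ⟨h1, h2⟩⟩
    · exact Sum.inl_ne_inr (φ.injective (h1.symm.trans h2))
    · exact Sum.inl_ne_inr (φ.injective (h2.symm.trans h1))⟩

def chainDart (x : ChainDart k) : (chainGraph φ).Dart :=
  if x.2 then ⟨(φ (Sum.inl x.1.center), φ (Sum.inr x.1)), x.1, Or.inl ⟨rfl, rfl⟩⟩
  else ⟨(φ (Sum.inr x.1), φ (Sum.inl x.1.center)), x.1, Or.inr ⟨rfl, rfl⟩⟩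

theorem chainDart_true_fst (e : ChainEdge k) : (chainDart φ (e, true)).fst = φ (Sum.inl e.center) := rfl

theorem chainDart_symm (x : ChainDart k) : (chainDart φ x).symm = chainDart φ x.reverse := by
  obtain ⟨e, _ | _⟩ := x <;> rfl

theorem chainDart_bijective : Function.Bijective (chainDart φ) := by
  constructor
  · rintro ⟨e, o⟩ ⟨e', o'⟩ h
    have h1 : (chainDart φ (e, o)).fst = (chainDart φ (e', o')).fst := by rw [h]
    have h2 : (chainDart φ (e, o)).snd = (chainDart φ (e', o')).snd := by rw [h]
    cases o <;> cases o'
    · have he : e = e' := Sum.inr_injective (φ.injective h1)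
      rw [he]
    · exact (Sum.inr_ne_inl (φ.injective h1)).elim
    · exact (Sum.inl_ne_inr (φ.injective h1)).elim
    · have he : e = e' := Sum.inr_injective (φ.injective h2)
      rw [he]
  · intro d
    obtain ⟨e, h | h⟩ := d.adj
    · exact ⟨(e, true), SimpleGraph.Dart.ext _ _ (Prod.ext h.1.symm h.2.symm)⟩
    · exact ⟨(e, false), SimpleGraph.Dart.ext _ _ (Prod.ext h.1.symm h.2.symm)⟩

noncomputable def chainDartEquiv : ChainDart k ≃ (chainGraph φ).Dart :=
  Equiv.ofBijective _ (chainDart_bijective φ)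

theorem chainDartEquiv_apply (x : ChainDart k) : chainDartEquiv φ x = chainDart φ x := rfl

theorem chainDartEquiv_symm (x : ChainDart k) : (chainDartEquiv φ).symm (chainDart φ x) = x :=
  (chainDartEquiv φ).symm_apply_apply x

theorem chainRot_apply (x : ChainDart k) :
    (chainDartEquiv φ).permCongr (ChainDart.rotPerm k) (chainDart φ x) =
      chainDart φ (ChainDart.rotPerm k x) := by
  rw [Equiv.permCongr_apply, chainDartEquiv_symm, chainDartEquiv_apply]

theorem exists_chainDart (d : (chainGraph φ).Dart) : ∃ x, chainDart φ x = d :=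
  (chainDart_bijective φ).2 d

theorem chainRot_isCycleOn (v : V) :
    ((chainDartEquiv φ).permCongr (ChainDart.rotPerm k)).IsCycleOn {d | d.fst = v} := by
  constructor
  · refine Equiv.bijOn _ fun d => ?_
    obtain ⟨⟨e, o⟩, rfl⟩ := exists_chainDart φ d
    rw [chainRot_apply]
    cases o
    · rfl
    · change φ (Sum.inl e.next.center) = v ↔ φ (Sum.inl e.center) = v
      rw [e.center_next]
  · intro d hd d' hd'
    obtain ⟨⟨e, o⟩, rfl⟩ := exists_chainDart φ d
    obtain ⟨⟨e', o'⟩, rfl⟩ := exists_chainDart φ d'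
    have h : (chainDart φ (e, o)).fst = (chainDart φ (e', o')).fst := Eq.trans hd (Eq.symm hd')
    cases o <;> cases o'
    · have he : e = e' := Sum.inr_injective (φ.injective h)
      rw [he]
    · exact (Sum.inr_ne_inl (φ.injective h)).elim
    · exact (Sum.inl_ne_inr (φ.injective h)).elim
    · have h : (Sum.inl e.center : Option (Fin 3 × Fin k) ⊕ ChainEdge k) = Sum.inl e'.center :=
        φ.injective h
      obtain ⟨n, hn⟩ := (ChainEdge.sameCycle_of_center_eq (Sum.inl_injective h)).exists_nat_pow_eq
      refine ⟨n, ?_⟩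
      rw [zpow_natCast, ← hn]
      clear hn
      induction n with
      | zero => rfl
      | succ n ih =>
        rw [pow_succ', Equiv.Perm.mul_apply, ih, chainRot_apply, pow_succ', Equiv.Perm.mul_apply]
        rfl

/-- The map of the chains. -/
noncomputable def chainMap : OnePlaneMap (chainGraph φ) where
  rot := (chainDartEquiv φ).permCongr (ChainDart.rotPerm k)
  rot_isCycleOn := chainRot_isCycleOn φ
  crossed := Set.univ
  cross := ((chainDartEquiv φ).trans (Equiv.Set.univ _).symm).permCongr (ChainDart.crossPerm k)
  cross_cross := by
    rintro ⟨d, hd⟩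
    obtain ⟨x, rfl⟩ := exists_chainDart φ d
    change chainDart φ (ChainDart.crossPerm k ((chainDartEquiv φ).symm (chainDart φ
      (ChainDart.crossPerm k ((chainDartEquiv φ).symm (chainDart φ x)))))) = (chainDart φ x).symm
    rw [chainDartEquiv_symm, chainDartEquiv_symm, ChainDart.crossPerm_crossPerm, chainDart_symm]
  cross_disjoint := by
    rintro ⟨d, hd⟩ v
    obtain ⟨x, rfl⟩ := exists_chainDart φ d
    change v ∈ (chainDart φ x).edge → v ∉ (chainDart φ (ChainDart.crossPerm k
      ((chainDartEquiv φ).symm (chainDart φ x)))).edge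
    rw [chainDartEquiv_symm]
    have hedge : ∀ x : ChainDart k, v ∈ (chainDart φ x).edge ↔
        v = φ (Sum.inl x.1.center) ∨ v = φ (Sum.inr x.1) := by
      rintro ⟨e, _ | _⟩
      · exact Sym2.mem_iff.trans or_comm
      · exact Sym2.mem_iff
    rw [hedge, hedge]
    obtain ⟨⟨a, r, c, i⟩, o⟩ := x
    have hc : ∀ a : Bool, ChainEdge.center (a, r, c, i) ≠ ChainEdge.center (!a, r, c, i) := by
      have : ChainEdge.center (false, r, c, i) ≠ ChainEdge.center (true, r, c, i) := by
        by_cases h : i.1 = 0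
        · simp [ChainEdge.center, h]
        · simp only [ChainEdge.center, if_neg h, ne_eq, Option.some.injEq, Prod.mk.injEq, true_and,
            Fin.ext_iff]
          omega
      rintro (_ | _)
      · exact this
      · exact this.symm
    change (v = φ (Sum.inl (ChainEdge.center (a, r, c, i))) ∨ v = φ (Sum.inr (a, r, c, i))) →
      ¬ (v = φ (Sum.inl (ChainEdge.center (!a, r, c, i))) ∨ v = φ (Sum.inr (!a, r, c, i)))
    rintro (rfl | rfl) (h | h)
    · exact hc a (Sum.inl_injective (φ.injective h))
    · exact Sum.inl_ne_inr (φ.injective h)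
    · exact Sum.inr_ne_inl (φ.injective h)
    · have := Sum.inr_injective (φ.injective h)
      rw [Prod.mk.injEq] at this
      exact absurd this.1 (by cases a <;> simp)

theorem chainMap_rot (x : ChainDart k) :
    (chainMap φ).rot (chainDart φ x) = chainDart φ (ChainDart.rotPerm k x) := chainRot_apply φ x

theorem mem_crossed_chainMap (d : (chainGraph φ).Dart) : d ∈ (chainMap φ).crossed := Set.mem_univ d

theorem chainMap_cross (x : ChainDart k) :
    (chainMap φ).cross ⟨chainDart φ x, mem_crossed_chainMap φ _⟩ =
      ⟨chainDart φ (ChainDart.crossPerm k x), mem_crossed_chainMap φ _⟩ := by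
  refine Subtype.ext ?_
  change chainDart φ (ChainDart.crossPerm k ((chainDartEquiv φ).symm (chainDart φ x))) = _
  rw [chainDartEquiv_symm]

/-- The face to the left of a piece. -/
noncomputable def chainFace : (chainMap φ).Piece → Option (Fin 3 × Fin k)
  | Sum.inl d => ((chainDartEquiv φ).symm d).firstFace
  | Sum.inr d => ((chainDartEquiv φ).symm d).secondFace

/-- The vertex or the crossing at which a piece begins. -/
noncomputable def chainVertex : (chainMap φ).Piece → V ⊕ (Bool × Fin 3 × Fin k)
  | Sum.inl d => Sum.inl d.fst
  | Sum.inr d => Sum.inr ((chainDartEquiv φ).symm d).1.2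

theorem chainFace_inl (x : ChainDart k) : chainFace φ (Sum.inl (chainDart φ x)) = x.firstFace := by
  change ((chainDartEquiv φ).symm (chainDart φ x)).firstFace = _
  rw [chainDartEquiv_symm]

theorem chainFace_inr (x : ChainDart k) :
    chainFace φ (Sum.inr ⟨chainDart φ x, mem_crossed_chainMap φ _⟩) = x.secondFace := by
  change ((chainDartEquiv φ).symm (chainDart φ x)).secondFace = _
  rw [chainDartEquiv_symm]

theorem chainVertex_inr (x : ChainDart k) :
    chainVertex φ (Sum.inr ⟨chainDart φ x, mem_crossed_chainMap φ _⟩) = Sum.inr x.1.2 := by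
  change Sum.inr ((chainDartEquiv φ).symm (chainDart φ x)).1.2 = _
  rw [chainDartEquiv_symm]

theorem chainVertex_vertexPerm (p : (chainMap φ).Piece) :
    chainVertex φ ((chainMap φ).vertexPerm p) = chainVertex φ p := by
  rcases p with d | ⟨d, hd⟩
  · exact congrArg Sum.inl ((chainMap φ).rot_fst d)
  · obtain ⟨x, rfl⟩ := exists_chainDart φ d
    rw [OnePlaneMap.vertexPerm_inr, chainMap_cross, chainVertex_inr]
    exact (chainVertex_inr φ x).symm

/-- Every edge is crossed, so a boundary walk alternates between first and second pieces; it turns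
at a crossing after a first piece and at a vertex after a second one. -/
theorem chainFace_facePerm (p : (chainMap φ).Piece) :
    chainFace φ ((chainMap φ).facePerm p) = chainFace φ p := by
  have hv := (chainMap φ).vertexPerm_facePerm p
  generalize (chainMap φ).facePerm p = q at hv ⊢
  rcases p with d | ⟨d, hd⟩ <;> rcases q with d' | ⟨d', hd'⟩ <;>
    obtain ⟨x, rfl⟩ := exists_chainDart φ d <;> obtain ⟨y, rfl⟩ := exists_chainDart φ d'
  · rw [OnePlaneMap.edgePerm_inl_of_mem _ (mem_crossed_chainMap φ _), OnePlaneMap.vertexPerm_inl] at hv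
    exact (Sum.inl_ne_inr hv).elim
  · rw [OnePlaneMap.edgePerm_inl_of_mem _ (mem_crossed_chainMap φ _), OnePlaneMap.vertexPerm_inr,
      chainMap_cross] at hv
    have h := congrArg Subtype.val (Sum.inr_injective hv)
    dsimp only at h
    rw [chainDart_symm] at h
    have h := (chainDart_bijective φ).1 h
    rw [← ChainDart.crossPerm_crossPerm] at h
    have h := (ChainDart.crossPerm k).injective h
    rw [chainFace_inl, ← ChainDart.secondFace_crossPerm, ← h]
    exact chainFace_inr φ y
  · rw [OnePlaneMap.edgePerm_inr, OnePlaneMap.vertexPerm_inl, chainMap_rot] at hv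
    have h := Sum.inl_injective hv
    dsimp only at h
    rw [chainDart_symm] at h
    have h := (chainDart_bijective φ).1 h
    rw [chainFace_inl, ← ChainDart.secondFace_reverse_rotPerm, h]
    refine Eq.trans ?_ (chainFace_inr φ x).symm
    unfold ChainDart.reverse
    rw [Bool.not_not]
  · rw [OnePlaneMap.edgePerm_inr, OnePlaneMap.vertexPerm_inr] at hv
    exact (Sum.inr_ne_inl hv).elim

/-- Arms are linked to the stems of their level at the crossings, and the stems of the next level
share the center of these arms. So everything is linked to the common center. -/
theorem chainMap_comp_eq [Finite V] (p q : (chainMap φ).Piece) :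
    (chainMap φ).comp p = (chainMap φ).comp q := by
  let M := chainMap φ
  let κ : ChainEdge k → M.Component := fun e => M.comp (Sum.inl (chainDart φ (e, true)))
  have h1 : ∀ (e : ChainEdge k) o, M.comp (Sum.inl (chainDart φ (e, o))) = κ e := by
    rintro e (_ | _)
    · rw [← M.comp_symm, chainDart_symm]
      rfl
    · rfl
  have h2 : ∀ e e' : ChainEdge k, e.center = e'.center → κ e = κ e' := fun e e' h =>
    M.comp_inl_of_fst_eq (by rw [chainDart_true_fst, chainDart_true_fst, h])
  have h3 : ∀ a r c i, κ (a, r, c, i) = κ (!a, r, c, i) := by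
    intro a r c i
    have h := M.comp_vertexPerm (Sum.inr ⟨chainDart φ ((a, r, c, i), true), mem_crossed_chainMap φ _⟩)
    rw [OnePlaneMap.vertexPerm_inr, chainMap_cross, M.comp_inr, M.comp_inr] at h
    dsimp only at h
    rw [h1] at h
    exact h.symm.trans (h1 (!a, r, c, i) _)
  have h4 : ∀ (n : ℕ) (a r : Bool) (c : Fin 3) (i : Fin k), i.1 = n →
      ∀ j : Fin k, j.1 = 0 → κ (a, r, c, i) = κ (false, false, 0, j) := by
    intro n
    induction n with
    | zero =>
      intro a r c i hi j hj
      have : κ (false, r, c, i) = κ (false, false, 0, j) := h2 _ _ (by simp [ChainEdge.center, hi, hj])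
      cases a
      · exact this
      · rw [h3]
        exact this
    | succ n ih =>
      intro a r c i hi j hj
      have : κ (false, r, c, i) = κ (false, false, 0, j) := by
        rw [← ih true r c ⟨n, by omega⟩ rfl j hj]
        refine h2 _ _ ?_
        have h0 : i.1 ≠ 0 := by omega
        simp only [ChainEdge.center, if_neg h0, Option.some.injEq, Prod.mk.injEq, true_and, Fin.ext_iff]
        omega
      cases a
      · exact this
      · rw [h3]
        exact this
  have h5 : ∀ p, ∃ e, M.comp p = κ e := by
    rintro (d | ⟨d, hd⟩) <;> obtain ⟨⟨e, o⟩, rfl⟩ := exists_chainDart φ d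
    · exact ⟨e, h1 e o⟩
    · exact ⟨e, (M.comp_inr _).trans (h1 e o)⟩
  obtain ⟨⟨a, r, c, i⟩, hp⟩ := h5 p
  obtain ⟨⟨a', r', c', i'⟩, hq⟩ := h5 q
  refine hp.trans (Eq.trans ?_ hq.symm)
  rw [h4 _ a r c i rfl ⟨0, i.pos⟩ rfl, h4 _ a' r' c' i' rfl ⟨0, i.pos⟩ rfl]

theorem chainFace_surjective (hk : 0 < k) : Function.Surjective (chainFace φ) := by
  rintro (_ | ⟨c, i⟩)
  · exact ⟨Sum.inl (chainDart φ ((false, false, 0, ⟨0, hk⟩), false)), by rw [chainFace_inl]; rfl⟩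
  · exact ⟨Sum.inl (chainDart φ ((false, false, c, i), true)), by rw [chainFace_inl]; rfl⟩

theorem exists_chainDart_fst (hk : 0 < k) (v : V) : ∃ x : ChainDart k,
    (chainDart φ x).fst = v ∧ x.firstFace = none := by
  obtain ⟨w, rfl⟩ := φ.surjective v
  rcases w with (_ | ⟨c, i⟩) | e
  · exact ⟨((false, true, 0, ⟨0, hk⟩), true), rfl, rfl⟩
  · exact ⟨((true, false, c, i), true), rfl, rfl⟩
  · exact ⟨(e, false), rfl, by simp [ChainDart.firstFace]⟩

theorem chainVertex_surjective (hk : 0 < k) : Function.Surjective (chainVertex φ) := by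
  rintro (v | ⟨r, c, i⟩)
  · obtain ⟨x, hx, -⟩ := exists_chainDart_fst φ hk v
    exact ⟨Sum.inl (chainDart φ x), congrArg Sum.inl hx⟩
  · exact ⟨Sum.inr ⟨chainDart φ ((true, r, c, i), true), mem_crossed_chainMap φ _⟩, chainVertex_inr φ _⟩

theorem chainMap_planar [Finite V] (hk : 0 < k) : (chainMap φ).IsPlanar ∧
    ∀ p q, chainFace φ p = chainFace φ q → (chainMap φ).facePerm.SameCycle p q := by
  refine (chainMap φ).isPlanar_of_labels (chainMap_comp_eq φ) (chainVertex_vertexPerm φ)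
    (chainFace_facePerm φ) (chainVertex_surjective φ hk) (chainFace_surjective φ hk) ?_
  -- The planarization has `48k` darts, `15k + 1` vertices, `6k` crossings and `3k + 1` faces, which
  -- is exactly Euler's formula for a connected map.
  have h1 : Nat.card (chainGraph φ).Dart = 24 * k := by
    rw [← Nat.card_congr (chainDartEquiv φ), Nat.card_eq_fintype_card]
    simp only [Fintype.card_prod, Fintype.card_bool, Fintype.card_fin]
    ring
  have h2 : Nat.card V = 15 * k + 1 := by
    rw [← Nat.card_congr φ, Nat.card_eq_fintype_card]
    simp only [Fintype.card_sum, Fintype.card_option, Fintype.card_prod, Fintype.card_bool,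
      Fintype.card_fin]
    ring
  have h3 : Nat.card (chainMap φ).crossed = 24 * k := by
    rw [← h1]
    exact Nat.card_congr (Equiv.Set.univ _)
  rw [Nat.card_sum, Nat.card_sum, h1, h2, h3, Nat.card_eq_fintype_card, Nat.card_eq_fintype_card]
  simp only [Fintype.card_option, Fintype.card_prod, Fintype.card_bool, Fintype.card_fin]
  omega

/-- The chains as an outer-1-plane graph. -/
noncomputable def chainOuter [Finite V] (hk : 0 < k) : OuterOnePlane (chainGraph φ) where
  toOnePlaneMap := chainMap φ
  planar := (chainMap_planar φ hk).1
  outer := {p | chainFace φ p = none}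
  facePerm_mem_outer p := by
    rw [Set.mem_ofPred_eq, Set.mem_ofPred_eq, chainFace_facePerm]
  outer_sameCycle p hp q hq _ := (chainMap_planar φ hk).2 p q (Eq.trans hp (Eq.symm hq))
  vertex_outer d := by
    obtain ⟨x, h1, h2⟩ := exists_chainDart_fst φ hk d.fst
    exact ⟨chainDart φ x, h1, (chainFace_inl φ x).trans h2⟩

end ChainMap

/-! ### Nested crossings need a large area -/

theorem Fin.strictMono_of_lt_succ {k : ℕ} {f : Fin k → ℤ}
    (h : ∀ (i : ℕ) (hi : i + 1 < k), f ⟨i, by omega⟩ < f ⟨i + 1, hi⟩) : StrictMono f := by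
  cases k with
  | zero => exact fun i => i.elim0
  | succ n => exact Fin.strictMono_iff_lt_succ.2 fun i => h i (by omega)

namespace BarVisRep

variable {V : Type*} {G : SimpleGraph V} {Γ : BarVisRep G}

theorem isBounded_drawing [Finite V] : Bornology.IsBounded Γ.drawing := by
  refine Bornology.IsBounded.union (Bornology.isBounded_iUnion.2 fun v => ?_)
    (Bornology.isBounded_iUnion.2 fun d => ?_)
  · exact (isCompact_Icc.prod isCompact_singleton).isBounded
  · refine Bornology.IsBounded.subset ?_ (openSegment_subset_segment ℝ _ _)
    rw [segment_eq_image']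
    exact (isCompact_Icc.image (by fun_prop)).isBounded

theorem le_ncard_of_bounded {S : Set ℤ} {C : ℝ} (hS : ∀ x ∈ S, |(x : ℝ)| ≤ C) {k : ℕ}
    {f : Fin k → ℤ} (hf : Function.Injective f) (hfS : ∀ i, f i ∈ S) : k ≤ S.ncard := by
  -- An infinite set would have `ncard` zero, so the bound is needed.
  have hfin : S.Finite := by
    refine (Set.finite_Icc (-⌈C⌉) ⌈C⌉).subset fun x hx => ?_
    have h1 := abs_le.1 (hS x hx)
    have h2 := Int.le_ceil C
    constructor
    · have h3 : (-⌈C⌉ : ℝ) ≤ x := by linarith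
      exact_mod_cast h3
    · have h3 : (x : ℝ) ≤ ⌈C⌉ := by linarith
      exact_mod_cast h3
  calc k = (f '' Set.univ).ncard := by
        rw [Set.ncard_image_of_injective _ hf, Set.ncard_univ, Nat.card_fin]
    _ ≤ S.ncard := Set.ncard_le_ncard (by rintro _ ⟨i, -, rfl⟩; exact hfS i) hfin

theorem le_width [Finite V] {k : ℕ} {f : Fin k → ℤ} (hf : Function.Injective f)
    (h : ∀ i, ∃ d, (Γ.attach d).1 = f i) : k ≤ Γ.width := by
  obtain ⟨C, hC⟩ := (isBounded_drawing (Γ := Γ)).exists_norm_le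
  refine le_ncard_of_bounded (C := C) ?_ hf fun i => ?_
  · rintro x ⟨p, hp, hx⟩
    rw [← hx]
    exact (norm_fst_le p).trans (hC p hp)
  · obtain ⟨d, hd⟩ := h i
    refine ⟨Γ.tailPt d, Or.inl (Set.mem_iUnion.2 ⟨_, Γ.tailPt_mem_bar d⟩), ?_⟩
    rw [← hd]
    rfl

theorem le_height [Finite V] {k : ℕ} {f : Fin k → ℤ} (hf : Function.Injective f)
    (h : ∀ i, ∃ v, Γ.row v = f i) : k ≤ Γ.height := by
  obtain ⟨C, hC⟩ := (isBounded_drawing (Γ := Γ)).exists_norm_le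
  refine le_ncard_of_bounded (C := C) ?_ hf fun i => ?_
  · rintro x ⟨p, hp, hx⟩
    rw [← hx]
    exact (norm_snd_le p).trans (hC p hp)
  · obtain ⟨v, hv⟩ := h i
    refine ⟨((Γ.left v : ℝ), (Γ.row v : ℝ)), Or.inl (Set.mem_iUnion.2 ⟨v, ⟨⟨le_rfl, ?_⟩, rfl⟩⟩), ?_⟩
    · change (Γ.left v : ℝ) ≤ Γ.right v
      exact_mod_cast Γ.left_le_right v
    · rw [← hv]

theorem dir_axis (d : G.Dart) : (Γ.dir d).1 = 0 ∨ (Γ.dir d).2 = 0 := by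
  rcases Γ.vec_axis d with h | h
  · exact Or.inl ((Int.cast_eq_zero (α := ℝ)).1 h)
  · exact Or.inr ((Int.cast_eq_zero (α := ℝ)).1 h)

theorem dir_ne_zero {d : G.Dart} (h1 : (Γ.dir d).1 = 0) (h2 : (Γ.dir d).2 = 0) : False :=
  Γ.vec_ne_zero d (Prod.ext (Int.cast_eq_zero.2 h1) (Int.cast_eq_zero.2 h2))

/-- A dart crossing a vertical dart. -/
theorem CrossesFromRight.vertical {d e : G.Dart} (h : Γ.CrossesFromRight d e) (hd : (Γ.dir d).1 = 0) :
    (Γ.dir e).2 = 0 ∧ (Γ.dir d).2 * (Γ.dir e).1 < 0 ∧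
      0 < (Γ.dir d).2 * (Γ.row e.fst - Γ.row d.fst) ∧
      0 < (Γ.dir e).1 * ((Γ.attach d).1 - (Γ.attach e).1) := by
  have h1 : (Γ.dir d).2 * (Γ.dir e).1 < 0 := by
    have := h.2
    rw [hd] at this
    linarith
  have h2 : (Γ.dir e).2 = 0 := by
    rcases dir_axis (Γ := Γ) e with h3 | h3
    · rw [h3] at h1
      simp at h1
    · exact h3
  refine ⟨h2, h1, ?_⟩
  obtain ⟨z, hzd, hze⟩ := h.1
  obtain ⟨t, t0, t1, ht⟩ := Γ.mem_edgeSeg_iff.1 hzd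
  obtain ⟨s, s0, s1, hs⟩ := Γ.mem_edgeSeg_iff.1 hze
  have h3 := ht.symm.trans hs
  have e1 := congrArg Prod.fst h3
  have e2 := congrArg Prod.snd h3
  simp only [tailPt, vec, gridPoint, Prod.fst_add, Prod.snd_add, Prod.smul_fst, Prod.smul_snd,
    smul_eq_mul, hd, h2, Int.cast_zero, mul_zero, add_zero] at e1 e2
  rw [Γ.attach_row, Γ.attach_row] at e2
  have n1 : (Γ.dir d).2 ≠ 0 := left_ne_zero_of_mul h1.ne
  have n2 : (Γ.dir e).1 ≠ 0 := right_ne_zero_of_mul h1.ne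
  have n1 : (0 : ℝ) < (Γ.dir d).2 * (Γ.dir d).2 := by
    have : ((Γ.dir d).2 : ℝ) ≠ 0 := by exact_mod_cast n1
    exact mul_self_pos.2 this
  have n2 : (0 : ℝ) < (Γ.dir e).1 * (Γ.dir e).1 := by
    have : ((Γ.dir e).1 : ℝ) ≠ 0 := by exact_mod_cast n2
    exact mul_self_pos.2 this
  constructor
  · have : (0 : ℝ) < (Γ.dir d).2 * (Γ.row e.fst - Γ.row d.fst) := by
      rw [← e2]
      have := mul_pos t0 n1
      linarith
    exact_mod_cast this
  · have : (0 : ℝ) < (Γ.dir e).1 * ((Γ.attach d).1 - (Γ.attach e).1) := by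
      rw [e1]
      have := mul_pos s0 n2
      linarith
    exact_mod_cast this

theorem mem_edgeSeg_horizontal {d : G.Dart} (hd : (Γ.dir d).2 = 0) {s : ℤ} (hs : s = 1 ∨ s = -1)
    (h : 0 < s * (Γ.dir d).1) {τ : ℝ} (h0 : 0 < τ) (h1 : τ < 1) :
    (((Γ.attach d).1 : ℝ) + τ * s, (Γ.row d.fst : ℝ)) ∈ Γ.edgeSeg d := by
  have hw : (1 : ℝ) ≤ s * (Γ.dir d).1 := by exact_mod_cast h
  have hss : (s : ℝ) * s = 1 := by rcases hs with rfl | rfl <;> norm_num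
  have hw0 : (0 : ℝ) < s * (Γ.dir d).1 := by linarith
  refine Γ.mem_edgeSeg_iff.2 ⟨τ / (s * (Γ.dir d).1), div_pos h0 hw0, ?_, ?_⟩
  · rw [div_lt_one hw0]
    linarith
  · simp only [tailPt, vec, gridPoint, Prod.smul_mk, Prod.mk_add_mk, smul_eq_mul, hd, Int.cast_zero,
      mul_zero, add_zero, Γ.attach_row, Prod.mk.injEq, and_true, add_right_inj]
    rw [div_mul_eq_mul_div, eq_div_iff hw0.ne']
    linear_combination τ * (Γ.dir d).1 * hss

/-- Otherwise the first half unit of the edge would lie in the bar from which it starts. -/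
theorem attach_horizontal {d : G.Dart} (hd : (Γ.dir d).2 = 0) :
    (0 < (Γ.dir d).1 → (Γ.attach d).1 = Γ.right d.fst) ∧
      ((Γ.dir d).1 < 0 → (Γ.attach d).1 = Γ.left d.fst) := by
  have hl := Γ.left_le_attach d
  have hr := Γ.attach_le_right d
  constructor
  · intro h
    by_contra hne
    have hm := mem_edgeSeg_horizontal hd (s := 1) (Or.inl rfl) (by linarith) (τ := 1 / 2)
      (by norm_num) (by norm_num)
    have h1 : (Γ.attach d).1 + 1 ≤ Γ.right d.fst := by omega
    have h1 : ((Γ.attach d).1 : ℝ) + 1 ≤ Γ.right d.fst := by exact_mod_cast h1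
    have h2 : (Γ.left d.fst : ℝ) ≤ (Γ.attach d).1 := by exact_mod_cast hl
    exact Γ.not_mem_bar_of_mem_edgeSeg hm d.fst ⟨⟨by push_cast; linarith, by push_cast; linarith⟩, rfl⟩
  · intro h
    by_contra hne
    have hm := mem_edgeSeg_horizontal hd (s := -1) (Or.inr rfl) (by linarith) (τ := 1 / 2)
      (by norm_num) (by norm_num)
    have h1 : Γ.left d.fst + 1 ≤ (Γ.attach d).1 := by omega
    have h1 : (Γ.left d.fst : ℝ) + 1 ≤ (Γ.attach d).1 := by exact_mod_cast h1
    have h2 : ((Γ.attach d).1 : ℝ) ≤ Γ.right d.fst := by exact_mod_cast hr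
    exact Γ.not_mem_bar_of_mem_edgeSeg hm d.fst ⟨⟨by push_cast; linarith, by push_cast; linarith⟩, rfl⟩

/-- At most one edge leaves a bar in each of the two horizontal directions. -/
theorem eq_of_horizontal {d e : G.Dart} (hde : d.fst = e.fst) (hd : (Γ.dir d).2 = 0)
    (he : (Γ.dir e).2 = 0) (h : 0 < (Γ.dir d).1 * (Γ.dir e).1) : d = e := by
  by_contra hne
  have hedge : d.edge ≠ e.edge := by
    intro h1
    rcases (SimpleGraph.dart_edge_eq_iff d e).1 h1 with h2 | h2
    · exact hne h2
    · rw [h2] at hde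
      exact e.adj.ne hde.symm
  have key : ∀ s : ℤ, (s = 1 ∨ s = -1) → 0 < s * (Γ.dir d).1 → 0 < s * (Γ.dir e).1 →
      (Γ.attach d).1 = (Γ.attach e).1 → False := by
    intro s hs h1 h2 h3
    have m1 := fun (τ : ℝ) (h0 : 0 < τ) (h1' : τ < 1) => mem_edgeSeg_horizontal hd hs h1 h0 h1'
    have m2 := fun (τ : ℝ) (h0 : 0 < τ) (h1' : τ < 1) => mem_edgeSeg_horizontal he hs h2 h0 h1'
    rw [← h3, ← hde] at m2
    have := Γ.edges_no_overlap d e hedge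
      ⟨m1 (1 / 2) (by norm_num) (by norm_num), m2 (1 / 2) (by norm_num) (by norm_num)⟩
      ⟨m1 (1 / 4) (by norm_num) (by norm_num), m2 (1 / 4) (by norm_num) (by norm_num)⟩
    have h4 := congrArg Prod.fst this
    dsimp only at h4
    rcases hs with rfl | rfl <;> norm_num at h4
  have h1 := attach_horizontal hd
  have h2 := attach_horizontal he
  rw [← hde] at h2
  rcases pos_and_pos_or_neg_and_neg_of_mul_pos h with ⟨a, b⟩ | ⟨a, b⟩
  · exact key 1 (Or.inl rfl) (by linarith) (by linarith) ((h1.1 a).trans (h2.1 b).symm)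
  · exact key (-1) (Or.inr rfl) (by linarith) (by linarith) ((h1.2 a).trans (h2.2 b).symm)

theorem place_horizontal {d : G.Dart} (hd : (Γ.dir d).2 = 0) :
    (0 < (Γ.dir d).1 → Γ.place d = 0) ∧
      ((Γ.dir d).1 < 0 → Γ.place d = Γ.right d.fst - Γ.left d.fst + 2) := by
  unfold place
  constructor <;> intro h
  · simp [hd, h]
  · simp [hd, h.not_gt]

theorem place_vertical {d : G.Dart} :
    (0 < (Γ.dir d).2 → 1 ≤ Γ.place d ∧ Γ.place d ≤ Γ.right d.fst - Γ.left d.fst + 1) ∧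
      ((Γ.dir d).2 < 0 → Γ.right d.fst - Γ.left d.fst + 3 ≤ Γ.place d) := by
  have hl := Γ.left_le_attach d
  have hr := Γ.attach_le_right d
  unfold place
  constructor <;> intro h
  · simp only [if_neg h.ne', if_pos h]
    omega
  · simp only [if_neg h.ne, if_neg h.not_gt]
    omega

end BarVisRep

/-! ### Forced directions along a chain -/

section Chain

variable {V : Type*} {k : ℕ} {φ : Option (Fin 3 × Fin k) ⊕ ChainEdge k ≃ V}
  {Γ : BarVisRep (chainGraph φ)}

/-- The stems of a level are vertical, upwards for `s = 1` and downwards for `s = -1`. -/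
def StemsVertical (Γ : BarVisRep (chainGraph φ)) (s : ℤ) (c : Fin 3) (i : Fin k) : Prop :=
  (Γ.dir (chainDart φ ((false, false, c, i), true))).1 = 0 ∧
  (Γ.dir (chainDart φ ((false, true, c, i), true))).1 = 0 ∧
  0 < s * (Γ.dir (chainDart φ ((false, false, c, i), true))).2

theorem chainDart_ne {e e' : ChainEdge k} (h : e ≠ e') :
    chainDart φ (e, true) ≠ chainDart φ (e', true) := fun h' =>
  h (congrArg Prod.fst ((chainDart_bijective φ).1 h'))

/-- The common center has at most one horizontal edge to each side, so among its three pairs of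
stems one pair is vertical. -/
theorem exists_stemsVertical (Γ : BarVisRep (chainGraph φ)) (hk : 0 < k) :
    ∃ s : ℤ, (s = 1 ∨ s = -1) ∧ ∃ c, StemsVertical Γ s c ⟨0, hk⟩ := by
  set S : Bool → Fin 3 → (chainGraph φ).Dart := fun r c => chainDart φ ((false, r, c, ⟨0, hk⟩), true)
  have hfst : ∀ r c r' c', (S r c).fst = (S r' c').fst := fun _ _ _ _ => rfl
  obtain ⟨c, hc⟩ : ∃ c, ∀ r, (Γ.dir (S r c)).1 = 0 := by
    by_contra! hcon
    choose r hr using hcon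
    have h2 : ∀ c, (Γ.dir (S (r c) c)).2 = 0 := fun c =>
      (BarVisRep.dir_axis (Γ := Γ) (S (r c) c)).resolve_left (hr c)
    have key : ∀ c c', c ≠ c' → ¬ 0 < (Γ.dir (S (r c) c)).1 * (Γ.dir (S (r c') c')).1 := by
      intro c c' hcc h
      exact chainDart_ne (φ := φ) (show ((false, r c, c, ⟨0, hk⟩) : ChainEdge k) ≠
        (false, r c', c', ⟨0, hk⟩) by simp [hcc])
        (BarVisRep.eq_of_horizontal (hfst _ _ _ _) (h2 c) (h2 c') h)
    have k1 := key 0 1 (by decide)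
    have k2 := key 0 2 (by decide)
    have k3 := key 1 2 (by decide)
    have r0 := hr 0
    have r1 := hr 1
    have r2 := hr 2
    rcases lt_or_gt_of_ne r0 with r0 | r0 <;> rcases lt_or_gt_of_ne r1 with r1 | r1 <;>
      rcases lt_or_gt_of_ne r2 with r2 | r2 <;>
      first
      | exact k1 (mul_pos r0 r1)
      | exact k2 (mul_pos r0 r2)
      | exact k3 (mul_pos r1 r2)
      | exact k1 (mul_pos_of_neg_of_neg r0 r1)
      | exact k2 (mul_pos_of_neg_of_neg r0 r2)
      | exact k3 (mul_pos_of_neg_of_neg r1 r2)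
  have hn : (Γ.dir (S false c)).2 ≠ 0 := fun h => BarVisRep.dir_ne_zero (hc false) h
  rcases lt_or_gt_of_ne hn with h | h
  · exact ⟨-1, Or.inr rfl, c, hc false, hc true, by change 0 < -1 * (Γ.dir (S false c)).2; linarith⟩
  · exact ⟨1, Or.inl rfl, c, hc false, hc true, by change 0 < 1 * (Γ.dir (S false c)).2; linarith⟩

variable [Finite V] {hk : 0 < k}

theorem crosses_left (hΓ : Γ.EmbeddingPreserving (chainOuter φ hk)) (c : Fin 3) (i : Fin k) :
    Γ.CrossesFromRight (chainDart φ ((false, false, c, i), true))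
      (chainDart φ ((true, false, c, i), true)).symm :=
  (hΓ.crossing _ _).2 ⟨mem_crossed_chainMap φ _, by
    rw [chainDart_symm]
    exact congrArg Subtype.val (chainMap_cross φ _)⟩

theorem crosses_right (hΓ : Γ.EmbeddingPreserving (chainOuter φ hk)) (c : Fin 3) (i : Fin k) :
    Γ.CrossesFromRight (chainDart φ ((false, true, c, i), true))
      (chainDart φ ((true, true, c, i), true)) :=
  (hΓ.crossing _ _).2 ⟨mem_crossed_chainMap φ _, congrArg Subtype.val (chainMap_cross φ _)⟩

/-- The positions of the arms of a level with vertical stems. -/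
theorem StemsVertical.arms (hΓ : Γ.EmbeddingPreserving (chainOuter φ hk)) {s : ℤ}
    (hs : s = 1 ∨ s = -1) {c : Fin 3} {i : Fin k} (h : StemsVertical Γ s c i) :
    ((Γ.dir (chainDart φ ((true, false, c, i), true))).2 = 0 ∧
      0 < s * (Γ.dir (chainDart φ ((true, false, c, i), true))).1) ∧
    ((Γ.dir (chainDart φ ((true, true, c, i), true))).2 = 0 ∧
      s * (Γ.dir (chainDart φ ((true, true, c, i), true))).1 < 0) ∧
    s * Γ.row (chainDart φ ((false, true, c, i), true)).fst < s * Γ.row (φ (Sum.inl (some (c, i)))) ∧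
    s * (Γ.attach (chainDart φ ((false, true, c, i), true))).1 <
      s * (Γ.attach (chainDart φ ((true, true, c, i), true))).1 := by
  obtain ⟨h1, h2, h3⟩ := h
  obtain ⟨a1, a2, -⟩ := (crosses_left hΓ c i).vertical h1
  obtain ⟨b1, b2, b3, b4⟩ := (crosses_right hΓ c i).vertical h2
  rw [Γ.dir_symm, Prod.snd_neg, neg_eq_zero] at a1
  rw [Γ.dir_symm, Prod.fst_neg] at a2
  -- Both arms start at the same bar, so they are not in the same direction. The orientation of each
  -- crossing couples the direction of an arm to that of its stem, so `s` determines all four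
  -- directions.
  have hu := fun h => chainDart_ne (φ := φ)
    (show ((true, false, c, i) : ChainEdge k) ≠ (true, true, c, i) by simp)
    (BarVisRep.eq_of_horizontal (Γ := Γ) rfl a1 b1 h)
  change 0 < _ * (Γ.row (φ (Sum.inl (some (c, i)))) - _) at b3
  generalize (Γ.dir (chainDart φ ((false, false, c, i), true))).2 = L at *
  generalize (Γ.dir (chainDart φ ((false, true, c, i), true))).2 = R at *
  generalize (Γ.dir (chainDart φ ((true, false, c, i), true))).1 = tl at *
  generalize (Γ.dir (chainDart φ ((true, true, c, i), true))).1 = tr at *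
  have hu : tl * tr ≤ 0 := not_lt.1 hu
  rcases hs with rfl | rfl
  · have c1 : 0 < tl := by
      by_contra! hc
      nlinarith
    have c2 : tr < 0 := by
      rcases lt_trichotomy tr 0 with hc | hc | hc
      · exact hc
      · rw [hc] at b2
        simp at b2
      · nlinarith
    have c3 : 0 < R := by
      by_contra! hc
      nlinarith
    have c4 := pos_of_mul_pos_right b3 c3.le
    have c5 := neg_of_mul_pos_right b4 c2.le
    exact ⟨⟨a1, by linarith⟩, ⟨b1, by linarith⟩, by linarith, by linarith⟩
  · have c1 : tl < 0 := by
      by_contra! hc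
      nlinarith
    have c2 : 0 < tr := by
      rcases lt_trichotomy tr 0 with hc | hc | hc
      · nlinarith
      · rw [hc] at b2
        simp at b2
      · exact hc
    have c3 : R < 0 := by
      by_contra! hc
      nlinarith
    have c4 := neg_of_mul_pos_right b3 c3.le
    have c5 := pos_of_mul_pos_right b4 c2.le
    exact ⟨⟨a1, by linarith⟩, ⟨b1, by linarith⟩, by linarith, by linarith⟩

/-- The arms of a level leave only vertical directions for the stems of the next level. -/
theorem StemsVertical.succ (hΓ : Γ.EmbeddingPreserving (chainOuter φ hk)) {s : ℤ}
    (hs : s = 1 ∨ s = -1) {c : Fin 3} {i : ℕ} (hi : i + 1 < k)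
    (h : StemsVertical Γ s c ⟨i, by omega⟩) : StemsVertical Γ s c ⟨i + 1, hi⟩ ∧
      s * (Γ.attach (chainDart φ ((false, true, c, ⟨i, by omega⟩), true))).1 <
        s * (Γ.attach (chainDart φ ((false, true, c, ⟨i + 1, hi⟩), true))).1 := by
  obtain ⟨⟨a1, a2⟩, ⟨b1, b2⟩, -, h4⟩ := h.arms hΓ hs
  set S : Bool → (chainGraph φ).Dart := fun r => chainDart φ ((false, r, c, ⟨i + 1, hi⟩), true) with hS
  set T : Bool → (chainGraph φ).Dart := fun r => chainDart φ ((true, r, c, ⟨i, by omega⟩), true) with hT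
  have hTS : ∀ r r', (S r).fst = (T r').fst := by
    intro r r'
    change φ (Sum.inl (ChainEdge.center (false, r, c, ⟨i + 1, hi⟩))) = φ (Sum.inl (some (c, ⟨i, _⟩)))
    simp [ChainEdge.center]
  have hne : ∀ r r', S r ≠ T r' := fun r r' => chainDart_ne (by simp)
  change (Γ.dir (T false)).2 = 0 at a1
  change 0 < s * (Γ.dir (T false)).1 at a2
  change (Γ.dir (T true)).2 = 0 at b1
  change s * (Γ.dir (T true)).1 < 0 at b2
  change _ < s * (Γ.attach (T true)).1 at h4
  -- The two arms occupy both horizontal directions at the center from which these stems start.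
  have hvert : ∀ r, (Γ.dir (S r)).1 = 0 := by
    intro r
    by_contra h0
    have h1 := (BarVisRep.dir_axis (Γ := Γ) (S r)).resolve_left h0
    have n1 : ¬ 0 < (Γ.dir (S r)).1 * (Γ.dir (T false)).1 := fun h =>
      hne r false (BarVisRep.eq_of_horizontal (hTS r false) h1 a1 h)
    have n2 : ¬ 0 < (Γ.dir (S r)).1 * (Γ.dir (T true)).1 := fun h =>
      hne r true (BarVisRep.eq_of_horizontal (hTS r true) h1 b1 h)
    rcases lt_or_gt_of_ne h0 with h0 | h0 <;> rcases hs with rfl | rfl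
    · exact n2 (mul_pos_of_neg_of_neg h0 (by linarith))
    · exact n1 (mul_pos_of_neg_of_neg h0 (by linarith))
    · exact n1 (mul_pos h0 (by linarith))
    · exact n2 (mul_pos h0 (by linarith))
  have hrot : (chainOuter φ hk).rot (T false) = S false := by
    refine (chainMap_rot φ _).trans ?_
    change chainDart φ (ChainEdge.next (true, false, c, ⟨i, _⟩), true) = _
    simp [ChainEdge.next, hi, hS]
  -- The rotation leads from `T false` immediately to `S false`. If `S false` pointed against `s`,
  -- the arm `T true` at the opposite end of the bar would come in between.
  have hR := hΓ.rotation (T false) (T true) rfl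
  rw [hrot] at hR
  have hn : (Γ.dir (S false)).2 ≠ 0 := fun h => BarVisRep.dir_ne_zero (hvert false) h
  have p1 := BarVisRep.place_horizontal a1
  have p2 := BarVisRep.place_horizontal b1
  have p3 := BarVisRep.place_vertical (Γ := Γ) (d := S false)
  have q1 := BarVisRep.attach_horizontal b1
  have l1 := Γ.left_le_attach (S true)
  have l2 := Γ.attach_le_right (S true)
  have l3 := Γ.left_le_right (T false).fst
  have f1 : (T true).fst = (T false).fst := rfl
  rw [hTS true true] at l1 l2
  rw [hTS false false] at p3
  rw [f1] at p2 q1 l1 l2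
  unfold BarVisRep.CyclicBetween at hR
  refine ⟨⟨hvert false, hvert true, ?_⟩, ?_⟩
  · change 0 < s * (Γ.dir (S false)).2
    rcases hs with rfl | rfl
    · by_contra hc
      have g1 := p1.1 (by linarith)
      have g2 := p2.2 (by linarith)
      have g3 := p3.2 (by omega)
      omega
    · by_contra hc
      have g1 := p1.2 (by linarith)
      have g2 := p2.1 (by linarith)
      have g3 := p3.1 (by omega)
      omega
  -- The arm `T true` leaves from the end of the bar nearest to its stem's column, which lies
  -- strictly beyond this end. So every edge attached to the bar, in particular the next stem, is
  -- still farther on.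
  · change _ < s * (Γ.attach (S true)).1
    rcases hs with rfl | rfl
    · have g2 := q1.2 (by linarith)
      linarith
    · have g2 := q1.1 (by linarith)
      linarith

/-- All representations of the chains have quadratic area. -/
theorem le_area_chain (hΓ : Γ.EmbeddingPreserving (chainOuter φ hk)) : k * k ≤ Γ.area := by
  obtain ⟨s, hs, c, h0⟩ := exists_stemsVertical Γ hk
  have hall : ∀ (i : ℕ) (hi : i < k), StemsVertical Γ s c ⟨i, hi⟩ := by
    intro i
    induction i with
    | zero => exact fun _ => h0
    | succ i ih => exact fun hi => ((ih (by omega)).succ hΓ hs hi).1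
  have hinj : ∀ f : Fin k → ℤ, (∀ (i : ℕ) (hi : i + 1 < k),
      s * f ⟨i, by omega⟩ < s * f ⟨i + 1, hi⟩) → Function.Injective f := by
    intro f hf a b hab
    exact (Fin.strictMono_of_lt_succ (k := k) (f := fun i => s * f i) hf).injective (congrArg (s * ·) hab)
  refine Nat.mul_le_mul
    (BarVisRep.le_width (f := fun i => (Γ.attach (chainDart φ ((false, true, c, i), true))).1)
      (hinj _ fun i hi => ((hall i (by omega)).succ hΓ hs hi).2) fun i => ⟨_, rfl⟩)
    (BarVisRep.le_height (f := fun i => Γ.row (φ (Sum.inl (some (c, i)))))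
      (hinj _ fun i hi => ?_) fun i => ⟨_, rfl⟩)
  have h1 := ((hall (i + 1) hi).arms hΓ hs).2.2.1
  have h2 : (chainDart φ ((false, true, c, (⟨i + 1, hi⟩ : Fin k)), true)).fst =
      φ (Sum.inl (some (c, ⟨i, by omega⟩))) := by
    rw [chainDart_true_fst]
    simp [ChainEdge.center]
  rwa [h2] at h1

end Chain

theorem theorem5 :
    (∃ C : ℝ, ∀ (V : Type*) [Finite V] (G : SimpleGraph V) (E : OuterOnePlane G),
      ∃ Γ : BarVisRep G, Γ.EmbeddingPreserving E ∧ (Γ.area : ℝ) ≤ C * (Nat.card V : ℝ) ^ 2) ∧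
    (∃ c : ℝ, 0 < c ∧ ∀ N : ℕ, ∃ n : ℕ, N ≤ n ∧
      ∃ (G : SimpleGraph (Fin n)) (E : OuterOnePlane G),
        ∀ Γ : BarVisRep G, Γ.EmbeddingPreserving E → c * (n : ℝ) ^ 2 ≤ (Γ.area : ℝ)) := by
  -- The first constant comes from `5n` columns and `n` rows. For the second one, `k = N + 1` levels
  -- have `n = 15k + 1 ≤ 16k` vertices, and `16 ^ 2 = 256`.
  refine ⟨⟨5, fun V _ G E => ?_⟩, 1 / 256, by norm_num, fun N => ?_⟩
  · obtain ⟨Γ, h1, h2⟩ := E.exists_barVisRep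
    refine ⟨Γ, h1, ?_⟩
    calc (Γ.area : ℝ) ≤ ((5 * Nat.card V * Nat.card V : ℕ) : ℝ) := by exact_mod_cast h2
      _ = 5 * (Nat.card V : ℝ) ^ 2 := by push_cast; ring
  · have hcard : Fintype.card (Option (Fin 3 × Fin (N + 1)) ⊕ ChainEdge (N + 1)) =
        15 * (N + 1) + 1 := by
      simp only [Fintype.card_sum, Fintype.card_option, Fintype.card_prod, Fintype.card_bool,
        Fintype.card_fin]
      ring
    refine ⟨15 * (N + 1) + 1, by omega, _, chainOuter (Fintype.equivFinOfCardEq hcard) N.succ_pos,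
      fun Γ hΓ => ?_⟩
    have h : (((N + 1) * (N + 1) : ℕ) : ℝ) ≤ Γ.area := by exact_mod_cast le_area_chain hΓ
    refine le_trans ?_ h
    push_cast
    have hN : (0 : ℝ) ≤ N := Nat.cast_nonneg N
    nlinarith
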